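/- **Setting.** Let $\Omega=[0,2\pi]^2$ (normalized so that the first eigenvalue of the Stokes operator is $1$). Let $\mathcal V$ be the set of $\mathbb R^2$-valued, $\Omega$-periodic, divergence-free trigonometric polynomials with zero average over $\Omega$; let $H$ be the closure of $\mathcal V$ in $L^2(\Omega)^2$, with norm $|\cdot|$ and inner product $\langle\cdot,\cdot\rangle$, and $V$ the closure of $\mathcal V$ in $H^1(\Omega)^2$, with inner product $\langle\!\langle u,w\rangle\!\rangle=\int_\Omega\sum_j\partial_ju\cdot\partial_jw\,dx$ and norm $\|u\|=\langle\!\langle u,u\rangle\!\rangle^{1/2}$. Define $A:V\to V'$ and $B:V\times V\to V'$ by $\langle Au,w\rangle=\langle\!\langle u,w\rangle\!\rangle$ and $\langle B(u,v),w\rangle=\int_\Omega((u\cdot\nabla)v)\cdot w\,dx$. There is an orthonormal basis $(\varphi_m)$ of $H$ with $\varphi_m\in V$, $A\varphi_m=\lambda_m\varphi_m$, $0<\lambda_1\le\lambda_2\le\dots\to\infty$. For any such basis and $s\ge0$ put $A^su=\sum_m\lambda_m^s\langle u,\varphi_m\rangle\varphi_m$ on $D(A^s)=\{u\in H:\sum_m\lambda_m^{2s}\langle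 u,\varphi_m\rangle^2<\infty\}$, with norm $\|u\|_{D(A^s)}=|A^su|$; $D(A)=D(A^1)$. **Expansions.** Let $\mathcal Z=(Z_k)_{k\ge0}$ be real normed spaces, $Z_0\subset Z_1\subset\cdots$ with continuous embeddings, and let $(u_n)_{n\ge1}$ be a sequence in $Z_0$. For $v\in Z_0$, and $\mathcal N=\{1,\dots,K\}$ with $K\ge1$ or $\mathcal N=\mathbb N$, a *relaxed system* on $\mathcal N$ consists of $w_k\in Z_k$, $w^{(k)}_n\in Z_{k-1}$, $\Gamma_{k,n}>0$ ($k\in\mathcal N$, $n\ge1$) such that, as $n\to\infty$, $\Gamma_{1,n}\to0$, $\Gamma_{k+1,n}/\Gamma_{k,n}\to0$ whenever $k,k+1\in\mathcal N$, $\|w^{(k)}_n-w_k\|_{Z_k}\to0$ for all $k\in\mathcal N$; such that $u_n=v+\sum_{j=1}^{k-1}\Gamma_{j,n}w_j+\Gamma_{k,n}w^{(k)}_n$ for all $k\in\mathcal N$, $n\ge1$; and, if $\mathcal N=\{1,\dots,K\}$, such that $w^{(K)}_n=w_K$ for all $n$. * $(u_n)$ has a *strict expansion* in $\mathcal Z$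 with leading vector $v$ if either $u_n=v$ for all $n$; or there is a relaxed system on some $\{1,\dots,K\}$ with $\|w^{(k)}_n\|_{Z_{k-1}}=1$ for all $n\ge1$, $1\le k\le K$; or there are a relaxed system on $\mathbb N$ and integers $N_k$ with $\|w^{(k)}_n\|_{Z_{k-1}}=1$ for all $k\ge1$, $n\ge N_k$. * It has a *unitary expansion* in $\mathcal Z$ with leading vector $v$ if either $u_n=v$ for all $n$, or there is a relaxed system on some $\{1,\dots,K\}$ or on $\mathbb N$ with $\|w_k\|_{Z_k}=1$ for all $k\in\mathcal N$. * It has a *degenerate expansion* in $\mathcal Z$ with leading vector $v$ if there is a relaxed system on $\mathbb N$ such that either $w_k=0$ for all $k$, or for some $N\ge1$ one has $\|w_k\|_{Z_k}=1$ for $k\le N$ and $w_k=0$ for $k>N$. An expansion in a single normed space $Z$ is one in $\mathcal Z=(Z,Z,Z,\dots)$. **Theorem.** Let $g\in H\setminus\{0\}$, let $\alpha_n>0$ with $\alpha_n\to\infty$, and for each $n\in\mathbb N$ let $v_n\in V$ be a weak solution of the steady 2D periodic Navier–Stokes equation $$Av_n+\alpha_nB(v_n,v_n)=g\quad\text{in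 }V'.$$ Then $v_n\in D(A)$ and $|Av_n|\le|g|$ for all $n$, and there are $v\in V$ and a subsequence of $(v_n)$ that converges to $v$ in $V$. Moreover, for every $v\in V$ and every subsequence, still denoted by $(v_n)$, with $v_n\to v$ in $V$, the following hold. (i) For any strictly decreasing sequence $(s_k)_{k\ge0}$ in $(1/2,1)$, there is a subsequence of $(v_n)$ that has a strict expansion with leading vector $v$ in $\mathcal Z=(D(A^{s_k}))_{k\ge0}$. (ii) For any $s\in[1/2,1)$, there is a subsequence of $(v_n)$ that has a unitary expansion or a degenerate expansion with leading vector $v$ in $D(A^s)$. -/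

import Mathlib

open Filter Topology MeasureTheory

noncomputable section

/-! ## Expansions in nested normed spaces -/

/-- A real normed space that sits inside the real vector space `E`: a linear subspace together with
a norm of its own. (The function `norm` is only used on `carrier`.) -/
structure NormedSubspace (E : Type*) [AddCommGroup E] [Module ℝ E] where
  carrier : Submodule ℝ E
  norm : E → ℝ
  norm_add_le : ∀ u ∈ carrier, ∀ v ∈ carrier, norm (u + v) ≤ norm u + norm v
  norm_smul : ∀ (c : ℝ), ∀ u ∈ carrier, norm (c • u) = |c| * norm u
  eq_zero_of_norm : ∀ u ∈ carrier, norm u = 0 → u = 0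

/-- A sequence `Z 0 ⊆ Z 1 ⊆ Z 2 ⊆ ...` of normed spaces with continuous embeddings. -/
structure NestedSpaces (E : Type*) [AddCommGroup E] [Module ℝ E] where
  Z : ℕ → NormedSubspace E
  le : ∀ k, (Z k).carrier ≤ (Z (k + 1)).carrier
  cont : ∀ k, ∃ C : ℝ, ∀ u ∈ (Z k).carrier, (Z (k + 1)).norm u ≤ C * (Z k).norm u

/-- The constant sequence of spaces `Z, Z, Z, ...`. -/
def NestedSpaces.const {E : Type*} [AddCommGroup E] [Module ℝ E] (Z : NormedSubspace E) :
    NestedSpaces E where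
  Z := fun _ => Z
  le := fun _ => le_rfl
  cont := fun _ => ⟨1, fun u _ => (one_mul (Z.norm u)).ge⟩

section Expansions

variable {E : Type*} [AddCommGroup E] [Module ℝ E]

/-- The conditions shared by all nontrivial expansions `u n ≈ v + ∑ k, Γ k n • w k`.
The terms are numbered from `0`, so `Γ k`, `w k`, `r k n` are the `(k+1)`-st coefficient, the
`(k+1)`-st vector `w` and the vector `w_n` whose limit it is; accordingly `w k ∈ Z (k+1)` and
`r k n ∈ Z k`. The set `I` of indices is `{k | k < K}` for a finite expansion with `K` terms
and `Set.univ` for an infinite one. -/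
structure ExpansionTerms (𝒵 : NestedSpaces E) (u : ℕ → E) (v : E) (I : Set ℕ)
    (Γ : ℕ → ℕ → ℝ) (w : ℕ → E) (r : ℕ → ℕ → E) : Prop where
  w_mem : ∀ k ∈ I, w k ∈ (𝒵.Z (k + 1)).carrier
  r_mem : ∀ k ∈ I, ∀ n, r k n ∈ (𝒵.Z k).carrier
  pos : ∀ k ∈ I, ∀ n, 0 < Γ k n
  first : Tendsto (Γ 0) atTop (𝓝 0)
  ratio : ∀ k, k + 1 ∈ I → Tendsto (fun n => Γ (k + 1) n / Γ k n) atTop (𝓝 0)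
  limit : ∀ k ∈ I, Tendsto (fun n => (𝒵.Z (k + 1)).norm (r k n - w k)) atTop (𝓝 0)
  expand : ∀ k ∈ I, ∀ n,
    u n = v + ∑ j ∈ Finset.range k, Γ j n • w j + Γ k n • r k n

/-- The sequence `u` in `Z 0` has a strict expansion in `𝒵` with leading vector `v ∈ Z 0`:
trivial, finite nontrivial (with `K ≥ 1` terms), or infinite. -/
def HasStrictExpansion (𝒵 : NestedSpaces E) (u : ℕ → E) (v : E) : Prop :=
  (∀ n, u n ∈ (𝒵.Z 0).carrier) ∧ v ∈ (𝒵.Z 0).carrier ∧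
  ((∀ n, u n = v) ∨
   (∃ (K : ℕ) (Γ : ℕ → ℕ → ℝ) (w : ℕ → E) (r : ℕ → ℕ → E),
      1 ≤ K ∧ ExpansionTerms 𝒵 u v {k | k < K} Γ w r ∧
      (∀ k < K, ∀ n, (𝒵.Z k).norm (r k n) = 1) ∧
      (∀ n, r (K - 1) n = w (K - 1))) ∨
   (∃ (N : ℕ → ℕ) (Γ : ℕ → ℕ → ℝ) (w : ℕ → E) (r : ℕ → ℕ → E),
      ExpansionTerms 𝒵 u v Set.univ Γ w r ∧
      ∀ k, ∀ n ≥ N k, (𝒵.Z k).norm (r k n) = 1))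

/-- The sequence `u` in `Z 0` has a unitary expansion in `𝒵` with leading vector `v ∈ Z 0`:
the unit vector condition on the `r k n` is dropped, and all vectors `w k` have norm one
(so that the last one of a finite expansion is nonzero). -/
def HasUnitaryExpansion (𝒵 : NestedSpaces E) (u : ℕ → E) (v : E) : Prop :=
  (∀ n, u n ∈ (𝒵.Z 0).carrier) ∧ v ∈ (𝒵.Z 0).carrier ∧
  ((∀ n, u n = v) ∨
   (∃ (K : ℕ) (Γ : ℕ → ℕ → ℝ) (w : ℕ → E) (r : ℕ → ℕ → E),
      1 ≤ K ∧ ExpansionTerms 𝒵 u v {k | k < K} Γ w r ∧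
      (∀ n, r (K - 1) n = w (K - 1)) ∧
      (∀ k < K, (𝒵.Z (k + 1)).norm (w k) = 1)) ∨
   (∃ (Γ : ℕ → ℕ → ℝ) (w : ℕ → E) (r : ℕ → ℕ → E),
      ExpansionTerms 𝒵 u v Set.univ Γ w r ∧
      ∀ k, (𝒵.Z (k + 1)).norm (w k) = 1))

/-- The sequence `u` in `Z 0` has a degenerate expansion in `𝒵` with leading vector `v ∈ Z 0`:
an infinite expansion (without the unit vector condition on the `r k n`) in which either all
vectors `w k` vanish, or, for some `N ≥ 1`, the first `N` of them have norm one and all later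
ones vanish. -/
def HasDegenerateExpansion (𝒵 : NestedSpaces E) (u : ℕ → E) (v : E) : Prop :=
  (∀ n, u n ∈ (𝒵.Z 0).carrier) ∧ v ∈ (𝒵.Z 0).carrier ∧
  ∃ (Γ : ℕ → ℕ → ℝ) (w : ℕ → E) (r : ℕ → ℕ → E),
    ExpansionTerms 𝒵 u v Set.univ Γ w r ∧
    ((∀ k, w k = 0) ∨
     ∃ N : ℕ, 1 ≤ N ∧ (∀ k < N, (𝒵.Z (k + 1)).norm (w k) = 1) ∧ ∀ k ≥ N, w k = 0)

end Expansions

/-! ## The two-dimensional periodic Navier-Stokes setting -/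

namespace NSE

/-- The plane. -/
abbrev Plane : Type := EuclideanSpace ℝ (Fin 2)

/-- The periodic cell `[0, 2π]²`; this is the size for which the first eigenvalue of the
Stokes operator is `1`. -/
def cell : Set Plane := {x | ∀ i, x i ∈ Set.Icc (0 : ℝ) (2 * Real.pi)}

/-- The space `L²(Ω)²` of real vector fields on the cell. -/
abbrev L2 : Type := Lp Plane 2 ((volume : Measure Plane).restrict cell)

/-- The phase `k · x` of the Fourier mode `k ∈ ℤ²`. -/
def phase (k : Fin 2 → ℤ) (x : Plane) : ℝ := ∑ i, (k i : ℝ) * x i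

/-- Real vector-valued trigonometric polynomials with the periods of the cell. -/
def IsTrigPoly (u : Plane → Plane) : Prop :=
  ∃ (S : Finset (Fin 2 → ℤ)) (a b : (Fin 2 → ℤ) → Plane),
    ∀ x, u x = ∑ k ∈ S, (Real.cos (phase k x) • a k + Real.sin (phase k x) • b k)

/-- The classical partial derivative `∂u/∂x_j` of a vector field. -/
def partialD (j : Fin 2) (u : Plane → Plane) (x : Plane) : Plane :=
  fderiv ℝ u x (EuclideanSpace.single j (1 : ℝ))

/-- Divergence-free trigonometric polynomials with zero average over the cell. -/
def smoothFields : Set (Plane → Plane) :=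
  {u | IsTrigPoly u ∧ (∀ x, ∑ j, partialD j u x j = 0) ∧ ∫ x in cell, u x = 0}

/-- The space `H`: the closure of `smoothFields` (a linear space) in `L²(Ω)²`. -/
def spaceH : Submodule ℝ L2 :=
  (Submodule.span ℝ {f : L2 | ∃ u ∈ smoothFields,
    f =ᵐ[(volume : Measure Plane).restrict cell] u}).topologicalClosure

/-- The space `V`: the closure of `smoothFields` in `H¹(Ω)²`. Here `H¹(Ω)²` is regarded, through
`u ↦ (u, (∂₁u, ∂₂u))`, as a closed subspace of the product of copies of `L²(Ω)²`; an element of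
`V` is thus a field together with its weak partial derivatives. -/
def spaceV : Submodule ℝ (L2 × (Fin 2 → L2)) :=
  (Submodule.span ℝ {p : L2 × (Fin 2 → L2) | ∃ u ∈ smoothFields,
    p.1 =ᵐ[(volume : Measure Plane).restrict cell] u ∧
    ∀ j, p.2 j =ᵐ[(volume : Measure Plane).restrict cell] partialD j u}).topologicalClosure

/-- The field underlying an element of `V`. -/
def field (u : spaceV) : L2 := u.1.1

/-- The weak partial derivative `∂u/∂x_j` of an element of `V`. -/
def weakD (j : Fin 2) (u : spaceV) : L2 := u.1.2 j

/-- The inner product of `V`, `∫ ∑ j, ∂_j u · ∂_j w`; this is also the pairing `⟨A u, w⟩` that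
defines `A : V → V'`. -/
def formA (u w : spaceV) : ℝ := ∑ j, inner ℝ (weakD j u) (weakD j w)

/-- The norm of `V`. -/
def normV (u : spaceV) : ℝ := Real.sqrt (formA u u)

/-- The pairing `⟨B(u, v), w⟩ = ∫ ((u · ∇) v) · w` that defines `B : V × V → V'`. -/
def formB (u v w : spaceV) : ℝ :=
  ∫ x in cell, inner ℝ (∑ j, (field u x) j • (weakD j v x)) (field w x)

/-- `v ∈ V` is a (weak) solution of `A v + α B(v, v) = g`, an equation in the dual of `V`. -/
def IsSteadyState (α : ℝ) (g : L2) (v : spaceV) : Prop :=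
  ∀ w : spaceV, formA v w + α * formB v v w = inner ℝ g (field w)

/-- An orthonormal basis of `H` that consists of eigenfunctions of the Stokes operator, with the
eigenvalues in nondecreasing order. (The identity `A (φ n) = λ_n (φ n)` is tested against all of
`V`.) -/
structure StokesEigenbasis where
  φ : ℕ → spaceV
  lam : ℕ → ℝ
  lam_pos : ∀ n, 0 < lam n
  lam_mono : Monotone lam
  lam_tendsto : Tendsto lam atTop atTop
  orthonormal : Orthonormal ℝ (fun n => field (φ n))
  complete : (Submodule.span ℝ (Set.range fun n => field (φ n))).topologicalClosure = spaceH
  eigen : ∀ n, ∀ w : spaceV, formA (φ n) w = lam n * inner ℝ (field (φ n)) (field w)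

namespace StokesEigenbasis

variable (𝔅 : StokesEigenbasis)

/-- The `n`-th coefficient of `A^s u` in the eigenbasis. -/
def coeff (s : ℝ) (u : L2) (n : ℕ) : ℝ := 𝔅.lam n ^ s * inner ℝ (field (𝔅.φ n)) u

/-- The domain `D(A^s)`. -/
def domain (s : ℝ) : Submodule ℝ L2 where
  carrier := {u | u ∈ spaceH ∧ Summable fun n => (𝔅.coeff s u n) ^ 2}
  zero_mem' := ⟨spaceH.zero_mem, by simp [coeff]⟩
  add_mem' := by
    rintro u v ⟨hu, su⟩ ⟨hv, sv⟩
    refine ⟨spaceH.add_mem hu hv, ?_⟩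
    refine Summable.of_nonneg_of_le (fun n => sq_nonneg _) (fun n => ?_)
      ((su.mul_left 2).add (sv.mul_left 2))
    have : 𝔅.coeff s (u + v) n = 𝔅.coeff s u n + 𝔅.coeff s v n := by
      simp [coeff, inner_add_right, mul_add]
    rw [this]
    nlinarith [sq_nonneg (𝔅.coeff s u n - 𝔅.coeff s v n)]
  smul_mem' := by
    rintro c u ⟨hu, su⟩
    refine ⟨spaceH.smul_mem c hu, ?_⟩
    have : (fun n => (𝔅.coeff s (c • u) n) ^ 2) = fun n => c ^ 2 * (𝔅.coeff s u n) ^ 2 := by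
      funext n
      simp only [coeff, inner_smul_right]
      ring
    rw [this]
    exact su.mul_left _

/-- A series in the eigenbasis with square summable coefficients converges. -/
theorem summable_series {c : ℕ → ℝ} (hc : Summable fun n => c n ^ 2) :
    Summable fun n => c n • field (𝔅.φ n) := by
  have h := (𝔅.orthonormal.orthogonalFamily).summable_iff_norm_sq_summable (f := c)
  simp only [LinearIsometry.toSpanSingleton_apply] at h
  rw [h]
  simpa using hc

/-- The operator `A^s u = ∑ λ_n^s ⟨φ_n, u⟩ φ_n`, to be used on `D(A^s)`. -/
def pow (s : ℝ) (u : L2) : L2 := ∑' n, 𝔅.coeff s u n • field (𝔅.φ n)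

theorem pow_add (s : ℝ) {u v : L2} (hu : u ∈ 𝔅.domain s) (hv : v ∈ 𝔅.domain s) :
    𝔅.pow s (u + v) = 𝔅.pow s u + 𝔅.pow s v := by
  unfold pow
  rw [← (𝔅.summable_series hu.2).tsum_add (𝔅.summable_series hv.2)]
  refine tsum_congr fun n => ?_
  simp [coeff, inner_add_right, mul_add, add_smul]

theorem pow_smul (s : ℝ) (c : ℝ) (u : L2) : 𝔅.pow s (c • u) = c • 𝔅.pow s u := by
  unfold pow
  rw [← tsum_const_smul'']
  refine tsum_congr fun n => ?_
  simp only [coeff, inner_smul_right, smul_smul]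
  congr 1
  ring

theorem inner_pow (s : ℝ) {u : L2} (hu : u ∈ 𝔅.domain s) (n : ℕ) :
    inner ℝ (field (𝔅.φ n)) (𝔅.pow s u) = 𝔅.coeff s u n := by
  have h := (𝔅.summable_series hu.2).hasSum.mapL (innerSL ℝ (field (𝔅.φ n)))
  have h2 : HasSum (fun m => innerSL ℝ (field (𝔅.φ n)) (𝔅.coeff s u m • field (𝔅.φ m)))
      (𝔅.coeff s u n) := by
    have : 𝔅.coeff s u n =
        innerSL ℝ (field (𝔅.φ n)) (𝔅.coeff s u n • field (𝔅.φ n)) := by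
      simp [𝔅.orthonormal.1 n]
    conv => arg 2; rw [this]
    refine hasSum_single n fun m hm => ?_
    simp [𝔅.orthonormal.2 hm.symm]
  exact h.unique h2

theorem norm_pow_sq (s : ℝ) {u : L2} (hu : u ∈ 𝔅.domain s) :
    HasSum (fun n => (𝔅.coeff s u n) ^ 2) (‖𝔅.pow s u‖ ^ 2) := by
  have h := (𝔅.summable_series hu.2).hasSum.mapL (innerSL ℝ (𝔅.pow s u))
  have e : (fun n => innerSL ℝ (𝔅.pow s u) (𝔅.coeff s u n • field (𝔅.φ n))) =
      fun n => (𝔅.coeff s u n) ^ 2 := by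
    funext n
    rw [innerSL_apply_apply, inner_smul_right, real_inner_comm, 𝔅.inner_pow s hu]
    ring
  rw [e] at h
  have e2 : innerSL ℝ (𝔅.pow s u) (∑' n, 𝔅.coeff s u n • field (𝔅.φ n)) = ‖𝔅.pow s u‖ ^ 2 := by
    rw [innerSL_apply_apply]
    exact real_inner_self_eq_norm_sq (𝔅.pow s u)
  rwa [e2] at h

theorem eq_zero_of_pow (s : ℝ) {u : L2} (hu : u ∈ 𝔅.domain s) (h0 : 𝔅.pow s u = 0) : u = 0 := by
  have hc : ∀ n, inner ℝ (field (𝔅.φ n)) u = 0 := by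
    intro n
    have h1 := 𝔅.inner_pow s hu n
    rw [h0, inner_zero_right] at h1
    have h2 : 𝔅.lam n ^ s ≠ 0 := (Real.rpow_pos_of_pos (𝔅.lam_pos n) s).ne'
    exact (mul_eq_zero.mp h1.symm).resolve_left h2
  have hmem : u ∈
      (Submodule.span ℝ (Set.range fun n => field (𝔅.φ n))).topologicalClosure := by
    rw [𝔅.complete]; exact hu.1
  have horth : u ∈
      (Submodule.span ℝ (Set.range fun n => field (𝔅.φ n))).topologicalClosureᗮ := by
    rw [Submodule.orthogonal_closure, Submodule.mem_orthogonal]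
    intro x hx
    induction hx using Submodule.span_induction with
    | mem x h => obtain ⟨n, rfl⟩ := h; exact hc n
    | zero => simp
    | add x y _ _ hx hy => rw [inner_add_left, hx, hy, add_zero]
    | smul a x _ hx => rw [inner_smul_left, hx, mul_zero]
  exact inner_self_eq_zero.mp (Submodule.inner_right_of_mem_orthogonal hmem horth)

/-- The normed space `D(A^s)` with the norm `|A^s u|`. -/
def D (s : ℝ) : NormedSubspace L2 where
  carrier := 𝔅.domain s
  norm := fun u => ‖𝔅.pow s u‖
  norm_add_le := fun u hu v hv => by
    rw [𝔅.pow_add s hu hv]; exact norm_add_le (𝔅.pow s u) (𝔅.pow s v)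
  norm_smul := fun c u _ => by
    rw [𝔅.pow_smul, norm_smul, Real.norm_eq_abs]
  eq_zero_of_norm := fun u hu h => 𝔅.eq_zero_of_pow s hu (norm_eq_zero.mp h)

theorem coeff_le {s t : ℝ} (hst : t ≤ s) (u : L2) (n : ℕ) :
    (𝔅.coeff t u n) ^ 2 ≤ (𝔅.lam 0 ^ (t - s)) ^ 2 * (𝔅.coeff s u n) ^ 2 := by
  have h1 : 𝔅.lam n ^ t = 𝔅.lam n ^ (t - s) * 𝔅.lam n ^ s := by
    rw [← Real.rpow_add (𝔅.lam_pos n)]; ring_nf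
  have h2 : 𝔅.lam n ^ (t - s) ≤ 𝔅.lam 0 ^ (t - s) :=
    Real.rpow_le_rpow_of_nonpos (𝔅.lam_pos 0) (𝔅.lam_mono (Nat.zero_le n)) (by linarith)
  have h3 : 0 ≤ 𝔅.lam n ^ (t - s) := (Real.rpow_pos_of_pos (𝔅.lam_pos n) _).le
  have h4 : (𝔅.lam n ^ (t - s)) ^ 2 ≤ (𝔅.lam 0 ^ (t - s)) ^ 2 := pow_le_pow_left₀ h3 h2 2
  have h5 : 𝔅.coeff t u n = 𝔅.lam n ^ (t - s) * 𝔅.coeff s u n := by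
    simp only [coeff]; rw [h1]; ring
  rw [h5, mul_pow]
  exact mul_le_mul_of_nonneg_right h4 (sq_nonneg _)

theorem domain_le {s t : ℝ} (hst : t ≤ s) : 𝔅.domain s ≤ 𝔅.domain t := by
  rintro u ⟨hu, su⟩
  exact ⟨hu, Summable.of_nonneg_of_le (fun n => sq_nonneg _) (fun n => 𝔅.coeff_le hst u n)
    (su.mul_left _)⟩

theorem norm_pow_le {s t : ℝ} (hst : t ≤ s) {u : L2} (hu : u ∈ 𝔅.domain s) :
    ‖𝔅.pow t u‖ ≤ 𝔅.lam 0 ^ (t - s) * ‖𝔅.pow s u‖ := by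
  have hC : 0 ≤ 𝔅.lam 0 ^ (t - s) := (Real.rpow_pos_of_pos (𝔅.lam_pos 0) _).le
  have h1 := 𝔅.norm_pow_sq t (𝔅.domain_le hst hu)
  have h2 := (𝔅.norm_pow_sq s hu).mul_left ((𝔅.lam 0 ^ (t - s)) ^ 2)
  have h3 := hasSum_le (fun n => 𝔅.coeff_le hst u n) h1 h2
  have hb : 0 ≤ ‖𝔅.pow s u‖ := norm_nonneg _
  rw [← mul_pow] at h3
  exact (abs_le_of_sq_le_sq' h3 (mul_nonneg hC hb)).2

/-- The nested spaces `D(A^{s 0}) ⊆ D(A^{s 1}) ⊆ ...` for decreasing exponents. -/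
def nested (s : ℕ → ℝ) (hs : StrictAnti s) : NestedSpaces L2 where
  Z := fun k => 𝔅.D (s k)
  le := fun k => 𝔅.domain_le (hs k.lt_succ_self).le
  cont := fun k => ⟨𝔅.lam 0 ^ (s (k + 1) - s k), fun _ hu =>
    𝔅.norm_pow_le (hs k.lt_succ_self).le hu⟩

end StokesEigenbasis

end NSE

end

noncomputable section

/-! ## Subsequences along a filter on `ℕ` -/

/-! Everything rests on two independent facts: a bound in `D(A)` for steady states that is uniform
in `α`, and an abstract extraction of expansions from compact embeddings.

The a priori bound. In two dimensions `⟨B(z, z), A z⟩ = 0` for smooth divergence-free periodic `z`,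
so formally testing the equation with `A v` gives `|A v| ≤ |g|`. For a weak solution this is
justified by freezing the transport velocity: `v` solves the linear problem `A u + α B(v, u) = g`,
which is coercive because `⟨B(v, u), u⟩ = 0`. Its Galerkin solutions `z` in Fourier modes converge
to `v` in `V`, and testing with `A z` leaves only the error `α⟨B(v - z, z), A z⟩`, bounded by a
multiple of `‖v - z‖ |A z|²`. In the limit `|⟨A v, w⟩| ≤ |g| |w|` for all `w`
(`IsSteadyState.abs_formA_le`), which is the bound in `D(A)` (`IsSteadyState.mem_domain_one`). The
estimates need the embedding of `V` into `L⁴`, proved here by Fourier series: the square of a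
trigonometric polynomial is a sum of convolutions, and a weighted Cauchy–Schwarz inequality applies
since `∑ |k|⁻⁴` converges on `ℤ² \ {0}` (`integral_sum_cas_pow_four_le`).

Compactness. Bounded sets of `D(A^s)` are relatively compact in `D(A^t)` for `t < s`: low modes
converge and high modes are uniformly small (`tendsto_norm_pow`). Thus a subsequence of `v n`
converges in `H`, and `‖u - v‖² ≤ 2|g| |u - v|` for steady states lifts this to `V`.

The expansion. Starting from `R 0 = u - v`, divide each remainder by its norm `Γ k` in `Z k`, let `w
k` be the limit in `Z (k + 1)` of the quotients `r k`, and put `R (k + 1) = R k - Γ k • w k = Γ k •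
(r k - w k)`. Then `Γ (k + 1) / Γ k` is the norm of `r k - w k` and tends to zero. Limits along a
fixed ultrafilter define all `w k` before any subsequence is chosen, so one extraction at the end
suffices (`exists_hasStrictExpansion`). In a single space `D(A^s)` the vectors `w k` of such an
expansion are normalized if none vanishes; otherwise the series is cut at the first zero vector and
continued by artificial scales (`HasStrictExpansion.unitary_or_degenerate`). -/

theorem exists_strictMono_of_eventually {l : Filter ℕ} [l.NeBot] (hl : l ≤ atTop)
    {P : ℕ → ℕ → Prop} (hP : ∀ i, ∀ᶠ n in l, P i n)
    {f : ℕ → ℕ → ℝ} (hf : ∀ j, Tendsto (f j) l (𝓝 0)) :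
    ∃ τ : ℕ → ℕ, StrictMono τ ∧ (∀ i n, i ≤ n → P i (τ n)) ∧
      ∀ j, Tendsto (fun n => f j (τ n)) atTop (𝓝 0) := by
  -- Diagonal choice: stage `n` asks only for the finitely many conditions with index at most `n`,
  -- and these hold jointly along `l`, hence infinitely often.
  have hQ : ∀ n : ℕ, ∃ᶠ m in atTop,
      ∀ i ∈ Finset.range (n + 1), P i m ∧ |f i m| < 1 / ((n : ℝ) + 1) := by
    intro n
    refine Frequently.filter_mono (f := l) (Eventually.frequently ?_) hl
    rw [Filter.eventually_all_finset]
    intro i _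
    refine (hP i).and ?_
    have := (hf i).abs
    rw [abs_zero] at this
    exact this.eventually_lt_const (by positivity)
  obtain ⟨τ, hτ, h⟩ := extraction_forall_of_frequently hQ
  refine ⟨τ, hτ, fun i n hin => (h n i (by simp; omega)).1, fun j => ?_⟩
  refine squeeze_zero_norm' ?_ tendsto_one_div_add_atTop_nhds_zero_nat
  filter_upwards [eventually_ge_atTop j] with n hn
  exact (h n j (by simp; omega)).2.le

/-! ### Elementary properties of the norm of a normed subspace. -/

namespace NormedSubspace

variable {E : Type*} [AddCommGroup E] [Module ℝ E] (Z : NormedSubspace E)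

theorem norm_zero : Z.norm 0 = 0 := by
  simpa using Z.norm_smul 0 0 Z.carrier.zero_mem

theorem norm_neg {u : E} (hu : u ∈ Z.carrier) : Z.norm (-u) = Z.norm u := by
  simpa using Z.norm_smul (-1) u hu

theorem norm_nonneg {u : E} (hu : u ∈ Z.carrier) : 0 ≤ Z.norm u := by
  have h := Z.norm_add_le u hu (-u) (Z.carrier.neg_mem hu)
  rw [add_neg_cancel, Z.norm_zero, Z.norm_neg hu] at h
  linarith

end NormedSubspace

/-! ## Strict expansions from compact embeddings -/

section Expansion

variable {E : Type*} [AddCommGroup E] [Module ℝ E]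

/-- The embeddings `Z k → Z (k + 1)` are compact, expressed with limits along an ultrafilter. -/
def NestedSpaces.CompactAlong (𝒵 : NestedSpaces E) (U : Ultrafilter ℕ) : Prop :=
  ∀ k, ∀ f : ℕ → E, (∀ n, f n ∈ (𝒵.Z k).carrier) → (∀ n, (𝒵.Z k).norm (f n) ≤ 1) →
    ∃ w ∈ (𝒵.Z (k + 1)).carrier, Tendsto (fun n => (𝒵.Z (k + 1)).norm (f n - w)) U (𝓝 0)

open Classical in
/-- The norm, with zero replaced by one. -/
def NormedSubspace.scale (Z : NormedSubspace E) (u : E) : ℝ :=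
  if u = 0 then 1 else Z.norm u

theorem NormedSubspace.scale_pos (Z : NormedSubspace E) {u : E} (hu : u ∈ Z.carrier) :
    0 < Z.scale u := by
  unfold scale
  split_ifs with h
  · exact one_pos
  · exact lt_of_le_of_ne (Z.norm_nonneg hu) fun h0 => h (Z.eq_zero_of_norm u hu h0.symm)

theorem NormedSubspace.scale_of_ne (Z : NormedSubspace E) {u : E} (h : u ≠ 0) :
    Z.scale u = Z.norm u := if_neg h

theorem NormedSubspace.norm_normalize (Z : NormedSubspace E) {u : E} (hu : u ∈ Z.carrier)
    (h : u ≠ 0) : Z.norm ((Z.scale u)⁻¹ • u) = 1 := by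
  have hp := Z.scale_pos hu
  rw [Z.norm_smul _ _ hu, abs_of_pos (inv_pos.mpr hp), Z.scale_of_ne h] at *
  exact inv_mul_cancel₀ hp.ne'

theorem NormedSubspace.norm_normalize_le (Z : NormedSubspace E) {u : E} (hu : u ∈ Z.carrier) :
    Z.norm ((Z.scale u)⁻¹ • u) ≤ 1 := by
  by_cases h : u = 0
  · subst h; rw [smul_zero, Z.norm_zero]; exact zero_le_one
  · exact (Z.norm_normalize hu h).le

/-- Successive remainders of an expansion, for given limit vectors `W k f` of the normalized
remainders `f`. -/
def expansionRemainder (𝒵 : NestedSpaces E) (W : ℕ → (ℕ → E) → E) (f : ℕ → E) : ℕ → ℕ → E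
  | 0 => f
  | k + 1 => fun n =>
      expansionRemainder 𝒵 W f k n -
        (𝒵.Z k).scale (expansionRemainder 𝒵 W f k n) •
          W k (fun m => ((𝒵.Z k).scale (expansionRemainder 𝒵 W f k m))⁻¹ •
            expansionRemainder 𝒵 W f k m)

/-- The greedy construction: the remainder is repeatedly normalized and the ultrafilter limit of its
direction subtracted. The ultrafilter also decides, for each `k`, whether the remainder `R k` is
eventually zero or eventually nonzero, which separates the trivial, finite and infinite cases. -/
theorem exists_hasStrictExpansion (𝒵 : NestedSpaces E) {U : Ultrafilter ℕ}
    (hU : (U : Filter ℕ) ≤ atTop) (hc : 𝒵.CompactAlong U) {u : ℕ → E} {v : E}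
    (hu : ∀ n, u n ∈ (𝒵.Z 0).carrier) (hv : v ∈ (𝒵.Z 0).carrier)
    (h0 : Tendsto (fun n => (𝒵.Z 0).norm (u n - v)) atTop (𝓝 0)) :
    ∃ τ : ℕ → ℕ, StrictMono τ ∧ HasStrictExpansion 𝒵 (fun n => u (τ n)) v := by
  classical
  -- The hypotheses on `f` sit inside the existential, so that `W k` is defined for every sequence
  -- and the remainders can be defined by recursion before their membership in `Z k` is known.
  have hW : ∀ k, ∀ f : ℕ → E, ∃ w : E, (∀ n, f n ∈ (𝒵.Z k).carrier) →
      (∀ n, (𝒵.Z k).norm (f n) ≤ 1) → w ∈ (𝒵.Z (k + 1)).carrier ∧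
        Tendsto (fun n => (𝒵.Z (k + 1)).norm (f n - w)) U (𝓝 0) := by
    intro k f
    by_cases h : (∀ n, f n ∈ (𝒵.Z k).carrier) ∧ (∀ n, (𝒵.Z k).norm (f n) ≤ 1)
    · obtain ⟨w, h1, h2⟩ := hc k f h.1 h.2
      exact ⟨w, fun _ _ => ⟨h1, h2⟩⟩
    · exact ⟨0, fun h1 h2 => absurd ⟨h1, h2⟩ h⟩
  choose W hW using hW
  set R := expansionRemainder 𝒵 W (fun n => u n - v) with hR
  set Γ : ℕ → ℕ → ℝ := fun k n => (𝒵.Z k).scale (R k n) with hΓ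
  set r : ℕ → ℕ → E := fun k n => (Γ k n)⁻¹ • R k n with hr
  set w : ℕ → E := fun k => W k (r k) with hw
  have hRs : ∀ k n, R (k + 1) n = R k n - Γ k n • w k := fun k n => rfl
  have hRm : ∀ k, ∀ n, R k n ∈ (𝒵.Z k).carrier := by
    intro k
    induction k with
    | zero => exact fun n => (𝒵.Z 0).carrier.sub_mem (hu n) hv
    | succ k ih =>
      intro n
      have := hW k (r k) (fun n => (𝒵.Z k).carrier.smul_mem _ (ih n))
        (fun n => (𝒵.Z k).norm_normalize_le (ih n))
      exact (𝒵.Z (k + 1)).carrier.sub_mem (𝒵.le k (ih n))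
        ((𝒵.Z (k + 1)).carrier.smul_mem _ this.1)
  have hrm : ∀ k n, r k n ∈ (𝒵.Z k).carrier := fun k n => (𝒵.Z k).carrier.smul_mem _ (hRm k n)
  have hwr := fun k => hW k (r k) (hrm k) (fun n => (𝒵.Z k).norm_normalize_le (hRm k n))
  have hpos : ∀ k n, 0 < Γ k n := fun k n => (𝒵.Z k).scale_pos (hRm k n)
  have hΓr : ∀ k n, Γ k n • r k n = R k n := fun k n => by
    rw [hr]; exact smul_inv_smul₀ (hpos k n).ne' _
  have hRs' : ∀ k n, R (k + 1) n = Γ k n • (r k n - w k) := fun k n => by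
    rw [hRs, smul_sub, hΓr]
  have hexp : ∀ k n, u n = v + ∑ j ∈ Finset.range k, Γ j n • w j + R k n := by
    intro k n
    induction k with
    | zero => simp [hR, expansionRemainder]
    | succ k ih => rw [Finset.sum_range_succ, hRs, ih]; abel
  have main : ∀ τ : ℕ → ℕ, StrictMono τ →
      (∀ j, Tendsto (fun n => (𝒵.Z (j + 1)).norm (r j (τ n) - w j)) atTop (𝓝 0)) →
      ∀ I : Set ℕ, 0 ∈ I → (∀ k ∈ I, ∀ᶠ n in atTop, R k (τ n) ≠ 0) →
      ExpansionTerms 𝒵 (fun n => u (τ n)) v I (fun k n => Γ k (τ n)) w (fun k n => r k (τ n)) := by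
    intro τ hτ hlim I h0I hI
    refine ⟨fun k _ => (hwr k).1, fun k _ n => hrm k _, fun k _ n => hpos k _, ?_, ?_,
      fun k _ => hlim k, ?_⟩
    · refine Tendsto.congr' ?_ (h0.comp hτ.tendsto_atTop)
      filter_upwards [hI 0 h0I] with n hn
      exact ((𝒵.Z 0).scale_of_ne hn).symm
    · intro k hk
      refine Tendsto.congr' ?_ (hlim k)
      filter_upwards [hI _ hk] with n hn
      have : Γ (k + 1) (τ n) = Γ k (τ n) * (𝒵.Z (k + 1)).norm (r k (τ n) - w k) := by
        rw [hΓ]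
        simp only
        rw [(𝒵.Z (k + 1)).scale_of_ne hn, hRs', (𝒵.Z (k + 1)).norm_smul,
          abs_of_pos (hpos k (τ n))]
        exact (𝒵.Z (k + 1)).carrier.sub_mem (𝒵.le k (hrm k _)) (hwr k).1
      rw [this, mul_div_cancel_left₀ _ (hpos k (τ n)).ne']
    · intro k _ n
      rw [hΓr]
      exact hexp k (τ n)
  have hunit : ∀ k n, R k n ≠ 0 → (𝒵.Z k).norm (r k n) = 1 := fun k n h =>
    (𝒵.Z k).norm_normalize (hRm k n) h
  -- In the finite case `K` is the least index whose remainder vanishes along `U`. For `K = 0` the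
  -- expansion is trivial; for `K ≥ 1`, `R K = Γ (K - 1) • (r (K - 1) - w (K - 1)) = 0` yields the
  -- exact last term.
  by_cases hfin : ∃ k, ∀ᶠ n in (U : Filter ℕ), R k n = 0
  · set K := Nat.find hfin with hK
    have hK0 : ∀ᶠ n in (U : Filter ℕ), R K n = 0 := Nat.find_spec hfin
    have hlt : ∀ k ∈ Finset.range K, ∀ᶠ n in (U : Filter ℕ), R k n ≠ 0 := fun k hk =>
      Ultrafilter.eventually_not.mpr (Nat.find_min hfin (Finset.mem_range.mp hk))
    obtain ⟨τ, hτ, hP, hf⟩ := exists_strictMono_of_eventually hU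
      (P := fun _ n => R K n = 0 ∧ ∀ k ∈ Finset.range K, R k n ≠ 0)
      (fun _ => hK0.and ((Filter.eventually_all_finset _).mpr hlt))
      (fun j => (hwr j).2)
    have hP' : ∀ n, R K (τ n) = 0 ∧ ∀ k < K, R k (τ n) ≠ 0 := fun n =>
      ⟨(hP 0 n n.zero_le).1, fun k hk => (hP 0 n n.zero_le).2 k (Finset.mem_range.mpr hk)⟩
    refine ⟨τ, hτ, fun n => hu _, hv, ?_⟩
    rcases Nat.eq_zero_or_pos K with h | h
    · left
      intro n
      have := (hP' n).1
      rw [h] at this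
      exact sub_eq_zero.mp this
    · right; left
      refine ⟨K, _, w, _, h, main τ hτ hf {k | k < K} h ?_, ?_, ?_⟩
      · exact fun k hk => Eventually.of_forall fun n => (hP' n).2 k hk
      · exact fun k hk n => hunit k _ ((hP' n).2 k hk)
      · intro n
        have h1 := (hP' n).1
        obtain ⟨K', hK'⟩ := Nat.exists_eq_add_of_le' h
        rw [hK'] at h1 ⊢
        rw [hRs'] at h1
        exact sub_eq_zero.mp ((smul_eq_zero.mp h1).resolve_left (hpos _ _).ne')
  · push Not at hfin
    -- Only `R k (τ n) ≠ 0` for `n ≥ k` can be arranged for all `k` at once; this is why the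
    -- thresholds `N k` appear, with `N = id`.
    obtain ⟨τ, hτ, hP, hf⟩ := exists_strictMono_of_eventually hU
      (P := fun k n => R k n ≠ 0) (fun k => hfin k)
      (fun j => (hwr j).2)
    refine ⟨τ, hτ, fun n => hu _, hv, Or.inr (Or.inr
      ⟨id, _, w, _, main τ hτ hf Set.univ trivial ?_, fun k n hn => hunit k _ (hP k n hn)⟩)⟩
    intro k _
    filter_upwards [eventually_ge_atTop k] with n hn using hP k n hn

end Expansion

/-! ## Unitary and degenerate expansions from strict ones -/

section UnitaryDegenerate

variable {E : Type*} [AddCommGroup E] [Module ℝ E] {u : ℕ → E} {v : E} {I : Set ℕ}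
  {Γ : ℕ → ℕ → ℝ} {w : ℕ → E} {r : ℕ → ℕ → E}

theorem ExpansionTerms.to_const {𝒵 : NestedSpaces E} {Z : NormedSubspace E}
    (hle : ∀ k, (𝒵.Z k).carrier ≤ Z.carrier)
    (hcont : ∀ k, ∃ C : ℝ, ∀ u ∈ (𝒵.Z k).carrier, Z.norm u ≤ C * (𝒵.Z k).norm u)
    (h : ExpansionTerms 𝒵 u v I Γ w r) :
    ExpansionTerms (NestedSpaces.const Z) u v I Γ w r where
  w_mem k hk := hle _ (h.w_mem k hk)
  r_mem k hk n := hle _ (h.r_mem k hk n)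
  pos := h.pos
  first := h.first
  ratio := h.ratio
  limit k hk := by
    obtain ⟨C, hC⟩ := hcont (k + 1)
    have hm : ∀ n, r k n - w k ∈ (𝒵.Z (k + 1)).carrier := fun n =>
      (𝒵.Z (k + 1)).carrier.sub_mem (𝒵.le k (h.r_mem k hk n)) (h.w_mem k hk)
    refine squeeze_zero (fun n => Z.norm_nonneg (hle _ (hm n))) (fun n => hC _ (hm n)) ?_
    simpa using (h.limit k hk).const_mul C
  expand := h.expand

/-- The terms of an expansion in a single space can be rescaled to make the nonzero vectors
`w k` unit vectors. -/
theorem ExpansionTerms.normalize {Z : NormedSubspace E}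
    (h : ExpansionTerms (NestedSpaces.const Z) u v I Γ w r) (hI : ∀ k ∈ I, ∀ j < k, j ∈ I) :
    ExpansionTerms (NestedSpaces.const Z) u v I (fun k n => Z.scale (w k) * Γ k n)
      (fun k => (Z.scale (w k))⁻¹ • w k) (fun k n => (Z.scale (w k))⁻¹ • r k n) := by
  have hs : ∀ k ∈ I, 0 < Z.scale (w k) := fun k hk => Z.scale_pos (h.w_mem k hk)
  refine ⟨fun k hk => Z.carrier.smul_mem _ (h.w_mem k hk),
    fun k hk n => Z.carrier.smul_mem _ (h.r_mem k hk n),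
    fun k hk n => mul_pos (hs k hk) (h.pos k hk n), ?_, ?_, ?_, ?_⟩
  · simpa using h.first.const_mul (Z.scale (w 0))
  · intro k hk
    have := (h.ratio k hk).const_mul (Z.scale (w (k + 1)) / Z.scale (w k))
    rw [mul_zero] at this
    refine this.congr fun n => ?_
    rw [div_mul_div_comm]
  · intro k hk
    have := (h.limit k hk).const_mul (Z.scale (w k))⁻¹
    rw [mul_zero] at this
    refine this.congr fun n => ?_
    rw [← smul_sub]
    change _ * Z.norm (r k n - w k) = Z.norm _
    rw [Z.norm_smul _ _ (Z.carrier.sub_mem (h.r_mem k hk n) (h.w_mem k hk)),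
      abs_of_pos (inv_pos.mpr (hs k hk))]
  · intro k hk n
    rw [h.expand k hk n]
    have e : ∀ j ∈ I, ∀ x : E, (Z.scale (w j) * Γ j n) • (Z.scale (w j))⁻¹ • x = Γ j n • x := by
      intro j hj x
      rw [smul_smul]
      congr 1
      field_simp [(hs j hj).ne']
    rw [e k hk]
    congr 2
    refine Finset.sum_congr rfl fun j hj => ?_
    rw [e j (hI k hk j (Finset.mem_range.mp hj))]

/-- If `w N = 0`, then `r N` tends to zero, so the last remainder `Γ N • r N` is of smaller order
than `Γ N`. Infinitely many scales fit in between, all with zero vector, and all later terms of the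
original expansion are discarded. -/
theorem ExpansionTerms.hasDegenerateExpansion {Z : NormedSubspace E}
    (h : ExpansionTerms (NestedSpaces.const Z) u v I Γ w r) (hI : ∀ k ∈ I, ∀ j < k, j ∈ I)
    (hu : ∀ n, u n ∈ Z.carrier) (hv : v ∈ Z.carrier)
    {N : ℕ} (hN : N ∈ I) (hw : w N = 0) (h1 : ∀ k < N, Z.norm (w k) = 1) :
    HasDegenerateExpansion (NestedSpaces.const Z) u v := by
  have hr0 : ∀ n, 0 ≤ Z.norm (r N n) := fun n => Z.norm_nonneg (h.r_mem N hN n)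
  -- The summand `1 / (n + 1)` keeps `ε` positive where `r N n` vanishes.
  set ε : ℕ → ℝ := fun n => Z.norm (r N n) + 1 / ((n : ℝ) + 1) with hε
  have hεpos : ∀ n, 0 < ε n := fun n => add_pos_of_nonneg_of_pos (hr0 n) (by positivity)
  have hεlim : Tendsto ε atTop (𝓝 0) := by
    have := (h.limit N hN).add tendsto_one_div_add_atTop_nhds_zero_nat
    rw [hw, add_zero] at this
    simpa [NestedSpaces.const, hε] using this
  have hεpow : ∀ a : ℝ, 0 < a → Tendsto (fun n => ε n ^ a) atTop (𝓝 0) := by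
    intro a ha
    have := hεlim.rpow_const (p := a) (Or.inr ha.le)
    rwa [Real.zero_rpow ha.ne'] at this
  -- Exponents increasing strictly from `0` and staying below `1`. Then `ε ^ (q (j + 1) - q j)` and
  -- `ε ^ (1 - q j)` both tend to zero, which controls the ratios and the rescaled remainders, while
  -- `q 0 = 0` leaves the coefficient `Γ N` unchanged.
  set q : ℕ → ℝ := fun k => (k : ℝ) / (k + 1) with hq
  have hwN : ∀ k < N, k ∈ I := hI N hN
  refine ⟨hu, hv, fun k n => if k < N then Γ k n else Γ N n * ε n ^ q (k - N),
    fun k => if k < N then w k else 0,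
    fun k n => if k < N then r k n else (ε n ^ q (k - N))⁻¹ • r N n,
    ⟨?_, ?_, ?_, ?_, ?_, ?_, ?_⟩, ?_⟩
  · intro k _
    split_ifs with hk
    · exact h.w_mem k (hwN k hk)
    · exact Z.carrier.zero_mem
  · intro k _ n
    split_ifs with hk
    · exact h.r_mem k (hwN k hk) n
    · exact Z.carrier.smul_mem _ (h.r_mem N hN n)
  · intro k _ n
    split_ifs with hk
    · exact h.pos k (hwN k hk) n
    · exact mul_pos (h.pos N hN n) (Real.rpow_pos_of_pos (hεpos n) _)
  · rcases Nat.eq_zero_or_pos N with h0 | h0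
    · subst h0; simpa [hq] using h.first
    · simpa [h0] using h.first
  · intro k _
    rcases lt_trichotomy (k + 1) N with hk | hk | hk
    · simpa [hk, (Nat.lt_succ_self k).trans hk] using h.ratio k (hwN _ hk)
    · subst hk
      simpa [hq] using h.ratio k hN
    · have h1 : ¬ (k + 1 < N) := by omega
      have h2 : ¬ (k < N) := by omega
      simp only [h1, h2, if_false]
      have h3 : k + 1 - N = (k - N) + 1 := by omega
      rw [h3]
      set j := k - N
      have hqj : 0 < q (j + 1) - q j := by
        simp only [hq]
        push_cast
        rw [sub_pos, div_lt_div_iff₀ (by positivity) (by positivity)]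
        nlinarith
      refine (hεpow _ hqj).congr fun n => ?_
      rw [Real.rpow_sub (hεpos n), mul_div_mul_left _ _ (h.pos N hN n).ne']
  · intro k _
    by_cases hk : k < N
    · simpa [hk] using h.limit k (hwN k hk)
    · simp only [hk, if_false, sub_zero]
      set j := k - N
      have hqj : 0 < 1 - q j := by
        simp only [hq]
        rw [sub_pos, div_lt_one (by positivity)]
        linarith
      refine squeeze_zero (fun n => Z.norm_nonneg (Z.carrier.smul_mem _ (h.r_mem N hN n)))
        (fun n => ?_) (hεpow _ hqj)
      have hp := Real.rpow_pos_of_pos (hεpos n) (q j)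
      change Z.norm _ ≤ _
      rw [Z.norm_smul _ _ (h.r_mem N hN n), abs_of_pos (inv_pos.mpr hp), Real.rpow_sub (hεpos n),
        Real.rpow_one, inv_mul_eq_div]
      gcongr
      exact le_add_of_nonneg_right (by positivity)
  · intro k _ n
    by_cases hk : k < N
    · simp only [hk, if_true]
      rw [h.expand k (hwN k hk) n]
      congr 2
      refine Finset.sum_congr rfl fun j hj => ?_
      simp [(Finset.mem_range.mp hj).trans hk]
    · simp only [hk, if_false]
      have hp := Real.rpow_pos_of_pos (hεpos n) (q (k - N))
      rw [h.expand N hN n, smul_smul, mul_assoc, mul_inv_cancel₀ hp.ne', mul_one]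
      congr 2
      have hsub : Finset.range N ⊆ Finset.range k := by
        intro j hj
        simp only [Finset.mem_range] at *
        omega
      rw [← Finset.sum_subset hsub]
      · refine Finset.sum_congr rfl fun j hj => ?_
        simp [Finset.mem_range.mp hj]
      · intro j _ hj
        have : ¬ j < N := by simpa using hj
        simp [this]
  · rcases Nat.eq_zero_or_pos N with h0 | h0
    · left; intro k; simp [h0]
    · right
      refine ⟨N, h0, fun k hk => ?_, fun k hk => ?_⟩
      · simpa [hk, NestedSpaces.const] using h1 k hk
      · simp [not_lt.mpr hk]

/-- A strict expansion normalizes the `r k n`, each in its own space, and a limit `w k` may well be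
zero. The alternative is whether this happens; the first zero vector, if any, supplies the index at
which to degenerate, even when the strict expansion is finite. -/
theorem HasStrictExpansion.unitary_or_degenerate {𝒵 : NestedSpaces E} {Z : NormedSubspace E}
    (hle : ∀ k, (𝒵.Z k).carrier ≤ Z.carrier)
    (hcont : ∀ k, ∃ C : ℝ, ∀ u ∈ (𝒵.Z k).carrier, Z.norm u ≤ C * (𝒵.Z k).norm u)
    (h : HasStrictExpansion 𝒵 u v) :
    HasUnitaryExpansion (NestedSpaces.const Z) u v ∨
      HasDegenerateExpansion (NestedSpaces.const Z) u v := by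
  classical
  obtain ⟨hu, hv, h⟩ := h
  have hu' : ∀ n, u n ∈ Z.carrier := fun n => hle 0 (hu n)
  have hv' : v ∈ Z.carrier := hle 0 hv
  have key : ∀ (I : Set ℕ) (Γ : ℕ → ℕ → ℝ) (w : ℕ → E) (r : ℕ → ℕ → E),
      ExpansionTerms 𝒵 u v I Γ w r → (∀ k ∈ I, ∀ j < k, j ∈ I) → (∃ k ∈ I, w k = 0) →
      HasDegenerateExpansion (NestedSpaces.const Z) u v := by
    intro I Γ w r ht hI hex
    have hs := Nat.find_spec hex
    refine ((ht.to_const hle hcont).normalize hI).hasDegenerateExpansion hI hu' hv'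
      (N := Nat.find hex) hs.1 (by rw [hs.2, smul_zero]) fun k hk => ?_
    have hkI := hI _ hs.1 k hk
    refine Z.norm_normalize (hle _ (ht.w_mem k hkI)) fun h0 => Nat.find_min hex hk ⟨hkI, h0⟩
  rcases h with h | ⟨K, Γ, w, r, hK, ht, -, hlast⟩ | ⟨-, Γ, w, r, ht, -⟩
  · exact Or.inl ⟨hu', hv', Or.inl h⟩
  · have hI : ∀ k ∈ {k | k < K}, ∀ j < k, j ∈ {k | k < K} := fun k hk j hj => hj.trans hk
    by_cases hex : ∃ k ∈ {k | k < K}, w k = 0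
    · exact Or.inr (key _ Γ w r ht hI hex)
    · push Not at hex
      refine Or.inl ⟨hu', hv', Or.inr (Or.inl ⟨K, _, _, _, hK,
        (ht.to_const hle hcont).normalize hI, fun n => ?_, fun k hk => ?_⟩)⟩
      · simp only [hlast]
      · exact Z.norm_normalize (hle _ (ht.w_mem k hk)) (hex k hk)
  · have hI : ∀ k ∈ (Set.univ : Set ℕ), ∀ j < k, j ∈ (Set.univ : Set ℕ) := fun _ _ _ _ => trivial
    by_cases hex : ∃ k ∈ (Set.univ : Set ℕ), w k = 0
    · exact Or.inr (key _ Γ w r ht hI hex)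
    · push Not at hex
      refine Or.inl ⟨hu', hv', Or.inr (Or.inr ⟨_, _, _,
        (ht.to_const hle hcont).normalize hI, fun k => ?_⟩)⟩
      exact Z.norm_normalize (hle _ (ht.w_mem k trivial)) (hex k trivial)

end UnitaryDegenerate

namespace NSE

/-! ## Fractional powers of the Stokes operator -/

theorem field_mem_spaceH (u : spaceV) : field u ∈ spaceH := by
  have hu := u.2
  unfold spaceV at hu
  unfold spaceH
  rw [← SetLike.mem_coe, Submodule.topologicalClosure_coe] at hu ⊢
  refine map_mem_closure (f := fun p : L2 × (Fin 2 → L2) => p.1) continuous_fst hu ?_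
  intro p hp
  induction hp using Submodule.span_induction with
  | mem p h =>
    obtain ⟨u, hu, h, -⟩ := h
    exact Submodule.subset_span ⟨u, hu, h⟩
  | zero => exact Submodule.zero_mem _
  | add x y _ _ hx hy => exact Submodule.add_mem _ hx hy
  | smul a x _ hx => exact Submodule.smul_mem _ a hx

theorem isClosed_spaceH : IsClosed (spaceH : Set L2) :=
  Submodule.isClosed_topologicalClosure _

namespace StokesEigenbasis

variable (𝔅 : StokesEigenbasis)

theorem mem_domain_of_sum_le {s C : ℝ} (hC : 0 ≤ C) {u : L2} (hu : u ∈ spaceH)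
    (h : ∀ F : Finset ℕ, ∑ m ∈ F, 𝔅.coeff s u m ^ 2 ≤ C ^ 2) :
    u ∈ 𝔅.domain s ∧ ‖𝔅.pow s u‖ ≤ C := by
  have hs : Summable fun m => 𝔅.coeff s u m ^ 2 :=
    summable_of_sum_le (fun _ => sq_nonneg _) h
  have hd : u ∈ 𝔅.domain s := ⟨hu, hs⟩
  refine ⟨hd, ?_⟩
  have h1 := hasSum_le_of_sum_le (𝔅.norm_pow_sq s hd) h
  exact abs_le_of_sq_le_sq' h1 hC |>.2

theorem sum_coeff_sq_le {s C : ℝ} {u : L2} (hu : u ∈ 𝔅.domain s) (hC : ‖𝔅.pow s u‖ ≤ C)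
    (F : Finset ℕ) : ∑ m ∈ F, 𝔅.coeff s u m ^ 2 ≤ C ^ 2 :=
  (sum_le_hasSum F (fun m _ => sq_nonneg _) (𝔅.norm_pow_sq s hu)).trans
    (pow_le_pow_left₀ (norm_nonneg _) hC 2)

/-- Compactness of `D(A^s) → D(A^t)` in coefficient form: the first `M` modes tend to zero one by
one, and the others contribute at most `λ_M ^ (t - s) * C`, which is small for large `M`. -/
theorem tendsto_norm_pow {ι : Type*} {l : Filter ι} {s t C : ℝ} (hts : t < s) {f : ι → L2}
    (hf : ∀ n, f n ∈ 𝔅.domain s) (hC : ∀ n, ‖𝔅.pow s (f n)‖ ≤ C)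
    (h0 : ∀ m, Tendsto (fun n => inner ℝ (field (𝔅.φ m)) (f n)) l (𝓝 0)) :
    Tendsto (fun n => ‖𝔅.pow t (f n)‖) l (𝓝 0) := by
  have hbound : ∀ M n, ‖𝔅.pow t (f n)‖ ^ 2 ≤
      ∑ m ∈ Finset.range M, 𝔅.coeff t (f n) m ^ 2 + (𝔅.lam M ^ (t - s)) ^ 2 * C ^ 2 := by
    intro M n
    have h1 := 𝔅.norm_pow_sq t (𝔅.domain_le hts.le (hf n))
    have h2 := (𝔅.norm_pow_sq s (hf n)).mul_left ((𝔅.lam M ^ (t - s)) ^ 2)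
    have h3 : HasSum (fun m => if m ∈ Finset.range M then 𝔅.coeff t (f n) m ^ 2 else 0)
        (∑ m ∈ Finset.range M, 𝔅.coeff t (f n) m ^ 2) := by
      have := hasSum_sum_of_ne_finset_zero (L := SummationFilter.unconditional ℕ)
        (f := fun m => if m ∈ Finset.range M then 𝔅.coeff t (f n) m ^ 2 else 0)
        (s := Finset.range M) (fun b hb => if_neg hb)
      rwa [Finset.sum_congr rfl fun m hm => if_pos hm] at this
    refine (hasSum_le (fun m => ?_) h1 (h3.add h2)).trans ?_
    · split_ifs with hm
      · exact le_add_of_nonneg_right (by positivity)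
      · rw [zero_add]
        have hm' : M ≤ m := by simpa using hm
        have e : 𝔅.coeff t (f n) m = 𝔅.lam m ^ (t - s) * 𝔅.coeff s (f n) m := by
          simp only [coeff]
          rw [← mul_assoc, ← Real.rpow_add (𝔅.lam_pos m)]
          ring_nf
        rw [e, mul_pow]
        have := Real.rpow_le_rpow_of_nonpos (𝔅.lam_pos M) (𝔅.lam_mono hm') (by linarith : t - s ≤ 0)
        have h0 := (Real.rpow_pos_of_pos (𝔅.lam_pos m) (t - s)).le
        gcongr
    · gcongr
      exact hC n
  have hsq : Tendsto (fun n => ‖𝔅.pow t (f n)‖ ^ 2) l (𝓝 0) := by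
    rw [Metric.tendsto_nhds]
    intro ε hε
    have hM : Tendsto (fun M => (𝔅.lam M ^ (t - s)) ^ 2 * C ^ 2) atTop (𝓝 0) := by
      have := (tendsto_rpow_neg_atTop (sub_pos.mpr hts)).comp 𝔅.lam_tendsto
      simpa [Function.comp_def] using ((this.pow 2).mul_const (C ^ 2))
    obtain ⟨M, hM⟩ := (hM.eventually_lt_const (half_pos hε)).exists
    have hsum : Tendsto (fun n => ∑ m ∈ Finset.range M, 𝔅.coeff t (f n) m ^ 2) l (𝓝 0) := by
      have := tendsto_finsetSum (Finset.range M)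
        (fun m _ => ((h0 m).const_mul (𝔅.lam m ^ t)).pow 2)
      simpa [coeff] using this
    filter_upwards [hsum.eventually_lt_const (half_pos hε)] with n hn
    rw [Real.dist_eq, sub_zero, abs_of_nonneg (sq_nonneg _)]
    linarith [hbound M n]
  simpa using hsq.sqrt

/-- Lower semicontinuity of the norm of `D(A^s)`: each finite partial sum of squared coefficients
passes to the limit. -/
theorem mem_domain_of_tendsto {ι : Type*} {l : Filter ι} [l.NeBot] {s C : ℝ} (hC0 : 0 ≤ C)
    {f : ι → L2} (hf : ∀ n, f n ∈ 𝔅.domain s) (hC : ∀ n, ‖𝔅.pow s (f n)‖ ≤ C)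
    {w : L2} (hw : w ∈ spaceH)
    (h : ∀ m, Tendsto (fun n => inner ℝ (field (𝔅.φ m)) (f n)) l
      (𝓝 (inner ℝ (field (𝔅.φ m)) w))) :
    w ∈ 𝔅.domain s ∧ ‖𝔅.pow s w‖ ≤ C := by
  refine 𝔅.mem_domain_of_sum_le hC0 hw fun F => ?_
  refine le_of_tendsto (tendsto_finsetSum F fun m _ => ((h m).const_mul (𝔅.lam m ^ s)).pow 2)
    (Eventually.of_forall fun n => 𝔅.sum_coeff_sq_le (hf n) (hC n) F)

theorem field_φ_mem (m : ℕ) : field (𝔅.φ m) ∈ spaceH := field_mem_spaceH _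

theorem tsum_mem_spaceH (c : ℕ → ℝ) : ∑' m, c m • field (𝔅.φ m) ∈ spaceH := by
  by_cases hs : Summable fun m => c m • field (𝔅.φ m)
  · exact isClosed_spaceH.mem_of_tendsto hs.hasSum
      (Eventually.of_forall fun F => spaceH.sum_mem fun m _ => spaceH.smul_mem _ (𝔅.field_φ_mem m))
  · rw [tsum_eq_zero_of_not_summable hs]; exact spaceH.zero_mem

theorem inner_tsum {c : ℕ → ℝ} (hc : Summable fun n => c n ^ 2) (n : ℕ) :
    inner ℝ (field (𝔅.φ n)) (∑' m, c m • field (𝔅.φ m)) = c n := by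
  have h := (𝔅.summable_series hc).hasSum.mapL (innerSL ℝ (field (𝔅.φ n)))
  have h2 : HasSum (fun m => innerSL ℝ (field (𝔅.φ n)) (c m • field (𝔅.φ m)))
      (innerSL ℝ (field (𝔅.φ n)) (c n • field (𝔅.φ n))) := by
    refine hasSum_single n fun m hm => ?_
    simp [𝔅.orthonormal.2 hm.symm]
  have := h.unique h2
  simpa [𝔅.orthonormal.1 n] using this

/-- Each coefficient stays in `[-C, C]` and so converges along the ultrafilter. The limits are
square summable by the bound on finite partial sums, and the series they define is the weak limit.
-/
theorem exists_weak_limit {s C : ℝ} (hs : 0 ≤ s) (hC0 : 0 ≤ C) {f : ℕ → L2}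
    (hf : ∀ n, f n ∈ 𝔅.domain s) (hC : ∀ n, ‖𝔅.pow s (f n)‖ ≤ C) (U : Ultrafilter ℕ) :
    ∃ w ∈ 𝔅.domain s, ‖𝔅.pow s w‖ ≤ C ∧
      ∀ m, Tendsto (fun n => inner ℝ (field (𝔅.φ m)) (f n)) U
        (𝓝 (inner ℝ (field (𝔅.φ m)) w)) := by
  have hlim : ∀ m, ∃ a : ℝ, Tendsto (fun n => 𝔅.coeff s (f n) m) U (𝓝 a) := by
    intro m
    have hK : IsCompact (Set.Icc (-C) C) := isCompact_Icc
    obtain ⟨a, -, ha⟩ := hK.ultrafilter_le_nhds (U.map fun n => 𝔅.coeff s (f n) m) (by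
      rw [Ultrafilter.coe_map, le_principal_iff]
      refine Filter.mem_map.mpr (Eventually.of_forall fun n => ?_)
      have := 𝔅.sum_coeff_sq_le (hf n) (hC n) {m}
      rw [Finset.sum_singleton] at this
      exact abs_le_of_sq_le_sq' this hC0)
    exact ⟨a, ha⟩
  choose a ha using hlim
  have hsum : ∀ F : Finset ℕ, ∑ m ∈ F, a m ^ 2 ≤ C ^ 2 := fun F =>
    le_of_tendsto (tendsto_finsetSum F fun m _ => (ha m).pow 2)
      (Eventually.of_forall fun n => 𝔅.sum_coeff_sq_le (hf n) (hC n) F)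
  have hp : ∀ m, 0 < 𝔅.lam m ^ s := fun m => Real.rpow_pos_of_pos (𝔅.lam_pos m) s
  set b : ℕ → ℝ := fun m => (𝔅.lam m ^ s)⁻¹ * a m with hb
  -- Here `s ≥ 0` is needed: the weights `λ_m ^ s` are bounded below by `λ_0 ^ s`, so the limit is
  -- an element of `H`.
  have hbs : Summable fun m => b m ^ 2 := by
    refine Summable.of_nonneg_of_le (fun m => sq_nonneg _) (fun m => ?_)
      ((summable_of_sum_le (fun m => sq_nonneg (a m)) hsum).mul_left (((𝔅.lam 0 ^ s)⁻¹) ^ 2))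
    rw [hb]
    simp only
    rw [mul_pow]
    have h1 : 𝔅.lam 0 ^ s ≤ 𝔅.lam m ^ s :=
      Real.rpow_le_rpow (𝔅.lam_pos 0).le (𝔅.lam_mono m.zero_le) hs
    have h2 := inv_anti₀ (hp 0) h1
    have h3 := (inv_pos.mpr (hp m)).le
    gcongr
  have hi := 𝔅.inner_tsum hbs
  have hw := 𝔅.tsum_mem_spaceH b
  have hconv : ∀ m, Tendsto (fun n => inner ℝ (field (𝔅.φ m)) (f n)) U
        (𝓝 (inner ℝ (field (𝔅.φ m)) (∑' m, b m • field (𝔅.φ m)))) := by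
    intro m
    rw [hi m]
    refine ((ha m).const_mul (𝔅.lam m ^ s)⁻¹).congr fun n => ?_
    rw [coeff, inv_mul_cancel_left₀ (hp m).ne']
  obtain ⟨h1, h2⟩ := 𝔅.mem_domain_of_tendsto hC0 hf hC hw hconv
  exact ⟨_, h1, h2, hconv⟩

theorem pow_sub_le {s C D : ℝ} {u w : L2} (hu : u ∈ 𝔅.domain s) (hw : w ∈ 𝔅.domain s)
    (hC : ‖𝔅.pow s u‖ ≤ C) (hD : ‖𝔅.pow s w‖ ≤ D) : ‖𝔅.pow s (u - w)‖ ≤ C + D := by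
  have h1 : ‖𝔅.pow s (-w)‖ = ‖𝔅.pow s w‖ := (𝔅.D s).norm_neg hw
  have h2 := (𝔅.D s).norm_add_le u hu (-w) ((𝔅.domain s).neg_mem hw)
  rw [← sub_eq_add_neg] at h2
  change ‖𝔅.pow s (u - w)‖ ≤ ‖𝔅.pow s u‖ + ‖𝔅.pow s (-w)‖ at h2
  linarith

theorem tendsto_norm_pow_sub {ι : Type*} {l : Filter ι} {s t C : ℝ} (hts : t < s) {f : ι → L2}
    {w : L2} (hf : ∀ n, f n ∈ 𝔅.domain s) (hC : ∀ n, ‖𝔅.pow s (f n)‖ ≤ C)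
    (hw : w ∈ 𝔅.domain s)
    (h : ∀ m, Tendsto (fun n => inner ℝ (field (𝔅.φ m)) (f n)) l
      (𝓝 (inner ℝ (field (𝔅.φ m)) w))) :
    Tendsto (fun n => ‖𝔅.pow t (f n - w)‖) l (𝓝 0) := by
  refine 𝔅.tendsto_norm_pow hts (fun n => (𝔅.domain s).sub_mem (hf n) hw)
    (fun n => 𝔅.pow_sub_le (hf n) hw (hC n) le_rfl) fun m => ?_
  simpa [inner_sub_right] using (h m).sub_const (inner ℝ (field (𝔅.φ m)) w)

theorem nested_compactAlong {s : ℕ → ℝ} (hs : StrictAnti s) (h0 : ∀ k, 0 ≤ s k)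
    (U : Ultrafilter ℕ) : (𝔅.nested s hs).CompactAlong U := by
  intro k f hf h1
  obtain ⟨w, hw, -, h⟩ := 𝔅.exists_weak_limit (h0 k) zero_le_one hf h1 U
  exact ⟨w, 𝔅.domain_le (hs k.lt_succ_self).le hw,
    𝔅.tendsto_norm_pow_sub (hs k.lt_succ_self) hf h1 hw h⟩

/-- Both sides have the same coefficients, and completeness of the basis in `H` makes them equal. -/
theorem pow_zero_apply {u : L2} (hu : u ∈ spaceH) : 𝔅.pow 0 u = u := by
  have hd : u ∈ 𝔅.domain 0 := by
    refine ⟨hu, ?_⟩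
    have := 𝔅.orthonormal.inner_products_summable u
    simpa [coeff] using this
  have hp : 𝔅.pow 0 u ∈ spaceH := 𝔅.tsum_mem_spaceH _
  have hc : ∀ m, 𝔅.coeff 0 (𝔅.pow 0 u - u) m = 0 := fun m => by
    simp only [coeff]
    rw [inner_sub_right, 𝔅.inner_pow 0 hd m]
    simp [coeff]
  have hd' : 𝔅.pow 0 u - u ∈ 𝔅.domain 0 := ⟨spaceH.sub_mem hp hu, by simp [hc]⟩
  refine sub_eq_zero.mp (𝔅.eq_zero_of_pow 0 hd' ?_)
  change ∑' m, 𝔅.coeff 0 (𝔅.pow 0 u - u) m • field (𝔅.φ m) = 0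
  simp [hc]

end StokesEigenbasis

end NSE

namespace NSE

/-! ## The functions `cos (k · x) + sin (k · x)` -/

theorem isCompact_cell : IsCompact cell := by
  have h : IsCompact (Set.univ.pi fun _ : Fin 2 => Set.Icc (0 : ℝ) (2 * Real.pi)) :=
    isCompact_univ_pi fun _ => isCompact_Icc
  have := (EuclideanSpace.equiv (Fin 2) ℝ).toHomeomorph.isCompact_preimage.mpr h
  convert this using 1
  ext x
  simp only [cell, Set.mem_ofPred_eq, Set.mem_preimage, Set.mem_univ_pi]
  rfl

instance : IsFiniteMeasure ((volume : Measure Plane).restrict cell) :=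
  isFiniteMeasure_restrict.mpr isCompact_cell.measure_lt_top.ne

theorem phase_add (k l : Fin 2 → ℤ) (x : Plane) : phase (k + l) x = phase k x + phase l x := by
  simp [phase, add_mul, Finset.sum_add_distrib]

theorem phase_neg (k : Fin 2 → ℤ) (x : Plane) : phase (-k) x = -phase k x := by
  simp only [phase, Pi.neg_apply, Int.cast_neg, neg_mul, Finset.sum_neg_distrib]

theorem phase_sub (k l : Fin 2 → ℤ) (x : Plane) : phase (k - l) x = phase k x - phase l x := by
  rw [sub_eq_add_neg, phase_add, phase_neg, sub_eq_add_neg]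

theorem integral_Icc_exp (k : ℤ) :
    ∫ t in Set.Icc (0 : ℝ) (2 * Real.pi), Complex.exp (((k : ℝ) * t : ℝ) * Complex.I) =
      if k = 0 then (2 * Real.pi : ℂ) else 0 := by
  rw [integral_Icc_eq_integral_Ioc, ← intervalIntegral.integral_of_le (by positivity)]
  split_ifs with h
  · subst h; simp
  · have hk : (k : ℂ) * Complex.I ≠ 0 := by simp [h]
    have := integral_exp_mul_complex (a := 0) (b := 2 * Real.pi) hk
    have e : (fun t : ℝ => Complex.exp (((k : ℝ) * t : ℝ) * Complex.I)) =
        fun t : ℝ => Complex.exp ((k : ℂ) * Complex.I * t) := by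
      funext t; push_cast; ring_nf
    rw [e, this]
    have h2 : Complex.exp ((k : ℂ) * Complex.I * ((2 * Real.pi : ℝ) : ℂ)) = 1 := by
      rw [← Complex.exp_int_mul_two_pi_mul_I k]; push_cast; ring_nf
    rw [h2]; simp

/-- Fubini's theorem: the exponential factors over the two coordinates. -/
theorem integral_cell_exp (k : Fin 2 → ℤ) :
    ∫ x in cell, Complex.exp ((phase k x : ℝ) * Complex.I) =
      if k = 0 then ((2 * Real.pi) ^ 2 : ℂ) else 0 := by
  have hpre : cell = (MeasurableEquiv.toLp 2 (Fin 2 → ℝ)).symm ⁻¹'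
      (Set.univ.pi fun _ : Fin 2 => Set.Icc (0 : ℝ) (2 * Real.pi)) := by
    ext x
    simp only [cell, Set.mem_ofPred_eq, Set.mem_preimage, Set.mem_univ_pi]
    rfl
  have hmp := EuclideanSpace.volume_preserving_symm_measurableEquiv_toLp (Fin 2)
  have h1 := hmp.setIntegral_preimage_emb (MeasurableEquiv.measurableEmbedding _)
    (fun y : Fin 2 → ℝ => ∏ i, Complex.exp (((k i : ℝ) * y i : ℝ) * Complex.I))
    (Set.univ.pi fun _ : Fin 2 => Set.Icc (0 : ℝ) (2 * Real.pi))
  rw [← hpre] at h1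
  have e : ∀ x : Plane, Complex.exp ((phase k x : ℝ) * Complex.I) =
      ∏ i, Complex.exp (((k i : ℝ) * (MeasurableEquiv.toLp 2 (Fin 2 → ℝ)).symm x i : ℝ)
        * Complex.I) := by
    intro x
    rw [← Complex.exp_sum]
    simp [phase, Fin.sum_univ_two, add_mul]
  simp_rw [e]
  rw [h1, volume_pi, Measure.restrict_pi_pi]
  rw [integral_fintype_prod_eq_prod (fun i t => Complex.exp (((k i : ℝ) * t : ℝ) * Complex.I))]
  simp_rw [integral_Icc_exp]
  rw [Fin.prod_univ_two]
  have hk : k = 0 ↔ k 0 = 0 ∧ k 1 = 0 := by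
    constructor
    · rintro rfl; simp
    · rintro ⟨h0, h1⟩; ext i; fin_cases i <;> simpa
  by_cases h0 : k 0 = 0 <;> by_cases h1 : k 1 = 0 <;> simp [hk, h0, h1, sq]

theorem continuous_phase (k : Fin 2 → ℤ) : Continuous (phase k) := by
  unfold phase; fun_prop

theorem _root_.Continuous.integrableOn_cell {F : Type*} [NormedAddCommGroup F] {f : Plane → F}
    (hf : Continuous f) : Integrable f ((volume : Measure Plane).restrict cell) :=
  hf.continuousOn.integrableOn_compact isCompact_cell

theorem integral_cell_cos_sin (k : Fin 2 → ℤ) :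
    (∫ x in cell, Real.cos (phase k x) = if k = 0 then (2 * Real.pi) ^ 2 else 0) ∧
      ∫ x in cell, Real.sin (phase k x) = 0 := by
  have hc := continuous_phase k
  have hi : Integrable (fun x => Complex.exp ((phase k x : ℝ) * Complex.I))
    ((volume : Measure Plane).restrict cell) := Continuous.integrableOn_cell (by fun_prop)
  have h1 := Complex.reCLM.integral_comp_comm hi
  have h2 := Complex.imCLM.integral_comp_comm hi
  rw [integral_cell_exp] at h1 h2
  simp only [Complex.reCLM_apply, Complex.imCLM_apply, Complex.exp_ofReal_mul_I_re,
    Complex.exp_ofReal_mul_I_im] at h1 h2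
  rw [h1, h2]
  constructor
  · split_ifs
    · rw [← Complex.ofReal_re ((2 * Real.pi) ^ 2)]; push_cast; rfl
    · rfl
  · split_ifs
    · rw [← Complex.ofReal_im ((2 * Real.pi) ^ 2)]; push_cast; rfl
    · rfl

/-- The function `cos (k · x) + sin (k · x)`. -/
def cas (k : Fin 2 → ℤ) (x : Plane) : ℝ := Real.cos (phase k x) + Real.sin (phase k x)

theorem continuous_cas (k : Fin 2 → ℤ) : Continuous (cas k) := by
  have := continuous_phase k
  unfold cas; fun_prop

theorem cas_mul_cas (k l : Fin 2 → ℤ) (x : Plane) :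
    cas k x * cas l x = Real.cos (phase (k - l) x) + Real.sin (phase (k + l) x) := by
  rw [phase_sub, phase_add, Real.cos_sub, Real.sin_add, cas, cas]
  ring

theorem cos_phase_eq (k : Fin 2 → ℤ) (x : Plane) :
    Real.cos (phase k x) = (cas k x + cas (-k) x) / 2 := by
  simp only [cas, phase_neg, Real.cos_neg, Real.sin_neg]; ring

theorem sin_phase_eq (k : Fin 2 → ℤ) (x : Plane) :
    Real.sin (phase k x) = (cas k x - cas (-k) x) / 2 := by
  simp only [cas, phase_neg, Real.cos_neg, Real.sin_neg]; ring

/-- The sine in the product formula integrates to zero and the cosine survives only for `k = l`. So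
a single real family indexed by `ℤ²` is orthogonal and replaces the pairs of sines and cosines. -/
theorem integral_cas_mul_cas (k l : Fin 2 → ℤ) :
    ∫ x in cell, cas k x * cas l x = if k = l then (2 * Real.pi) ^ 2 else 0 := by
  have h1 := continuous_phase (k - l)
  have h2 := continuous_phase (k + l)
  simp_rw [cas_mul_cas]
  rw [integral_add (Continuous.integrableOn_cell (by fun_prop))
    (Continuous.integrableOn_cell (by fun_prop)), (integral_cell_cos_sin _).1,
    (integral_cell_cos_sin _).2, add_zero]
  simp [sub_eq_zero]

theorem cas_zero (x : Plane) : cas 0 x = 1 := by simp [cas, phase]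

theorem integral_cas (k : Fin 2 → ℤ) :
    ∫ x in cell, cas k x = if k = 0 then (2 * Real.pi) ^ 2 else 0 := by
  rw [← integral_cas_mul_cas]
  simp [cas_zero]

/-- The derivative of a scalar function in the direction of the `j`-th coordinate. -/
def pderiv (j : Fin 2) (f : Plane → ℝ) (x : Plane) : ℝ :=
  fderiv ℝ f x (EuclideanSpace.single j (1 : ℝ))

theorem hasFDerivAt_phase (k : Fin 2 → ℤ) (x : Plane) :
    HasFDerivAt (phase k) (∑ i, (k i : ℝ) • (EuclideanSpace.proj i : Plane →L[ℝ] ℝ)) x := by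
  have : phase k = ⇑(∑ i, (k i : ℝ) • (EuclideanSpace.proj i : Plane →L[ℝ] ℝ)) := by
    funext x; simp [phase]
  rw [this]
  exact ContinuousLinearMap.hasFDerivAt _

theorem differentiable_cas (k : Fin 2 → ℤ) : Differentiable ℝ (cas k) := fun x =>
  ((hasFDerivAt_phase k x).cos.add (hasFDerivAt_phase k x).sin).differentiableAt

theorem pderiv_cas (j : Fin 2) (k : Fin 2 → ℤ) : pderiv j (cas k) = (k j : ℝ) • cas (-k) := by
  funext x
  have h := ((hasFDerivAt_phase k x).cos.add (hasFDerivAt_phase k x).sin).fderiv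
  have e : cas k = (fun x => Real.cos (phase k x)) + fun x => Real.sin (phase k x) := rfl
  rw [pderiv, e, h]
  simp [cas, phase_neg, Fin.sum_univ_two]
  fin_cases j <;> simp <;> ring

end NSE

namespace NSE

/-! ## The algebra of real trigonometric polynomials -/

/-- Closure under products makes the trigonometric polynomials a commutative algebra with
derivations, in which pointwise identities of vector calculus can be checked by `ring`. -/
theorem mem_span_cas_mul {f g : Plane → ℝ} (hf : f ∈ Submodule.span ℝ (Set.range cas))
    (hg : g ∈ Submodule.span ℝ (Set.range cas)) : f * g ∈ Submodule.span ℝ (Set.range cas) := by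
  induction hf using Submodule.span_induction with
  | zero => rw [zero_mul]; exact Submodule.zero_mem _
  | add x y _ _ hx hy => rw [add_mul]; exact Submodule.add_mem _ hx hy
  | smul a x _ hx => rw [smul_mul_assoc]; exact Submodule.smul_mem _ _ hx
  | mem f hf =>
    obtain ⟨k, rfl⟩ := hf
    induction hg using Submodule.span_induction with
    | zero => rw [mul_zero]; exact Submodule.zero_mem _
    | add x y _ _ hx hy => rw [mul_add]; exact Submodule.add_mem _ hx hy
    | smul a x _ hx => rw [mul_smul_comm]; exact Submodule.smul_mem _ _ hx
    | mem g hg =>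
      obtain ⟨l, rfl⟩ := hg
      have e : cas k * cas l = (1 / 2 : ℝ) • (cas (k - l) + cas (-(k - l))) +
          (1 / 2 : ℝ) • (cas (k + l) - cas (-(k + l))) := by
        funext x
        rw [Pi.mul_apply, cas_mul_cas, cos_phase_eq, sin_phase_eq]
        simp only [Pi.add_apply, Pi.smul_apply, Pi.sub_apply, smul_eq_mul]
        ring
      rw [e]
      have h : ∀ p, cas p ∈ Submodule.span ℝ (Set.range cas) := fun p =>
        Submodule.subset_span ⟨p, rfl⟩
      exact Submodule.add_mem _ (Submodule.smul_mem _ _ (Submodule.add_mem _ (h _) (h _)))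
        (Submodule.smul_mem _ _ (Submodule.sub_mem _ (h _) (h _)))

/-- The algebra of real trigonometric polynomials. -/
def trigAlg : Subalgebra ℝ (Plane → ℝ) :=
  (Submodule.span ℝ (Set.range cas)).toSubalgebra
    (Submodule.subset_span ⟨0, funext cas_zero⟩) (fun _ _ => mem_span_cas_mul)

theorem mem_trigAlg {f : Plane → ℝ} : f ∈ trigAlg ↔ f ∈ Submodule.span ℝ (Set.range cas) := by
  exact Submodule.mem_toSubalgebra

theorem cas_mem_trigAlg (k : Fin 2 → ℤ) : cas k ∈ trigAlg :=
  mem_trigAlg.mpr (Submodule.subset_span ⟨k, rfl⟩)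

theorem differentiable_of_mem_trigAlg {f : Plane → ℝ} (hf : f ∈ trigAlg) :
    Differentiable ℝ f := by
  rw [mem_trigAlg] at hf
  induction hf using Submodule.span_induction with
  | zero => exact differentiable_const 0
  | add x y _ _ hx hy => exact hx.add hy
  | smul a x _ hx => exact hx.const_smul a
  | mem f hf => obtain ⟨k, rfl⟩ := hf; exact differentiable_cas k

theorem pderiv_add (j : Fin 2) {f g : Plane → ℝ} (hf : Differentiable ℝ f)
    (hg : Differentiable ℝ g) : pderiv j (f + g) = pderiv j f + pderiv j g := by
  funext x
  simp [pderiv, fderiv_add (hf x) (hg x)]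

theorem pderiv_smul (j : Fin 2) (c : ℝ) (f : Plane → ℝ) :
    pderiv j (c • f) = c • pderiv j f := by
  funext x
  simp [pderiv, fderiv_const_smul_field]

theorem pderiv_mul (j : Fin 2) {f g : Plane → ℝ} (hf : Differentiable ℝ f)
    (hg : Differentiable ℝ g) : pderiv j (f * g) = f * pderiv j g + g * pderiv j f := by
  funext x
  simp [pderiv, fderiv_mul (hf x) (hg x)]

theorem pderiv_zero (j : Fin 2) : pderiv j 0 = 0 := by
  simpa using pderiv_smul j 0 0

theorem pderiv_mem_trigAlg (j : Fin 2) {f : Plane → ℝ} (hf : f ∈ trigAlg) :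
    pderiv j f ∈ trigAlg := by
  have hf' := mem_trigAlg.mp hf
  induction hf' using Submodule.span_induction with
  | zero => rw [pderiv_zero]; exact trigAlg.zero_mem
  | add x y hx' hy' hx hy =>
    rw [← mem_trigAlg] at hx' hy'
    rw [pderiv_add j (differentiable_of_mem_trigAlg hx') (differentiable_of_mem_trigAlg hy')]
    exact trigAlg.add_mem (hx hx') (hy hy')
  | smul a x hx' hx =>
    rw [pderiv_smul]
    exact trigAlg.smul_mem (hx (mem_trigAlg.mpr hx')) a
  | mem f hm =>
    obtain ⟨k, rfl⟩ := hm
    rw [pderiv_cas]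
    exact trigAlg.smul_mem (cas_mem_trigAlg _) _

/-- The partial derivatives, as derivations of the algebra of trigonometric polynomials. -/
def trigD (j : Fin 2) : Derivation ℝ trigAlg trigAlg :=
  Derivation.mk'
    { toFun := fun f => ⟨pderiv j f, pderiv_mem_trigAlg j f.2⟩
      map_add' := fun f g => Subtype.ext
        (pderiv_add j (differentiable_of_mem_trigAlg f.2) (differentiable_of_mem_trigAlg g.2))
      map_smul' := fun c f => Subtype.ext (pderiv_smul j c f) }
    (fun f g => Subtype.ext
      (pderiv_mul j (differentiable_of_mem_trigAlg f.2) (differentiable_of_mem_trigAlg g.2)))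

theorem continuous_of_mem_trigAlg {f : Plane → ℝ} (hf : f ∈ trigAlg) : Continuous f :=
  (differentiable_of_mem_trigAlg hf).continuous

/-- The integral over the cell. -/
def trigInt : trigAlg →ₗ[ℝ] ℝ where
  toFun f := ∫ x in cell, (f : Plane → ℝ) x
  map_add' f g := integral_add (continuous_of_mem_trigAlg f.2).integrableOn_cell
    (continuous_of_mem_trigAlg g.2).integrableOn_cell
  map_smul' c _ := integral_const_mul c _

theorem trigAlg_induction {p : trigAlg → Prop} (h0 : ∀ k, p ⟨cas k, cas_mem_trigAlg k⟩)
    (hadd : ∀ f g, p f → p g → p (f + g)) (hsmul : ∀ (c : ℝ) f, p f → p (c • f))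
    (f : trigAlg) : p f := by
  obtain ⟨f, hf⟩ := f
  have hf' := mem_trigAlg.mp hf
  have key : ∃ h : f ∈ trigAlg, p ⟨f, h⟩ := by
    induction hf' using Submodule.span_induction with
    | zero => exact ⟨trigAlg.zero_mem, by
        have := hsmul 0 _ (h0 0)
        rwa [zero_smul] at this⟩
    | add x y hx' hy' hx hy =>
      obtain ⟨hx, px⟩ := hx (mem_trigAlg.mpr hx')
      obtain ⟨hy, py⟩ := hy (mem_trigAlg.mpr hy')
      exact ⟨trigAlg.add_mem hx hy, hadd _ _ px py⟩
    | smul a x hx' hx =>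
      obtain ⟨hx, px⟩ := hx (mem_trigAlg.mpr hx')
      exact ⟨trigAlg.smul_mem hx a, hsmul a _ px⟩
    | mem f hm => obtain ⟨k, rfl⟩ := hm; exact ⟨cas_mem_trigAlg k, h0 k⟩
  exact key.2

theorem trigD_cas (j : Fin 2) (k : Fin 2 → ℤ) :
    trigD j ⟨cas k, cas_mem_trigAlg k⟩ = (k j : ℝ) • ⟨cas (-k), cas_mem_trigAlg (-k)⟩ :=
  Subtype.ext (pderiv_cas j k)

/-- This is integration by parts for periodic functions; the derivative of a mode has no constant
term. -/
theorem trigInt_trigD (j : Fin 2) (f : trigAlg) : trigInt (trigD j f) = 0 := by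
  induction f using trigAlg_induction with
  | h0 k =>
    rw [trigD_cas, map_smul]
    by_cases hk : k = 0
    · simp [hk]
    · change (k j : ℝ) * ∫ x in cell, cas (-k) x = 0
      simp [integral_cas, hk]
  | hadd f g hf hg => rw [map_add, map_add, hf, hg, add_zero]
  | hsmul c f hf => rw [Derivation.map_smul, map_smul, hf, smul_zero]

theorem trigD_comm (i j : Fin 2) (f : trigAlg) : trigD i (trigD j f) = trigD j (trigD i f) := by
  induction f using trigAlg_induction with
  | h0 k =>
    rw [trigD_cas, trigD_cas, Derivation.map_smul, Derivation.map_smul, trigD_cas, trigD_cas, smul_smul, smul_smul]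
    congr 1
    simp only [Pi.neg_apply, Int.cast_neg]
    ring
  | hadd f g hf hg => simp only [map_add, hf, hg]
  | hsmul c f hf => simp only [Derivation.map_smul, hf]

/-- The transport term is skew-symmetric for divergence-free velocities. -/
theorem trigInt_transport_self (U W : Fin 2 → trigAlg) (hU : ∑ j, trigD j (U j) = 0) :
    trigInt (∑ j, ∑ i, U j * trigD j (W i) * W i) = 0 := by
  -- The identity `2 (U · ∇W) · W = div (|W|² U) - (div U) |W|²`.
  have h2 : (2 : ℝ) • (∑ j, ∑ i, U j * trigD j (W i) * W i) =
      ∑ j, trigD j (U j * ∑ i, W i * W i) - (∑ j, trigD j (U j)) * ∑ i, W i * W i := by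
    simp only [Fin.sum_univ_two, map_add, Derivation.leibniz, smul_eq_mul, two_smul]
    ring
  have h3 : 2 * trigInt (∑ j, ∑ i, U j * trigD j (W i) * W i) = 0 := by
    rw [← smul_eq_mul, ← map_smul, h2, hU, zero_mul, sub_zero, map_sum]
    exact Finset.sum_eq_zero fun j _ => trigInt_trigD j _
  linarith

/-- In two dimensions the transport term of a divergence-free field is orthogonal to the
Laplacian of the field. -/
theorem trigInt_transport_laplacian (Z : Fin 2 → trigAlg) (hZ : ∑ j, trigD j (Z j) = 0) :
    trigInt (∑ j, ∑ i, Z j * trigD j (Z i) * ∑ k, trigD k (trigD k (Z i))) = 0 := by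
  have hc : trigD 1 (trigD 0 (Z 0)) = trigD 0 (trigD 1 (Z 0)) := trigD_comm _ _ _
  have hc' : trigD 1 (trigD 0 (Z 1)) = trigD 0 (trigD 1 (Z 1)) := trigD_comm _ _ _
  have hZ' : trigD 1 (Z 1) = - trigD 0 (Z 0) := by
    rw [Fin.sum_univ_two] at hZ
    exact (neg_eq_of_add_eq_zero_right hZ).symm
  -- After moving all divergences aside, what remains is `(div Z) |∇Z|²` and the cubic term `tr (M²
  -- Mᵀ)` with `M = ∇Z`. For a trace-free 2 × 2 matrix `M² = -(det M) I`, so the cubic term vanishes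
  -- too; this is where dimension two enters.
  have h2 : (2 : ℝ) • (∑ j, ∑ i, Z j * trigD j (Z i) * ∑ k, trigD k (trigD k (Z i))) =
      ∑ k, trigD k ((2 : ℝ) • ∑ j, ∑ i, Z j * trigD j (Z i) * trigD k (Z i)) -
      ∑ j, trigD j (Z j * ∑ i, ∑ k, trigD k (Z i) * trigD k (Z i)) := by
    simp only [Fin.sum_univ_two, map_add, Derivation.leibniz, smul_eq_mul, two_smul, hc, hc', hZ',
      map_neg]
    ring
  have h3 : 2 * trigInt
      (∑ j, ∑ i, Z j * trigD j (Z i) * ∑ k, trigD k (trigD k (Z i))) = 0 := by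
    rw [← smul_eq_mul, ← map_smul, h2, map_sub, map_sum, map_sum,
      Finset.sum_eq_zero fun j _ => trigInt_trigD j _,
      Finset.sum_eq_zero fun j _ => trigInt_trigD j _, sub_zero]
  linarith

end NSE

namespace NSE

/-! ## An `L⁴` bound for trigonometric polynomials -/

/-- The squared Euclidean length of a wave vector. -/
def normSq (k : Fin 2 → ℤ) : ℝ := ∑ i, (k i : ℝ) ^ 2

theorem normSq_nonneg (k : Fin 2 → ℤ) : 0 ≤ normSq k := Finset.sum_nonneg fun _ _ => sq_nonneg _

theorem normSq_zero : normSq 0 = 0 := by simp [normSq]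

theorem normSq_neg (k : Fin 2 → ℤ) : normSq (-k) = normSq k := by simp [normSq]

theorem norm_sq_le_normSq (k : Fin 2 → ℤ) : ‖k‖ ^ 2 ≤ normSq k := by
  have h : ‖k‖ ≤ √(normSq k) := by
    rw [pi_norm_le_iff_of_nonneg (Real.sqrt_nonneg _)]
    intro i
    rw [← Int.norm_cast_real, Real.norm_eq_abs]
    refine Real.abs_le_sqrt ?_
    exact Finset.single_le_sum (f := fun i => (k i : ℝ) ^ 2) (fun _ _ => sq_nonneg _)
      (Finset.mem_univ i)
  calc ‖k‖ ^ 2 ≤ √(normSq k) ^ 2 := by gcongr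
    _ = normSq k := Real.sq_sqrt (normSq_nonneg k)

theorem one_le_normSq {k : Fin 2 → ℤ} (hk : k ≠ 0) : 1 ≤ normSq k := by
  obtain ⟨i, hi⟩ := Function.ne_iff.mp hk
  have h1 : (1 : ℝ) ≤ (k i : ℝ) ^ 2 := by
    have : 0 < (k i) ^ 2 := sq_pos_of_ne_zero hi
    have : 1 ≤ (k i) ^ 2 := this
    exact_mod_cast this
  exact h1.trans (Finset.single_le_sum (f := fun i => (k i : ℝ) ^ 2) (fun _ _ => sq_nonneg _)
    (Finset.mem_univ i))

theorem summable_inv_normSq_sq : Summable fun k : Fin 2 → ℤ => ((normSq k)⁻¹) ^ 2 := by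
  refine Summable.of_nonneg_of_le (fun k => sq_nonneg _) (fun k => ?_)
    (EisensteinSeries.summable_one_div_norm_rpow (k := 4) (by norm_num))
  by_cases hk : k = 0
  · subst hk; simp [normSq_zero]
  · have hp : 0 < ‖k‖ := norm_pos_iff.mpr hk
    have : ‖k‖ ^ (-4 : ℝ) = ((‖k‖ ^ 2)⁻¹) ^ 2 := by
      rw [Real.rpow_neg hp.le]
      norm_cast
      rw [← inv_pow, ← inv_pow, ← pow_mul]
    rw [this]
    have := norm_sq_le_normSq k
    have := inv_nonneg.mpr (normSq_nonneg k)
    gcongr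

theorem integral_sum_cas_mul (P : Finset (Fin 2 → ℤ)) (A B : (Fin 2 → ℤ) → ℝ) :
    ∫ x in cell, (∑ p ∈ P, A p * cas p x) * (∑ p ∈ P, B p * cas p x) =
      (2 * Real.pi) ^ 2 * ∑ p ∈ P, A p * B p := by
  have hc := continuous_cas
  have e : ∀ x, (∑ p ∈ P, A p * cas p x) * (∑ p ∈ P, B p * cas p x) =
      ∑ p ∈ P, ∑ q ∈ P, (A p * B q) * (cas p x * cas q x) := by
    intro x
    rw [Finset.sum_mul_sum]
    exact Finset.sum_congr rfl fun p _ => Finset.sum_congr rfl fun q _ => by ring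
  simp_rw [e]
  rw [integral_finsetSum _ fun p _ => Continuous.integrableOn_cell (by fun_prop)]
  rw [Finset.mul_sum]
  refine Finset.sum_congr rfl fun p hp => ?_
  rw [integral_finsetSum _ fun p _ => Continuous.integrableOn_cell (by fun_prop)]
  simp_rw [integral_const_mul, integral_cas_mul_cas]
  rw [Finset.sum_eq_single p]
  · simp; ring
  · intro q _ hq; simp [hq.symm]
  · exact fun h => absurd hp h

/-- By orthogonality the integral is a sum over frequencies `p` of squares of sums over the fibre `σ
l m = p`. Cauchy–Schwarz with weights `|l|² |m|²` bounds each square. Only injectivity of `σ` in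
each variable matters, so one proof serves the three convolutions that occur in a square. -/
theorem integral_convolution_sq_le (S : Finset (Fin 2 → ℤ)) (hS : 0 ∉ S) (c : (Fin 2 → ℤ) → ℝ)
    (σ : (Fin 2 → ℤ) → (Fin 2 → ℤ) → (Fin 2 → ℤ)) (h1 : ∀ l, Function.Injective (σ l))
    (h2 : ∀ m, Function.Injective fun l => σ l m) :
    ∫ x in cell, (∑ q ∈ S ×ˢ S, c q.1 * c q.2 * cas (σ q.1 q.2) x) ^ 2 ≤
      (2 * Real.pi) ^ 2 * ((∑' k, ((normSq k)⁻¹) ^ 2) * (∑ l ∈ S, normSq l * c l ^ 2) ^ 2) := by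
  classical
  set P := (S ×ˢ S).image fun q => σ q.1 q.2 with hP
  set fib : (Fin 2 → ℤ) → Finset ((Fin 2 → ℤ) × (Fin 2 → ℤ)) := fun p =>
    {q ∈ S ×ˢ S | σ q.1 q.2 = p} with hfib
  set A : (Fin 2 → ℤ) → ℝ := fun p => ∑ q ∈ fib p, c q.1 * c q.2 with hA
  have hmaps : ∀ q ∈ S ×ˢ S, σ q.1 q.2 ∈ P := fun q hq => Finset.mem_image_of_mem _ hq
  have e : ∀ x, ∑ q ∈ S ×ˢ S, c q.1 * c q.2 * cas (σ q.1 q.2) x = ∑ p ∈ P, A p * cas p x := by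
    intro x
    rw [← Finset.sum_fiberwise_of_maps_to hmaps]
    refine Finset.sum_congr rfl fun p _ => ?_
    rw [hA]
    simp only
    rw [Finset.sum_mul]
    refine Finset.sum_congr rfl fun q hq => ?_
    rw [(Finset.mem_filter.mp hq).2]
  simp_rw [e, sq (∑ p ∈ P, A p * cas p _)]
  rw [integral_sum_cas_mul]
  refine mul_le_mul_of_nonneg_left ?_ (by positivity)
  have hT : ∀ (p : Fin 2 → ℤ) (π : (Fin 2 → ℤ) × (Fin 2 → ℤ) → (Fin 2 → ℤ)),
      Set.InjOn π (fib p) →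
      ∑ q ∈ fib p, ((normSq (π q))⁻¹) ^ 2 ≤ ∑' k, ((normSq k)⁻¹) ^ 2 := by
    intro p π hπ
    rw [← Finset.sum_image (f := fun k => ((normSq k)⁻¹) ^ 2) hπ]
    exact summable_inv_normSq_sq.sum_le_tsum _ fun _ _ => sq_nonneg _
  have hA2 : ∀ p, A p * A p ≤ (∑' k, ((normSq k)⁻¹) ^ 2) *
      ∑ q ∈ fib p, (normSq q.1 * c q.1 ^ 2) * (normSq q.2 * c q.2 ^ 2) := by
    intro p
    rw [← sq]
    have hcs := Finset.sum_sq_le_sum_mul_sum_of_sq_le_mul (fib p)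
      (r := fun q => c q.1 * c q.2) (f := fun q => (normSq q.1)⁻¹ * (normSq q.2)⁻¹)
      (g := fun q => (normSq q.1 * c q.1 ^ 2) * (normSq q.2 * c q.2 ^ 2))
      (fun q _ => mul_nonneg (inv_nonneg.mpr (normSq_nonneg _)) (inv_nonneg.mpr (normSq_nonneg _)))
      (fun q _ => mul_nonneg (mul_nonneg (normSq_nonneg _) (sq_nonneg _))
        (mul_nonneg (normSq_nonneg _) (sq_nonneg _)))
      (fun q hq => by
        have hq' := Finset.mem_product.mp (Finset.mem_filter.mp hq).1
        have n1 : normSq q.1 ≠ 0 :=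
          (zero_lt_one.trans_le (one_le_normSq fun h => hS (h ▸ hq'.1))).ne'
        have n2 : normSq q.2 ≠ 0 :=
          (zero_lt_one.trans_le (one_le_normSq fun h => hS (h ▸ hq'.2))).ne'
        exact le_of_eq (by field_simp))
    refine hcs.trans (mul_le_mul_of_nonneg_right ?_ (Finset.sum_nonneg fun q _ =>
      mul_nonneg (mul_nonneg (normSq_nonneg _) (sq_nonneg _))
        (mul_nonneg (normSq_nonneg _) (sq_nonneg _))))
    -- On a fibre either wave vector determines the other, so both projections are injective and
    -- each sum of inverse fourth powers is at most the full lattice sum.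
    have t1 := hT p Prod.fst (by
      intro q hq q' hq' h
      have hq := (Finset.mem_filter.mp hq).2
      have hq' := (Finset.mem_filter.mp hq').2
      refine Prod.ext h (h1 q.1 ?_)
      rw [hq, h, hq'])
    have t2 := hT p Prod.snd (by
      intro q hq q' hq' h
      have hq := (Finset.mem_filter.mp hq).2
      have hq' := (Finset.mem_filter.mp hq').2
      refine Prod.ext (h2 q.2 ?_) h
      simp only
      rw [hq, h, hq'])
    have t3 : ∑ q ∈ fib p, (normSq q.1)⁻¹ * (normSq q.2)⁻¹ ≤
        ∑ q ∈ fib p, (((normSq q.1)⁻¹) ^ 2 + ((normSq q.2)⁻¹) ^ 2) / 2 :=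
      Finset.sum_le_sum fun q _ => by
        nlinarith [sq_nonneg ((normSq q.1)⁻¹ - (normSq q.2)⁻¹)]
    rw [← Finset.sum_div, Finset.sum_add_distrib] at t3
    linarith
  calc ∑ p ∈ P, A p * A p ≤ ∑ p ∈ P, (∑' k, ((normSq k)⁻¹) ^ 2) *
        ∑ q ∈ fib p, (normSq q.1 * c q.1 ^ 2) * (normSq q.2 * c q.2 ^ 2) :=
        Finset.sum_le_sum fun p _ => hA2 p
    _ = _ := by
      rw [← Finset.mul_sum, Finset.sum_fiberwise_of_maps_to hmaps
        (fun q => (normSq q.1 * c q.1 ^ 2) * (normSq q.2 * c q.2 ^ 2)), Finset.sum_product,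
        sq, Finset.sum_mul_sum]

/-- The product formula contains `cos ((l - m) · x)`, which is replaced by `cas (l - m)`: the sine
thereby added is antisymmetric in `(l, m)` and cancels in the double sum. -/
theorem sq_sum_cas (S : Finset (Fin 2 → ℤ)) (c : (Fin 2 → ℤ) → ℝ) (x : Plane) :
    (∑ l ∈ S, c l * cas l x) ^ 2 =
      ∑ q ∈ S ×ˢ S, c q.1 * c q.2 * cas (q.1 - q.2) x +
        (1 / 2) * ∑ q ∈ S ×ˢ S, c q.1 * c q.2 * cas (q.1 + q.2) x -
        (1 / 2) * ∑ q ∈ S ×ˢ S, c q.1 * c q.2 * cas (-(q.1 + q.2)) x := by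
  have hanti : ∑ q ∈ S ×ˢ S, c q.1 * c q.2 * Real.sin (phase (q.1 - q.2) x) = 0 := by
    have h : ∑ q ∈ S ×ˢ S, c q.1 * c q.2 * Real.sin (phase (q.1 - q.2) x) =
        ∑ q ∈ S ×ˢ S, -(c q.1 * c q.2 * Real.sin (phase (q.1 - q.2) x)) := by
      rw [Finset.sum_product, Finset.sum_comm, ← Finset.sum_product']
      refine Finset.sum_congr rfl fun q _ => ?_
      rw [← neg_sub q.1 q.2, phase_neg, Real.sin_neg]
      ring
    rw [Finset.sum_neg_distrib] at h
    linarith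
  rw [← add_zero (_ - _), ← neg_zero, ← hanti, sq, Finset.sum_mul_sum, ← Finset.sum_product',
    Finset.mul_sum, Finset.mul_sum, ← Finset.sum_neg_distrib, ← Finset.sum_add_distrib,
    ← Finset.sum_sub_distrib, ← Finset.sum_add_distrib]
  refine Finset.sum_congr rfl fun q _ => ?_
  have e := cas_mul_cas q.1 q.2 x
  rw [sin_phase_eq] at e
  have e2 : cas (q.1 - q.2) x = Real.cos (phase (q.1 - q.2) x) + Real.sin (phase (q.1 - q.2) x) :=
    rfl
  linear_combination c q.1 * c q.2 * e - c q.1 * c q.2 * e2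

/-- The constant in the `L⁴` bound for trigonometric polynomials. -/
def quarticConst : ℝ := 9 / 2 * ((2 * Real.pi) ^ 2 * ∑' k : Fin 2 → ℤ, ((normSq k)⁻¹) ^ 2)

theorem quarticConst_nonneg : 0 ≤ quarticConst := by
  have := tsum_nonneg (L := SummationFilter.unconditional _) (fun k : Fin 2 → ℤ => sq_nonneg ((normSq k)⁻¹))
  unfold quarticConst
  positivity

theorem integral_sum_cas_pow_four_le (S : Finset (Fin 2 → ℤ)) (hS : 0 ∉ S)
    (c : (Fin 2 → ℤ) → ℝ) :
    ∫ x in cell, (∑ l ∈ S, c l * cas l x) ^ 4 ≤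
      quarticConst * (∑ l ∈ S, normSq l * c l ^ 2) ^ 2 := by
  have hc := continuous_cas
  set G : ((Fin 2 → ℤ) → (Fin 2 → ℤ) → (Fin 2 → ℤ)) → Plane → ℝ := fun σ x =>
    ∑ q ∈ S ×ˢ S, c q.1 * c q.2 * cas (σ q.1 q.2) x with hG
  have hGc : ∀ σ, Continuous (G σ) := fun σ => by simp only [hG]; fun_prop
  have b1 := integral_convolution_sq_le S hS c (fun l m => l - m)
    (fun l m m' h => sub_right_injective h) (fun m l l' h => sub_left_injective h)
  have b2 := integral_convolution_sq_le S hS c (fun l m => l + m)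
    (fun l m m' h => add_right_injective l h) (fun m l l' h => add_left_injective m h)
  have b3 := integral_convolution_sq_le S hS c (fun l m => -(l + m))
    (fun l m m' h => add_right_injective l (neg_injective h))
    (fun m l l' h => add_left_injective m (neg_injective h))
  set σ₁ : (Fin 2 → ℤ) → (Fin 2 → ℤ) → (Fin 2 → ℤ) := fun l m => l - m
  set σ₂ : (Fin 2 → ℤ) → (Fin 2 → ℤ) → (Fin 2 → ℤ) := fun l m => l + m
  set σ₃ : (Fin 2 → ℤ) → (Fin 2 → ℤ) → (Fin 2 → ℤ) := fun l m => -(l + m)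
  have h1 := hGc σ₁
  have h2 := hGc σ₂
  have h3 := hGc σ₃
  -- From `(a + b - c)² ≤ 3 (a² + b² + c²)` with `b`, `c` carrying a factor `1 / 2`; the
  -- coefficients add up to the `9 / 2` in `quarticConst`.
  have hle : ∀ x, (∑ l ∈ S, c l * cas l x) ^ 4 ≤
      3 * G σ₁ x ^ 2 + (3 / 4) * G σ₂ x ^ 2 + (3 / 4) * G σ₃ x ^ 2 := by
    intro x
    have e : (∑ l ∈ S, c l * cas l x) ^ 4 = ((∑ l ∈ S, c l * cas l x) ^ 2) ^ 2 := by ring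
    rw [e, sq_sum_cas]
    change (G σ₁ x + 1 / 2 * G σ₂ x - 1 / 2 * G σ₃ x) ^ 2 ≤ _
    nlinarith [sq_nonneg (G σ₁ x - 1 / 2 * G σ₂ x), sq_nonneg (G σ₁ x + 1 / 2 * G σ₃ x),
      sq_nonneg (1 / 2 * G σ₂ x + 1 / 2 * G σ₃ x)]
  have hint := integral_mono (μ := (volume : Measure Plane).restrict cell)
    (Continuous.integrableOn_cell (by fun_prop)) (Continuous.integrableOn_cell (by fun_prop)) hle
  rw [integral_add (Continuous.integrableOn_cell (by fun_prop))
    (Continuous.integrableOn_cell (by fun_prop)),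
    integral_add (Continuous.integrableOn_cell (by fun_prop))
    (Continuous.integrableOn_cell (by fun_prop)),
    integral_const_mul, integral_const_mul, integral_const_mul] at hint
  unfold quarticConst
  linarith

end NSE

namespace NSE

/-! ## The divergence-free Fourier modes -/

/-- The unit vector orthogonal to the wave vector `k` (zero for `k = 0`). -/
def perp (k : Fin 2 → ℤ) : Plane := (√(normSq k))⁻¹ • !₂[-(k 1 : ℝ), (k 0 : ℝ)]

theorem perp_neg (k : Fin 2 → ℤ) : perp (-k) = -perp k := by
  ext i
  fin_cases i <;> simp [perp, normSq_neg]

theorem perp_zero : perp 0 = 0 := by simp [perp, normSq_zero]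

theorem sum_mul_perp (k : Fin 2 → ℤ) : ∑ i, (k i : ℝ) * perp k i = 0 := by
  simp [perp, Fin.sum_univ_two]; ring

theorem inner_perp_self {k : Fin 2 → ℤ} (hk : k ≠ 0) : inner ℝ (perp k) (perp k) = (1 : ℝ) := by
  have hp : 0 < normSq k := zero_lt_one.trans_le (one_le_normSq hk)
  have h2 : normSq k = (k 0 : ℝ) ^ 2 + (k 1 : ℝ) ^ 2 := by simp [normSq]
  simp only [PiLp.inner_apply, Fin.sum_univ_two, perp]
  simp
  rw [mul_pow, mul_pow, inv_pow, sq_abs, sq_abs, sq_abs, Real.sq_sqrt hp.le, ← mul_add, add_comm,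
    ← h2, inv_mul_cancel₀ hp.ne']

theorem perp_sq_le (k : Fin 2 → ℤ) (i : Fin 2) : perp k i ^ 2 ≤ 1 := by
  by_cases hk : k = 0
  · subst hk; simp [perp_zero]
  · have := inner_perp_self hk
    simp only [PiLp.inner_apply, Fin.sum_univ_two] at this
    simp at this
    fin_cases i
    · change perp k 0 ^ 2 ≤ 1
      nlinarith [sq_nonneg (perp k 1)]
    · change perp k 1 ^ 2 ≤ 1
      nlinarith [sq_nonneg (perp k 0)]

theorem eq_smul_perp {k : Fin 2 → ℤ} (hk : k ≠ 0) {d : Plane} (h : ∑ i, (k i : ℝ) * d i = 0) :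
    d = ((√(normSq k))⁻¹ * (k 0 * d 1 - k 1 * d 0)) • perp k := by
  have hp : 0 < normSq k := zero_lt_one.trans_le (one_le_normSq hk)
  have h2 : normSq k = (k 0 : ℝ) ^ 2 + (k 1 : ℝ) ^ 2 := by simp [normSq]
  have hs : (√(normSq k))⁻¹ * (√(normSq k))⁻¹ = (normSq k)⁻¹ := by
    rw [← mul_inv, Real.mul_self_sqrt hp.le]
  rw [Fin.sum_univ_two] at h
  rw [perp, smul_smul, mul_right_comm, hs]
  ext i
  fin_cases i
  · simp
    field_simp
    rw [h2]
    linear_combination (k 0 : ℝ) * h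
  · simp
    field_simp
    rw [h2]
    linear_combination (k 1 : ℝ) * h

/-- The divergence-free Fourier mode with wave vector `k`. -/
def mode (k : Fin 2 → ℤ) (x : Plane) : Plane := ((2 * Real.pi)⁻¹ * cas k x) • perp k

theorem differentiable_mode (k : Fin 2 → ℤ) : Differentiable ℝ (mode k) :=
  ((differentiable_cas k).const_mul _).smul_const _

theorem mode_zero : mode 0 = 0 := by funext x; simp [mode, perp_zero]

theorem partialD_cas_smul (j : Fin 2) (k : Fin 2 → ℤ) (d : Plane) :
    partialD j (fun x => cas k x • d) = fun x => ((k j : ℝ) * cas (-k) x) • d := by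
  funext x
  have h1 := congrFun (pderiv_cas j k) x
  unfold pderiv at h1
  rw [partialD, fderiv_smul_const (differentiable_cas k x)]
  simp [h1]

theorem partialD_add (j : Fin 2) {u v : Plane → Plane} (hu : Differentiable ℝ u)
    (hv : Differentiable ℝ v) : partialD j (u + v) = partialD j u + partialD j v := by
  funext x
  simp [partialD, fderiv_add (hu x) (hv x)]

theorem partialD_smul (j : Fin 2) (c : ℝ) (u : Plane → Plane) :
    partialD j (c • u) = c • partialD j u := by
  funext x
  simp [partialD, fderiv_const_smul_field]

theorem partialD_zero (j : Fin 2) : partialD j 0 = 0 := by simpa using partialD_smul j 0 0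

/-- The minus sign comes from `perp (-k) = -perp k`. -/
theorem partialD_mode (j : Fin 2) (k : Fin 2 → ℤ) :
    partialD j (mode k) = (-(k j : ℝ)) • mode (-k) := by
  have e : mode k = (2 * Real.pi)⁻¹ • fun x => cas k x • perp k := by
    funext x; simp [mode, mul_smul]
  rw [e, partialD_smul, partialD_cas_smul]
  funext x
  ext i
  simp only [mode, Pi.smul_apply, perp_neg, PiLp.smul_apply, PiLp.neg_apply, smul_eq_mul]
  ring

/-- The divergence-free trigonometric polynomials with zero average, as a linear space. -/
def modeSpan : Submodule ℝ (Plane → Plane) := Submodule.span ℝ (Set.range mode)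

theorem mode_mem (k : Fin 2 → ℤ) : mode k ∈ modeSpan := Submodule.subset_span ⟨k, rfl⟩

theorem differentiable_of_mem_modeSpan {u : Plane → Plane} (hu : u ∈ modeSpan) :
    Differentiable ℝ u := by
  induction hu using Submodule.span_induction with
  | zero => exact differentiable_const 0
  | add x y _ _ hx hy => exact hx.add hy
  | smul a x _ hx => exact hx.const_smul a
  | mem f hf => obtain ⟨k, rfl⟩ := hf; exact differentiable_mode k

theorem partialD_mem_modeSpan (j : Fin 2) {u : Plane → Plane} (hu : u ∈ modeSpan) :
    partialD j u ∈ modeSpan := by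
  induction hu using Submodule.span_induction with
  | zero => rw [partialD_zero]; exact modeSpan.zero_mem
  | add x y hx' hy' hx hy =>
    rw [partialD_add j (differentiable_of_mem_modeSpan hx') (differentiable_of_mem_modeSpan hy')]
    exact modeSpan.add_mem hx hy
  | smul a x _ hx => rw [partialD_smul]; exact modeSpan.smul_mem _ hx
  | mem f hf =>
    obtain ⟨k, rfl⟩ := hf
    rw [partialD_mode]
    exact modeSpan.smul_mem _ (mode_mem _)

theorem div_of_mem_modeSpan {u : Plane → Plane} (hu : u ∈ modeSpan) (x : Plane) :
    ∑ j, partialD j u x j = 0 := by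
  induction hu using Submodule.span_induction with
  | zero => simp [partialD_zero]
  | add y z hy' hz' hy hz =>
    simp_rw [partialD_add _ (differentiable_of_mem_modeSpan hy')
      (differentiable_of_mem_modeSpan hz')]
    simp only [Pi.add_apply, PiLp.add_apply, Finset.sum_add_distrib, hy, hz, add_zero]
  | smul a y _ hy =>
    simp_rw [partialD_smul]
    simp only [Pi.smul_apply, PiLp.smul_apply, smul_eq_mul, ← Finset.mul_sum, hy, mul_zero]
  | mem f hf =>
    obtain ⟨k, rfl⟩ := hf
    simp_rw [partialD_mode]
    have h := sum_mul_perp k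
    simp only [Fin.sum_univ_two] at h
    simp only [mode, Fin.sum_univ_two, Pi.smul_apply, PiLp.smul_apply, smul_eq_mul, perp_neg,
      PiLp.neg_apply]
    linear_combination (2 * Real.pi)⁻¹ * cas (-k) x * h

theorem continuous_of_mem_modeSpan {u : Plane → Plane} (hu : u ∈ modeSpan) : Continuous u :=
  (differentiable_of_mem_modeSpan hu).continuous

theorem mode_mem_smoothFields (k : Fin 2 → ℤ) : mode k ∈ smoothFields := by
  refine ⟨⟨{k}, fun _ => (2 * Real.pi)⁻¹ • perp k, fun _ => (2 * Real.pi)⁻¹ • perp k, fun x => ?_⟩,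
    div_of_mem_modeSpan (mode_mem k), ?_⟩
  · rw [Finset.sum_singleton, smul_smul, smul_smul, ← add_smul, mode, cas]
    congr 1
    ring
  · simp only [mode]
    rw [integral_smul_const, integral_const_mul, integral_cas]
    split_ifs with h
    · rw [h, perp_zero, smul_zero]
    · simp

/-- The vector-valued trigonometric polynomial with given coefficients. -/
def casSum : ((Fin 2 → ℤ) →₀ Plane) →ₗ[ℝ] (Plane → Plane) :=
  Finsupp.lsum ℝ fun k =>
    { toFun := fun d x => cas k x • d
      map_add' := fun d e => by funext x; simp
      map_smul' := fun c d => by funext x; exact smul_comm _ _ _ }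

theorem casSum_single (k : Fin 2 → ℤ) (d : Plane) :
    casSum (Finsupp.single k d) = fun x => cas k x • d := by
  rw [casSum, Finsupp.lsum_single]
  rfl

theorem casSum_apply (D : (Fin 2 → ℤ) →₀ Plane) :
    casSum D = ∑ k ∈ D.support, fun x => cas k x • D k := by
  rw [casSum, Finsupp.lsum_apply]
  rfl

theorem IsTrigPoly.exists_casSum {u : Plane → Plane} (hu : IsTrigPoly u) :
    ∃ D, u = casSum D := by
  obtain ⟨S, a, b, h⟩ := hu
  refine ⟨∑ k ∈ S, (Finsupp.single k ((1 / 2 : ℝ) • (a k + b k)) +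
    Finsupp.single (-k) ((1 / 2 : ℝ) • (a k - b k))), ?_⟩
  rw [map_sum]
  funext x
  rw [h, Finset.sum_apply]
  refine Finset.sum_congr rfl fun k _ => ?_
  rw [map_add, casSum_single, casSum_single, cos_phase_eq, sin_phase_eq]
  ext i
  simp
  ring

theorem partialD_casSum (j : Fin 2) (D : (Fin 2 → ℤ) →₀ Plane) (x : Plane) :
    partialD j (casSum D) x = ∑ k ∈ D.support, ((k j : ℝ) * cas (-k) x) • D k := by
  rw [casSum_apply, partialD, fderiv_sum fun k _ => ((differentiable_cas k x).smul_const _)]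
  rw [_root_.sum_apply]
  exact Finset.sum_congr rfl fun k _ => congrFun (partialD_cas_smul j k (D k)) x

/-- Orthogonality reads the constraints off the coefficients: zero average kills `D 0`, and zero
divergence tested against `cas (-l)` makes `D l` orthogonal to `l`. In the plane that leaves only
multiples of `perp l`. -/
theorem smoothFields_subset {u : Plane → Plane} (hu : u ∈ smoothFields) : u ∈ modeSpan := by
  obtain ⟨hT, hdiv, hmean⟩ := hu
  obtain ⟨D, rfl⟩ := hT.exists_casSum
  have hc := continuous_cas
  have hpi : (2 * Real.pi) ^ 2 ≠ 0 := by positivity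
  have h0 : D 0 = 0 := by
    rw [casSum_apply] at hmean
    simp only [Finset.sum_apply] at hmean
    rw [integral_finsetSum _ fun k _ => Continuous.integrableOn_cell (by fun_prop)] at hmean
    simp_rw [integral_smul_const, integral_cas] at hmean
    by_cases hD : D 0 = 0
    · exact hD
    · rw [Finset.sum_eq_single 0 (fun k _ hk => by simp [hk])
        (fun h => absurd (Finsupp.mem_support_iff.mpr hD) h), if_pos rfl] at hmean
      exact (smul_eq_zero.mp hmean).resolve_left hpi
  have hperp : ∀ l, ∑ j, (l j : ℝ) * D l j = 0 := by
    intro l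
    by_cases hl : l ∈ D.support
    · have hsum : ∀ x, ∑ k ∈ D.support, (∑ j, (k j : ℝ) * D k j) * (cas (-k) x * cas (-l) x) = 0 := by
        intro x
        have := hdiv x
        simp_rw [partialD_casSum] at this
        rw [← zero_mul (cas (-l) x), ← this, Finset.sum_mul]
        simp only [Fin.sum_univ_two, WithLp.ofLp_sum, Finset.sum_apply, PiLp.smul_apply,
          smul_eq_mul]
        rw [Finset.sum_mul, Finset.sum_mul, ← Finset.sum_add_distrib]
        exact Finset.sum_congr rfl fun k _ => by ring
      have hint : ∫ x in cell, ∑ k ∈ D.support,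
          (∑ j, (k j : ℝ) * D k j) * (cas (-k) x * cas (-l) x) = 0 := by
        simp_rw [hsum]; simp
      rw [integral_finsetSum _ fun k _ => Continuous.integrableOn_cell (by fun_prop)] at hint
      simp_rw [integral_const_mul, integral_cas_mul_cas] at hint
      rw [Finset.sum_eq_single l (fun k _ hk => by simp [hk]) (fun h => absurd hl h),
        if_pos rfl] at hint
      exact (mul_eq_zero.mp hint).resolve_right hpi
    · simp [Finsupp.notMem_support_iff.mp hl]
  rw [casSum_apply]
  refine Submodule.sum_mem _ fun k _ => ?_
  by_cases hk : k = 0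
  · subst hk
    have : (fun x => cas 0 x • D 0) = 0 := by funext x; simp [h0]
    rw [this]
    exact modeSpan.zero_mem
  · have e : (fun x => cas k x • D k) =
        (2 * Real.pi * ((√(normSq k))⁻¹ * (k 0 * D k 1 - k 1 * D k 0))) • mode k := by
      funext x
      conv_lhs => rw [eq_smul_perp hk (hperp k)]
      simp only [mode, Pi.smul_apply, smul_smul]
      congr 1
      have : Real.pi ≠ 0 := Real.pi_ne_zero
      field_simp
    rw [e]
    exact modeSpan.smul_mem _ (mode_mem k)

end NSE

namespace NSE

/-! ## Fourier modes as elements of `V` -/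

theorem _root_.Continuous.memLp_cell {F : Type*} [NormedAddCommGroup F]
    [SecondCountableTopology F] {f : Plane → F} (hf : Continuous f) (p : ENNReal) :
    MemLp f p ((volume : Measure Plane).restrict cell) := by
  borelize F
  obtain ⟨C, hC⟩ := isCompact_cell.exists_bound_of_continuousOn hf.continuousOn
  exact MemLp.of_bound hf.aestronglyMeasurable C
    ((ae_restrict_iff' isCompact_cell.measurableSet).mpr (Eventually.of_forall hC))

/-- The class in `L²` of a divergence-free trigonometric polynomial. -/
def modeSpanToL2 : modeSpan →ₗ[ℝ] L2 where
  toFun Z := ((continuous_of_mem_modeSpan Z.2).memLp_cell 2).toLp Z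
  map_add' _ _ := MemLp.toLp_add _ _
  map_smul' c _ := MemLp.toLp_const_smul c _

theorem coeFn_modeSpanToL2 (Z : modeSpan) :
    modeSpanToL2 Z =ᵐ[(volume : Measure Plane).restrict cell] (Z : Plane → Plane) :=
  MemLp.coeFn_toLp ((continuous_of_mem_modeSpan Z.2).memLp_cell 2)

/-- Partial differentiation on `modeSpan`. -/
def modeD (j : Fin 2) : modeSpan →ₗ[ℝ] modeSpan where
  toFun Z := ⟨partialD j Z, partialD_mem_modeSpan j Z.2⟩
  map_add' Y Z := Subtype.ext
    (partialD_add j (differentiable_of_mem_modeSpan Y.2) (differentiable_of_mem_modeSpan Z.2))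
  map_smul' c Z := Subtype.ext (partialD_smul j c Z)

/-- A divergence-free trigonometric polynomial together with its partial derivatives. -/
def modeSpanToPair : modeSpan →ₗ[ℝ] L2 × (Fin 2 → L2) :=
  modeSpanToL2.prod (LinearMap.pi fun j => modeSpanToL2 ∘ₗ modeD j)

theorem range_modeSpanToPair_le : LinearMap.range modeSpanToPair ≤
    Submodule.span ℝ {p : L2 × (Fin 2 → L2) | ∃ u ∈ smoothFields,
      p.1 =ᵐ[(volume : Measure Plane).restrict cell] u ∧
      ∀ j, p.2 j =ᵐ[(volume : Measure Plane).restrict cell] partialD j u} := by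
  rintro _ ⟨⟨Z, hZ⟩, rfl⟩
  unfold modeSpan at hZ
  induction hZ using Submodule.span_induction with
  | mem f hf =>
    obtain ⟨k, rfl⟩ := hf
    exact Submodule.subset_span ⟨mode k, mode_mem_smoothFields k, coeFn_modeSpanToL2 _,
      fun j => coeFn_modeSpanToL2 _⟩
  | zero =>
    have : modeSpanToPair ⟨0, modeSpan.zero_mem⟩ = 0 := map_zero modeSpanToPair
    rw [this]
    exact Submodule.zero_mem _
  | add x y hx' hy' hx hy =>
    have : modeSpanToPair ⟨x + y, modeSpan.add_mem hx' hy'⟩ =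
      modeSpanToPair ⟨x, hx'⟩ + modeSpanToPair ⟨y, hy'⟩ :=
      map_add modeSpanToPair ⟨x, hx'⟩ ⟨y, hy'⟩
    rw [this]
    exact Submodule.add_mem _ hx hy
  | smul a x hx' hx =>
    have : modeSpanToPair ⟨a • x, modeSpan.smul_mem a hx'⟩ = a • modeSpanToPair ⟨x, hx'⟩ :=
      map_smul modeSpanToPair a ⟨x, hx'⟩
    rw [this]
    exact Submodule.smul_mem _ _ hx

theorem spaceV_le : spaceV ≤ (LinearMap.range modeSpanToPair).topologicalClosure := by
  refine Submodule.topologicalClosure_mono (Submodule.span_le.mpr ?_)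
  rintro ⟨f, q⟩ ⟨u, hu, h1, h2⟩
  refine ⟨⟨u, smoothFields_subset hu⟩, Prod.ext ?_ (funext fun j => ?_)⟩
  · exact Lp.ext ((coeFn_modeSpanToL2 _).trans h1.symm)
  · exact Lp.ext ((coeFn_modeSpanToL2 _).trans (h2 j).symm)

/-- The embedding of the divergence-free trigonometric polynomials into `V`. -/
def emb : modeSpan →ₗ[ℝ] spaceV :=
  modeSpanToPair.codRestrict spaceV fun Z =>
    Submodule.le_topologicalClosure _ (range_modeSpanToPair_le ⟨Z, rfl⟩)

/-- This reduces every closed condition on `V` to an identity or estimate for finite sums of Fourier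
modes. -/
theorem denseRange_emb : DenseRange emb := by
  intro w
  have hw := spaceV_le w.2
  rw [← SetLike.mem_coe, Submodule.topologicalClosure_coe] at hw
  rw [Topology.IsInducing.subtypeVal.closure_eq_preimage_closure_image]
  refine closure_mono ?_ hw
  rintro _ ⟨Z, rfl⟩
  exact ⟨emb Z, ⟨Z, rfl⟩, rfl⟩

theorem coeFn_field_emb (Z : modeSpan) :
    field (emb Z) =ᵐ[(volume : Measure Plane).restrict cell] (Z : Plane → Plane) :=
  coeFn_modeSpanToL2 Z

theorem weakD_emb (j : Fin 2) (Z : modeSpan) : weakD j (emb Z) = field (emb (modeD j Z)) := rfl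

/-- The field, as a linear map. -/
def fieldL : spaceV →L[ℝ] L2 :=
  (ContinuousLinearMap.fst ℝ L2 (Fin 2 → L2)).comp spaceV.subtypeL

/-- The weak partial derivative, as a linear map. -/
def weakDL (j : Fin 2) : spaceV →L[ℝ] L2 :=
  ((ContinuousLinearMap.proj j).comp (ContinuousLinearMap.snd ℝ L2 (Fin 2 → L2))).comp
    spaceV.subtypeL

theorem fieldL_apply (u : spaceV) : fieldL u = field u := rfl

theorem continuous_field : Continuous field := fieldL.continuous

theorem continuous_weakD (j : Fin 2) : Continuous (weakD j) := (weakDL j).continuous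

theorem field_add (u w : spaceV) : field (u + w) = field u + field w := rfl

theorem field_sub (u w : spaceV) : field (u - w) = field u - field w := rfl

theorem field_smul (c : ℝ) (u : spaceV) : field (c • u) = c • field u := rfl

theorem weakD_add (j : Fin 2) (u w : spaceV) : weakD j (u + w) = weakD j u + weakD j w := rfl

theorem weakD_smul (j : Fin 2) (c : ℝ) (u : spaceV) : weakD j (c • u) = c • weakD j u := rfl

/-- The Dirichlet form of `V`, as a bilinear form. -/
def bilinA : LinearMap.BilinForm ℝ spaceV :=
  LinearMap.mk₂ ℝ formA
    (fun u v w => by simp [formA, weakD_add, inner_add_left, Finset.sum_add_distrib])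
    (fun c u w => by
      simp only [formA, weakD_smul, real_inner_smul_left, Finset.mul_sum, smul_eq_mul])
    (fun u v w => by simp [formA, weakD_add, inner_add_right, Finset.sum_add_distrib])
    (fun c u w => by
      simp only [formA, weakD_smul, real_inner_smul_right, Finset.mul_sum, smul_eq_mul])

theorem bilinA_apply (u w : spaceV) : bilinA u w = formA u w := rfl

theorem formA_comm (u w : spaceV) : formA u w = formA w u := by
  simp [formA, real_inner_comm]

theorem formA_self_nonneg (u : spaceV) : 0 ≤ formA u u :=
  Finset.sum_nonneg fun _ _ => real_inner_self_nonneg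

theorem normV_nonneg (u : spaceV) : 0 ≤ normV u := Real.sqrt_nonneg _

theorem normV_sq (u : spaceV) : normV u ^ 2 = formA u u := Real.sq_sqrt (formA_self_nonneg u)

theorem abs_formA_le (u w : spaceV) : |formA u w| ≤ normV u * normV w := by
  have h := LinearMap.BilinForm.apply_sq_le_of_symm bilinA formA_self_nonneg
    ⟨fun u w => formA_comm u w⟩ u w
  refine abs_le_of_sq_le_sq ?_ (mul_nonneg (normV_nonneg _) (normV_nonneg _))
  rw [mul_pow, normV_sq, normV_sq]
  exact h

theorem normV_smul (c : ℝ) (u : spaceV) : normV (c • u) = |c| * normV u := by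
  have : formA (c • u) (c • u) = c ^ 2 * formA u u := by
    simp only [← bilinA_apply, map_smul, LinearMap.smul_apply, smul_eq_mul]; ring
  rw [normV, this, Real.sqrt_mul (sq_nonneg c), Real.sqrt_sq_eq_abs, normV]

theorem normV_sub_comm (u w : spaceV) : normV (u - w) = normV (w - u) := by
  rw [← neg_sub w u, ← neg_one_smul ℝ (w - u), normV_smul]
  simp

theorem norm_weakD_le (j : Fin 2) (u : spaceV) : ‖weakD j u‖ ≤ normV u := by
  refine abs_le_of_sq_le_sq' ?_ (normV_nonneg _) |>.2
  rw [normV_sq, ← real_inner_self_eq_norm_sq]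
  exact Finset.single_le_sum (f := fun j => inner ℝ (weakD j u) (weakD j u))
    (fun _ _ => real_inner_self_nonneg) (Finset.mem_univ j)

theorem continuous_formA : Continuous fun p : spaceV × spaceV => formA p.1 p.2 := by
  have := continuous_weakD
  unfold formA
  fun_prop

theorem continuous_normV : Continuous normV :=
  (continuous_formA.comp (continuous_id.prodMk continuous_id)).sqrt

/-- The Fourier mode with wave vector `k`, as an element of `V`. -/
def modeV (k : Fin 2 → ℤ) : spaceV := emb ⟨mode k, mode_mem k⟩

theorem inner_field_emb (Y Z : modeSpan) : inner ℝ (field (emb Y)) (field (emb Z)) =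
    ∫ x in cell, inner ℝ ((Y : Plane → Plane) x) ((Z : Plane → Plane) x) := by
  rw [L2.inner_def]
  refine integral_congr_ae ?_
  filter_upwards [coeFn_field_emb Y, coeFn_field_emb Z] with x h1 h2
  rw [h1, h2]

theorem inner_field_modeV (k l : Fin 2 → ℤ) : inner ℝ (field (modeV k)) (field (modeV l)) =
    if k = l ∧ k ≠ 0 then (1 : ℝ) else 0 := by
  rw [modeV, modeV, inner_field_emb]
  have e : ∀ x, inner ℝ (mode k x) (mode l x) =
      ((2 * Real.pi)⁻¹ ^ 2 * inner ℝ (perp k) (perp l)) * (cas k x * cas l x) := by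
    intro x
    rw [mode, mode, real_inner_smul_left, real_inner_smul_right]
    ring
  simp only [e]
  rw [integral_const_mul, integral_cas_mul_cas]
  by_cases hkl : k = l
  · subst hkl
    by_cases hk : k = 0
    · subst hk; simp [perp_zero]
    · rw [if_pos rfl, if_pos ⟨rfl, hk⟩, inner_perp_self hk]
      have := Real.pi_ne_zero
      field_simp
  · simp [hkl]

theorem weakD_modeV (j : Fin 2) (k : Fin 2 → ℤ) :
    weakD j (modeV k) = (-(k j : ℝ)) • field (modeV (-k)) := by
  have : modeD j ⟨mode k, mode_mem k⟩ = (-(k j : ℝ)) • ⟨mode (-k), mode_mem (-k)⟩ :=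
    Subtype.ext (partialD_mode j k)
  rw [modeV, weakD_emb, this, map_smul]
  rfl

theorem modeSpan_induction {p : modeSpan → Prop} (h0 : ∀ k, p ⟨mode k, mode_mem k⟩)
    (hadd : ∀ f g, p f → p g → p (f + g)) (hsmul : ∀ (c : ℝ) f, p f → p (c • f))
    (f : modeSpan) : p f := by
  obtain ⟨f, hf⟩ := f
  have hf' := hf
  unfold modeSpan at hf'
  have key : ∃ h : f ∈ modeSpan, p ⟨f, h⟩ := by
    clear hf
    induction hf' using Submodule.span_induction with
    | zero =>
      refine ⟨modeSpan.zero_mem, ?_⟩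
      have := hsmul 0 _ (h0 0)
      rwa [zero_smul] at this
    | add x y _ _ hx hy =>
      obtain ⟨hx, px⟩ := hx
      obtain ⟨hy, py⟩ := hy
      exact ⟨modeSpan.add_mem hx hy, hadd _ _ px py⟩
    | smul a x _ hx =>
      obtain ⟨hx, px⟩ := hx
      exact ⟨modeSpan.smul_mem a hx, hsmul a _ px⟩
    | mem f hm => obtain ⟨k, rfl⟩ := hm; exact ⟨mode_mem k, h0 k⟩
  exact key.2

/-- Fourier modes are Stokes eigenfunctions, with eigenvalue `|k|²`: this is checked on modes by
orthogonality and extended to `V` by density. -/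
theorem formA_modeV_left (k : Fin 2 → ℤ) (w : spaceV) :
    formA (modeV k) w = normSq k * inner ℝ (field (modeV k)) (field w) := by
  have h1 : Continuous fun w => formA (modeV k) w :=
    continuous_formA.comp (f := fun w => (modeV k, w)) (by fun_prop)
  have h2 : Continuous fun w => normSq k * inner ℝ (field (modeV k)) (field w) :=
    (((innerSL ℝ (field (modeV k))).comp fieldL).continuous).const_mul (normSq k)
  have key : ∀ Z : modeSpan,
      formA (modeV k) (emb Z) = normSq k * inner ℝ (field (modeV k)) (field (emb Z)) := by
    intro Z
    induction Z using modeSpan_induction with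
    | h0 l =>
      rw [show emb ⟨mode l, mode_mem l⟩ = modeV l from rfl]
      simp only [formA, weakD_modeV, real_inner_smul_left, real_inner_smul_right, inner_field_modeV]
      by_cases hkl : k = l
      · subst hkl
        by_cases hk : k = 0
        · simp [hk]
        · simp [hk, normSq, sq]
      · simp [hkl]
    | hadd f g hf hg =>
      rw [map_add, field_add, inner_add_right, mul_add, ← hf, ← hg]
      exact map_add (bilinA (modeV k)) _ _
    | hsmul c f hf =>
      rw [map_smul, field_smul, real_inner_smul_right, mul_left_comm, ← hf]
      exact map_smul (bilinA (modeV k)) _ _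
  have hcl : IsClosed {w | formA (modeV k) w = normSq k * inner ℝ (field (modeV k)) (field w)} :=
    isClosed_eq h1 h2
  exact denseRange_emb.induction_on w hcl key

/-- The linear combination of Fourier modes with given coefficients. -/
def modeSum (S : Finset (Fin 2 → ℤ)) (t : (Fin 2 → ℤ) → ℝ) : modeSpan :=
  ∑ k ∈ S, t k • ⟨mode k, mode_mem k⟩

theorem coe_modeSum (S : Finset (Fin 2 → ℤ)) (t : (Fin 2 → ℤ) → ℝ) (x : Plane) :
    (modeSum S t : Plane → Plane) x = ∑ k ∈ S, t k • mode k x := by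
  simp [modeSum]

theorem emb_modeSum (S : Finset (Fin 2 → ℤ)) (t : (Fin 2 → ℤ) → ℝ) :
    emb (modeSum S t) = ∑ k ∈ S, t k • modeV k := by
  simp only [modeSum, modeV, map_sum, map_smul]

theorem exists_modeSum (Z : modeSpan) : ∃ (S : Finset (Fin 2 → ℤ)) (t : (Fin 2 → ℤ) → ℝ),
    0 ∉ S ∧ Z = modeSum S t := by
  obtain ⟨Z, hZ⟩ := Z
  obtain ⟨c, hc⟩ := (Finsupp.mem_span_range_iff_exists_finsupp).mp hZ
  refine ⟨c.support.erase 0, c, by simp, Subtype.ext ?_⟩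
  change Z = _
  rw [← hc, modeSum]
  simp only [AddSubmonoidClass.coe_finsetSum, SetLike.val_smul]
  rw [Finsupp.sum, Finset.sum_erase]
  rw [mode_zero, smul_zero]

theorem field_sum_modeV (S : Finset (Fin 2 → ℤ)) (t : (Fin 2 → ℤ) → ℝ) :
    field (emb (modeSum S t)) = ∑ k ∈ S, t k • field (modeV k) := by
  rw [emb_modeSum, ← fieldL_apply, map_sum]
  rfl

theorem inner_field_modeSum {S : Finset (Fin 2 → ℤ)} (hS : 0 ∉ S) (t s : (Fin 2 → ℤ) → ℝ) :
    inner ℝ (field (emb (modeSum S t))) (field (emb (modeSum S s))) = ∑ k ∈ S, t k * s k := by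
  rw [field_sum_modeV, field_sum_modeV, sum_inner]
  refine Finset.sum_congr rfl fun k hk => ?_
  rw [inner_sum, Finset.sum_eq_single k]
  · rw [real_inner_smul_left, real_inner_smul_right, inner_field_modeV,
      if_pos ⟨rfl, fun h => hS (h ▸ hk)⟩, mul_one]
  · intro l _ hl
    rw [real_inner_smul_left, real_inner_smul_right, inner_field_modeV]
    simp [hl.symm]
  · exact fun h => absurd hk h

theorem formA_modeSum_left (S : Finset (Fin 2 → ℤ)) (t : (Fin 2 → ℤ) → ℝ) (w : spaceV) :
    formA (emb (modeSum S t)) w =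
      inner ℝ (field (emb (modeSum S fun k => normSq k * t k))) (field w) := by
  rw [field_sum_modeV, sum_inner, emb_modeSum, ← bilinA_apply, map_sum, LinearMap.sum_apply]
  refine Finset.sum_congr rfl fun k _ => ?_
  rw [map_smul, LinearMap.smul_apply, bilinA_apply, formA_modeV_left, real_inner_smul_left,
    smul_eq_mul]
  ring

theorem formA_modeSum_self {S : Finset (Fin 2 → ℤ)} (hS : 0 ∉ S) (t : (Fin 2 → ℤ) → ℝ) :
    formA (emb (modeSum S t)) (emb (modeSum S t)) = ∑ k ∈ S, normSq k * t k ^ 2 := by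
  rw [formA_modeSum_left, inner_field_modeSum hS]
  exact Finset.sum_congr rfl fun k _ => by ring

/-- The Poincaré inequality on `V`. -/
theorem norm_field_le (u : spaceV) : ‖field u‖ ≤ normV u := by
  refine denseRange_emb.induction_on (p := fun u => ‖field u‖ ≤ normV u) u
    (isClosed_le continuous_field.norm continuous_normV) fun Z => ?_
  obtain ⟨S, t, hS, rfl⟩ := exists_modeSum Z
  refine abs_le_of_sq_le_sq' ?_ (normV_nonneg _) |>.2
  rw [normV_sq, ← real_inner_self_eq_norm_sq, inner_field_modeSum hS, formA_modeSum_self hS]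
  refine Finset.sum_le_sum fun k hk => ?_
  have := one_le_normSq (fun h => hS (h ▸ hk) : k ≠ 0)
  nlinarith [sq_nonneg (t k)]

theorem norm_le_normV (u : spaceV) : ‖u‖ ≤ normV u := by
  change ‖(u : L2 × (Fin 2 → L2))‖ ≤ normV u
  rw [Prod.norm_def]
  refine max_le (norm_field_le u) ?_
  exact (pi_norm_le_iff_of_nonneg (normV_nonneg u)).mpr fun j => norm_weakD_le j u

end NSE

namespace NSE

/-! ## The embedding of `V` into `L⁴` and the trilinear form -/

theorem integral_norm_pow_four_le (Z : modeSpan) :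
    ∫ x in cell, ‖(Z : Plane → Plane) x‖ ^ 4 ≤ 4 * quarticConst * normV (emb Z) ^ 4 := by
  obtain ⟨S, t, hS, rfl⟩ := exists_modeSum Z
  have hZ := continuous_of_mem_modeSpan (modeSum S t).2
  have hcomp : ∀ i x, (modeSum S t : Plane → Plane) x i =
      ∑ k ∈ S, (t k * ((2 * Real.pi)⁻¹ * perp k i)) * cas k x := by
    intro i x
    rw [coe_modeSum]
    simp only [WithLp.ofLp_sum, Finset.sum_apply, mode, PiLp.smul_apply, smul_eq_mul]
    exact Finset.sum_congr rfl fun k _ => by ring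
  have hA : normV (emb (modeSum S t)) ^ 4 = (∑ k ∈ S, normSq k * t k ^ 2) ^ 2 := by
    rw [← formA_modeSum_self hS, ← normV_sq, ← pow_mul]
  have hi : ∀ i, ∫ x in cell, (modeSum S t : Plane → Plane) x i ^ 4 ≤
      quarticConst * (∑ k ∈ S, normSq k * t k ^ 2) ^ 2 := by
    intro i
    simp_rw [hcomp i]
    refine (integral_sum_cas_pow_four_le S hS _).trans ?_
    have hq := quarticConst_nonneg
    have h0 : 0 ≤ ∑ k ∈ S, normSq k * (t k * ((2 * Real.pi)⁻¹ * perp k i)) ^ 2 :=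
      Finset.sum_nonneg fun k _ => mul_nonneg (normSq_nonneg k) (sq_nonneg _)
    refine mul_le_mul_of_nonneg_left (pow_le_pow_left₀ h0 (Finset.sum_le_sum fun k _ =>
      mul_le_mul_of_nonneg_left ?_ (normSq_nonneg k)) 2) hq
    · have h1 := perp_sq_le k i
      have h2 : (2 * Real.pi)⁻¹ ^ 2 ≤ 1 := by
        refine pow_le_one₀ (by positivity) (inv_le_one_of_one_le₀ ?_)
        linarith [Real.pi_gt_three]
      have h3 : (2 * Real.pi)⁻¹ ^ 2 * perp k i ^ 2 ≤ 1 := mul_le_one₀ h2 (sq_nonneg _) h1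
      rw [mul_pow, mul_pow]
      exact mul_le_of_le_one_right (sq_nonneg _) h3
  have hle : ∀ x, ‖(modeSum S t : Plane → Plane) x‖ ^ 4 ≤
      2 * (modeSum S t : Plane → Plane) x 0 ^ 4 + 2 * (modeSum S t : Plane → Plane) x 1 ^ 4 := by
    intro x
    have h1 := EuclideanSpace.real_norm_sq_eq ((modeSum S t : Plane → Plane) x)
    rw [Fin.sum_univ_two] at h1
    have h2 : ‖(modeSum S t : Plane → Plane) x‖ ^ 4 =
      (‖(modeSum S t : Plane → Plane) x‖ ^ 2) ^ 2 := by ring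
    rw [h2, h1]
    nlinarith [sq_nonneg ((modeSum S t : Plane → Plane) x 0 ^ 2 -
      (modeSum S t : Plane → Plane) x 1 ^ 2)]
  have hint := integral_mono (μ := (volume : Measure Plane).restrict cell)
    (Continuous.integrableOn_cell (by fun_prop)) (Continuous.integrableOn_cell (by fun_prop)) hle
  rw [integral_add (Continuous.integrableOn_cell (by fun_prop))
    (Continuous.integrableOn_cell (by fun_prop)), integral_const_mul, integral_const_mul] at hint
  rw [hA]
  linarith [hi 0, hi 1]

/-- The constant of the embedding of `V` into `L⁴`. -/
def sobolevConst : ℝ := (4 * quarticConst) ^ (4⁻¹ : ℝ)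

theorem sobolevConst_nonneg : 0 ≤ sobolevConst :=
  Real.rpow_nonneg (mul_nonneg (by norm_num) quarticConst_nonneg) _

theorem eLpNorm_emb_le (Z : modeSpan) :
    eLpNorm (field (emb Z)) 4 ((volume : Measure Plane).restrict cell) ≤
      ENNReal.ofReal (sobolevConst * normV (emb Z)) := by
  have hq := quarticConst_nonneg
  have hn := normV_nonneg (emb Z)
  rw [eLpNorm_congr_ae (coeFn_field_emb Z),
    ((continuous_of_mem_modeSpan Z.2).memLp_cell 4).eLpNorm_eq_integral_rpow_norm
      (by norm_num) (by norm_num)]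
  refine ENNReal.ofReal_le_ofReal ?_
  have h4 : (4 : ENNReal).toReal = (4 : ℕ) := by norm_num
  rw [h4]
  simp_rw [Real.rpow_natCast]
  have e : sobolevConst * normV (emb Z) =
      (4 * quarticConst * normV (emb Z) ^ 4) ^ (((4 : ℕ) : ℝ)⁻¹) := by
    rw [Real.mul_rpow (by positivity) (by positivity), Real.pow_rpow_inv_natCast hn (by norm_num),
      sobolevConst]
    norm_num
  rw [e]
  exact Real.rpow_le_rpow (integral_nonneg fun x => by positivity) (integral_norm_pow_four_le Z)
    (by positivity)

/-- Approximation in `V` by trigonometric polynomials gives almost everywhere convergence along a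
subsequence, and Fatou's lemma carries the `L⁴` bound to the limit. -/
theorem eLpNorm_field_le (u : spaceV) :
    eLpNorm (field u) 4 ((volume : Measure Plane).restrict cell) ≤
      ENNReal.ofReal (sobolevConst * normV u) := by
  obtain ⟨p, hp, hlim⟩ := mem_closure_iff_seq_limit.mp (denseRange_emb u)
  choose Z hZ using hp
  have h1 : Tendsto (fun n => field (p n)) atTop (𝓝 (field u)) :=
    (continuous_field.tendsto u).comp hlim
  obtain ⟨ns, hns, hae⟩ := (tendstoInMeasure_of_tendsto_Lp h1).exists_seq_tendsto_ae
  refine (Lp.eLpNorm_lim_le_liminf_eLpNorm (fun n => Lp.aestronglyMeasurable (field (p (ns n)))) _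
    hae).trans ?_
  have h2 : Tendsto (fun n => ENNReal.ofReal (sobolevConst * normV (p (ns n)))) atTop
      (𝓝 (ENNReal.ofReal (sobolevConst * normV u))) :=
    ENNReal.tendsto_ofReal ((((continuous_normV.tendsto u).comp hlim).comp
      hns.tendsto_atTop).const_mul _)
  rw [← h2.liminf_eq]
  refine liminf_le_liminf (Eventually.of_forall fun n => ?_)
  rw [← hZ]
  exact eLpNorm_emb_le _

theorem memLp_field_four (u : spaceV) :
    MemLp (field u) 4 ((volume : Measure Plane).restrict cell) :=
  ⟨Lp.aestronglyMeasurable _, (eLpNorm_field_le u).trans_lt ENNReal.ofReal_lt_top⟩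

instance : ENNReal.HolderTriple 4 4 2 := ⟨by
  rw [← two_mul, show (4 : ENNReal) = 2 * 2 by norm_num, ENNReal.mul_inv (by norm_num) (by norm_num),
    ← mul_assoc, ENNReal.mul_inv_cancel (by norm_num) (by norm_num), one_mul]⟩

theorem eLpNorm_mul_le_mul {α : Type*} [MeasurableSpace α] {μ : Measure α} {f g : α → ℝ}
    (p q r : ENNReal) [ENNReal.HolderTriple p q r] (hf : AEStronglyMeasurable f μ)
    (hg : AEStronglyMeasurable g μ) :
    eLpNorm (fun x => f x * g x) r μ ≤ eLpNorm f p μ * eLpNorm g q μ := by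
  have h : eLpNorm (f • g) r μ ≤ eLpNorm f p μ * eLpNorm g q μ :=
    eLpNorm_smul_le_mul_eLpNorm hg hf
  exact h

theorem eLpNorm_triple_le {α : Type*} [MeasurableSpace α] {μ : Measure α} {a b c : α → Plane}
    (ha : MemLp a 4 μ) (hb : MemLp b 2 μ) (hc : MemLp c 4 μ) :
    eLpNorm (fun x => ‖a x‖ * ‖c x‖ * ‖b x‖) 1 μ ≤
      eLpNorm a 4 μ * eLpNorm c 4 μ * eLpNorm b 2 μ := by
  have h1 := eLpNorm_mul_le_mul 4 4 2 ha.norm.1 hc.norm.1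
  have h2 := eLpNorm_mul_le_mul 2 2 1 (ha.norm.1.mul hc.norm.1) hb.norm.1
  rw [eLpNorm_norm, eLpNorm_norm] at h1
  rw [eLpNorm_norm] at h2
  exact h2.trans (mul_le_mul_left h1 _)

/-- Hölder's inequality with exponents `4`, `2`, `4`. Integrability is recorded as well, since
without it the integral would not be additive in its arguments. -/
theorem integrable_triple {α : Type*} [MeasurableSpace α] {μ : Measure α} {a b c : α → Plane}
    (ha : MemLp a 4 μ) (hb : MemLp b 2 μ) (hc : MemLp c 4 μ) (j : Fin 2) :
    Integrable (fun x => a x j * inner ℝ (b x) (c x)) μ ∧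
      |∫ x, a x j * inner ℝ (b x) (c x) ∂μ| ≤
        (eLpNorm a 4 μ).toReal * (eLpNorm b 2 μ).toReal * (eLpNorm c 4 μ).toReal := by
  have hm : AEStronglyMeasurable (fun x => a x j * inner ℝ (b x) (c x)) μ := by
    refine AEStronglyMeasurable.mul ?_ (hb.1.inner hc.1)
    exact (EuclideanSpace.proj j : Plane →L[ℝ] ℝ).continuous.comp_aestronglyMeasurable ha.1
  have hle : ∀ x, ‖a x j * inner ℝ (b x) (c x)‖ ≤ ‖a x‖ * ‖c x‖ * ‖b x‖ := by
    intro x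
    rw [norm_mul, mul_assoc, mul_comm ‖c x‖]
    exact mul_le_mul (PiLp.norm_apply_le (a x) j) (norm_inner_le_norm _ _) (norm_nonneg _)
      (norm_nonneg _)
  have hb1 := (eLpNorm_mono_real (μ := μ) (p := 1) hle).trans (eLpNorm_triple_le ha hb hc)
  have htop : eLpNorm a 4 μ * eLpNorm c 4 μ * eLpNorm b 2 μ ≠ ⊤ :=
    ENNReal.mul_ne_top (ENNReal.mul_ne_top ha.2.ne hc.2.ne) hb.2.ne
  have hint : Integrable (fun x => a x j * inner ℝ (b x) (c x)) μ :=
    memLp_one_iff_integrable.mp ⟨hm, hb1.trans_lt htop.lt_top⟩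
  refine ⟨hint, ?_⟩
  have h3 := norm_integral_le_integral_norm (μ := μ) fun x => a x j * inner ℝ (b x) (c x)
  rw [Real.norm_eq_abs, integral_norm_eq_lintegral_enorm hm, ← eLpNorm_one_eq_lintegral_enorm] at h3
  refine h3.trans ((ENNReal.toReal_mono htop hb1).trans (le_of_eq ?_))
  rw [ENNReal.toReal_mul, ENNReal.toReal_mul]
  ring

theorem toReal_eLpNorm_field_le (u : spaceV) :
    (eLpNorm (field u) 4 ((volume : Measure Plane).restrict cell)).toReal ≤
      sobolevConst * normV u :=
  ENNReal.toReal_le_of_le_ofReal (mul_nonneg sobolevConst_nonneg (normV_nonneg u))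
    (eLpNorm_field_le u)

/-- The integral `∫ a_j b · c`. -/
def triInt (j : Fin 2) (a b c : L2) : ℝ := ∫ x in cell, a x j * inner ℝ (b x) (c x)

theorem triInt_comm (j : Fin 2) (a b c : L2) : triInt j a b c = triInt j a c b := by
  simp only [triInt, real_inner_comm]

theorem integrable_triInt (j : Fin 2) (u w : spaceV) (b : L2) :
    Integrable (fun x => field u x j * inner ℝ (b x) (field w x))
      ((volume : Measure Plane).restrict cell) :=
  (integrable_triple (memLp_field_four u) (Lp.memLp b) (memLp_field_four w) j).1

theorem abs_triInt_le (j : Fin 2) (u w : spaceV) (b : L2) :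
    |triInt j (field u) b (field w)| ≤ sobolevConst ^ 2 * (normV u * ‖b‖ * normV w) := by
  refine (integrable_triple (memLp_field_four u) (Lp.memLp b) (memLp_field_four w) j).2.trans ?_
  rw [← Lp.norm_def]
  have h1 := toReal_eLpNorm_field_le u
  have h2 := toReal_eLpNorm_field_le w
  have h3 := sobolevConst_nonneg
  have h4 := normV_nonneg u
  calc _ ≤ (sobolevConst * normV u) * ‖b‖ * (sobolevConst * normV w) := by gcongr
    _ = _ := by ring

theorem formB_eq (u v w : spaceV) :
    formB u v w = ∑ j, triInt j (field u) (weakD j v) (field w) := by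
  unfold formB triInt
  rw [← integral_finsetSum _ fun j _ => integrable_triInt j u w (weakD j v)]
  refine integral_congr_ae (Eventually.of_forall fun x => ?_)
  simp only [sum_inner, real_inner_smul_left]

theorem triInt_add_left (j : Fin 2) (u u' w : spaceV) (b : L2) :
    triInt j (field (u + u')) b (field w) =
      triInt j (field u) b (field w) + triInt j (field u') b (field w) := by
  unfold triInt
  rw [← integral_add (integrable_triInt j u w b) (integrable_triInt j u' w b)]
  refine integral_congr_ae ?_
  filter_upwards [Lp.coeFn_add (field u) (field u')] with x hx
  rw [field_add, hx, Pi.add_apply, PiLp.add_apply, add_mul]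

theorem triInt_add_mid (j : Fin 2) (u w : spaceV) (b b' : L2) :
    triInt j (field u) (b + b') (field w) =
      triInt j (field u) b (field w) + triInt j (field u) b' (field w) := by
  unfold triInt
  rw [← integral_add (integrable_triInt j u w b) (integrable_triInt j u w b')]
  refine integral_congr_ae ?_
  filter_upwards [Lp.coeFn_add b b'] with x hx
  rw [hx, Pi.add_apply, inner_add_left, mul_add]

theorem triInt_add_right (j : Fin 2) (u w w' : spaceV) (b : L2) :
    triInt j (field u) b (field (w + w')) =
      triInt j (field u) b (field w) + triInt j (field u) b (field w') := by
  unfold triInt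
  rw [← integral_add (integrable_triInt j u w b) (integrable_triInt j u w' b)]
  refine integral_congr_ae ?_
  filter_upwards [Lp.coeFn_add (field w) (field w')] with x hx
  rw [field_add, hx, Pi.add_apply, inner_add_right, mul_add]

theorem triInt_smul_mid (j : Fin 2) (c : ℝ) (a b d : L2) :
    triInt j a (c • b) d = c * triInt j a b d := by
  unfold triInt
  rw [← integral_const_mul]
  refine integral_congr_ae ?_
  filter_upwards [Lp.coeFn_smul c b] with x hx
  rw [hx, Pi.smul_apply, real_inner_smul_left]
  ring

theorem formB_add_left (u u' v w : spaceV) :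
    formB (u + u') v w = formB u v w + formB u' v w := by
  simp only [formB_eq, triInt_add_left, Finset.sum_add_distrib]

/-- The form `(v, w) ↦ ⟨B(u, v), w⟩` as a bilinear form. -/
def bilinB (u : spaceV) : LinearMap.BilinForm ℝ spaceV :=
  LinearMap.mk₂ ℝ (formB u)
    (fun v v' w => by
      simp only [formB_eq, weakD_add, triInt_add_mid, Finset.sum_add_distrib])
    (fun c v w => by
      simp only [formB_eq, weakD_smul, triInt_smul_mid, Finset.mul_sum, smul_eq_mul])
    (fun v w w' => by simp only [formB_eq, triInt_add_right, Finset.sum_add_distrib])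
    (fun c v w => by
      simp only [formB_eq, field_smul]
      rw [smul_eq_mul, Finset.mul_sum]
      refine Finset.sum_congr rfl fun j _ => ?_
      rw [triInt_comm, triInt_smul_mid, triInt_comm])

theorem bilinB_apply (u v w : spaceV) : bilinB u v w = formB u v w := rfl

/-- A bound for the trilinear form on `V`. -/
theorem abs_formB_le (u v w : spaceV) :
    |formB u v w| ≤ 2 * sobolevConst ^ 2 * (normV u * normV v * normV w) := by
  have h : ∀ j, |triInt j (field u) (weakD j v) (field w)| ≤
      sobolevConst ^ 2 * (normV u * normV v * normV w) := by
    intro j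
    refine (abs_triInt_le j u w _).trans ?_
    have h1 := norm_weakD_le j v
    have h2 := normV_nonneg u
    have h3 := normV_nonneg w
    gcongr
  rw [formB_eq, Fin.sum_univ_two]
  refine (abs_add_le _ _).trans ?_
  linarith [h 0, h 1]

end NSE

namespace NSE

/-! ## Cancellations in the trilinear form -/

theorem comp_mem_trigAlg (i : Fin 2) {Z : Plane → Plane} (hZ : Z ∈ modeSpan) :
    (fun x => Z x i) ∈ trigAlg := by
  induction hZ using Submodule.span_induction with
  | zero => exact trigAlg.zero_mem
  | add x y _ _ hx hy => exact trigAlg.add_mem hx hy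
  | smul a x _ hx => exact trigAlg.smul_mem hx a
  | mem f hf =>
    obtain ⟨k, rfl⟩ := hf
    have e : (fun x => mode k x i) = ((2 * Real.pi)⁻¹ * perp k i) • cas k := by
      funext x
      simp only [mode, PiLp.smul_apply, Pi.smul_apply, smul_eq_mul]
      ring
    rw [e]
    exact trigAlg.smul_mem (cas_mem_trigAlg k) _

/-- The components of a field in `modeSpan`. -/
def comp (i : Fin 2) (Z : modeSpan) : trigAlg :=
  ⟨fun x => (Z : Plane → Plane) x i, comp_mem_trigAlg i Z.2⟩

theorem trigD_comp (i j : Fin 2) (Z : modeSpan) : trigD j (comp i Z) = comp i (modeD j Z) := by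
  refine Subtype.ext (funext fun x => ?_)
  change fderiv ℝ (fun x => (Z : Plane → Plane) x i) x _ = fderiv ℝ (Z : Plane → Plane) x _ i
  have h := ((EuclideanSpace.proj i : Plane →L[ℝ] ℝ).hasFDerivAt.comp x
    (differentiable_of_mem_modeSpan Z.2 x).hasFDerivAt).fderiv
  have e : (EuclideanSpace.proj i : Plane →L[ℝ] ℝ) ∘ (Z : Plane → Plane) =
    fun x => (Z : Plane → Plane) x i := rfl
  rw [e] at h
  rw [h]
  rfl

theorem sum_trigD_comp (Z : modeSpan) : ∑ j, trigD j (comp j Z) = 0 := by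
  refine Subtype.ext (funext fun x => ?_)
  have h := div_of_mem_modeSpan Z.2 x
  rw [Fin.sum_univ_two] at h ⊢
  rw [trigD_comp, trigD_comp]
  exact h

theorem formB_emb (U Y W : modeSpan) : formB (emb U) (emb Y) (emb W) =
    trigInt (∑ j, ∑ i, comp j U * trigD j (comp i Y) * comp i W) := by
  rw [formB_eq, map_sum]
  refine Finset.sum_congr rfl fun j _ => ?_
  rw [weakD_emb]
  change _ = ∫ x in cell, ((∑ i, comp j U * trigD j (comp i Y) * comp i W : trigAlg) :
    Plane → ℝ) x
  refine integral_congr_ae ?_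
  filter_upwards [coeFn_field_emb U, coeFn_field_emb (modeD j Y), coeFn_field_emb W]
    with x h1 h2 h3
  rw [h1, h2, h3]
  simp only [trigD_comp, Fin.sum_univ_two, PiLp.inner_apply]
  change _ = (U : Plane → Plane) x j * (modeD j Y : Plane → Plane) x 0 * (W : Plane → Plane) x 0 +
    (U : Plane → Plane) x j * (modeD j Y : Plane → Plane) x 1 * (W : Plane → Plane) x 1
  simp only [RCLike.inner_apply, conj_trivial]
  ring

theorem continuous_formB : Continuous fun p : spaceV × spaceV => formB p.1 p.2 p.2 := by
  rw [continuous_iff_continuousAt]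
  rintro ⟨u, w⟩
  rw [ContinuousAt, tendsto_iff_norm_sub_tendsto_zero]
  have hN := continuous_normV
  have hb : ∀ p : spaceV × spaceV, ‖formB p.1 p.2 p.2 - formB u w w‖ ≤
      2 * sobolevConst ^ 2 * (normV (p.1 - u) * normV p.2 * normV p.2) +
      2 * sobolevConst ^ 2 * (normV u * normV (p.2 - w) * normV p.2) +
      2 * sobolevConst ^ 2 * (normV u * normV w * normV (p.2 - w)) := by
    rintro ⟨u', w'⟩
    have e : formB u' w' w' - formB u w w =
        formB (u' - u) w' w' + formB u (w' - w) w' + formB u w (w' - w) := by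
      have h1 := formB_add_left (u' - u) u w' w'
      rw [sub_add_cancel] at h1
      have h2 : formB u (w' - w) w' = formB u w' w' - formB u w w' := by
        simp only [← bilinB_apply, map_sub, LinearMap.sub_apply]
      have h3 : formB u w (w' - w) = formB u w w' - formB u w w := by
        simp only [← bilinB_apply, map_sub]
      rw [h1, h2, h3]; ring
    rw [e, Real.norm_eq_abs]
    exact (abs_add_three _ _ _).trans
      (add_le_add (add_le_add (abs_formB_le _ _ _) (abs_formB_le _ _ _)) (abs_formB_le _ _ _))
  refine squeeze_zero (fun _ => norm_nonneg _) hb ?_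
  have hc : Continuous fun p : spaceV × spaceV =>
      2 * sobolevConst ^ 2 * (normV (p.1 - u) * normV p.2 * normV p.2) +
      2 * sobolevConst ^ 2 * (normV u * normV (p.2 - w) * normV p.2) +
      2 * sobolevConst ^ 2 * (normV u * normV w * normV (p.2 - w)) := by fun_prop
  have h0 : normV 0 = 0 := by simpa using normV_smul 0 0
  have := hc.tendsto (u, w)
  simpa [h0] using this

/-- Continuity on `V × V` extends the skew-symmetry from trigonometric polynomials, where it is
integration by parts. -/
theorem formB_self_right (u w : spaceV) : formB u w w = 0 := by
  have hcl : IsClosed {p : spaceV × spaceV | formB p.1 p.2 p.2 = 0} :=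
    isClosed_eq continuous_formB continuous_const
  have hd : DenseRange (Prod.map emb emb) := denseRange_emb.prodMap denseRange_emb
  refine hd.induction_on (p := fun p => formB p.1 p.2 p.2 = 0) (u, w) hcl ?_
  rintro ⟨U, W⟩
  change formB (emb U) (emb W) (emb W) = 0
  rw [formB_emb]
  exact trigInt_transport_self (fun j => comp j U) (fun i => comp i W) (sum_trigD_comp U)

theorem modeD_modeSum (j : Fin 2) (S : Finset (Fin 2 → ℤ)) (t : (Fin 2 → ℤ) → ℝ) :
    modeD j (modeSum S t) = ∑ k ∈ S, (-(t k * k j)) • ⟨mode (-k), mode_mem (-k)⟩ := by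
  rw [modeSum, map_sum]
  refine Finset.sum_congr rfl fun k _ => ?_
  have : modeD j ⟨mode k, mode_mem k⟩ = (-(k j : ℝ)) • ⟨mode (-k), mode_mem (-k)⟩ :=
    Subtype.ext (partialD_mode j k)
  rw [map_smul, this, smul_smul, mul_neg]

theorem modeD_modeD_modeSum (j : Fin 2) (S : Finset (Fin 2 → ℤ)) (t : (Fin 2 → ℤ) → ℝ) :
    modeD j (modeD j (modeSum S t)) = modeSum S fun k => -((k j : ℝ) ^ 2 * t k) := by
  rw [modeD_modeSum, map_sum, modeSum]
  refine Finset.sum_congr rfl fun k _ => ?_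
  have : modeD j ⟨mode (-k), mode_mem (-k)⟩ = (k j : ℝ) • ⟨mode k, mode_mem k⟩ := by
    refine Subtype.ext ((partialD_mode j (-k)).trans ?_)
    simp
  rw [map_smul, this, smul_smul]
  congr 1
  ring

theorem neg_laplacian_modeSum (S : Finset (Fin 2 → ℤ)) (t : (Fin 2 → ℤ) → ℝ) :
    modeSum S (fun k => normSq k * t k) = -∑ j, modeD j (modeD j (modeSum S t)) := by
  simp only [modeD_modeD_modeSum, Fin.sum_univ_two]
  simp only [modeSum]
  rw [← Finset.sum_add_distrib, ← Finset.sum_neg_distrib]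
  refine Finset.sum_congr rfl fun k _ => ?_
  rw [← add_smul, ← neg_smul]
  congr 1
  simp only [normSq, Fin.sum_univ_two]
  ring

/-- The form `⟨B(z, z), A z⟩` vanishes. -/
theorem formB_self_laplacian (S : Finset (Fin 2 → ℤ)) (t : (Fin 2 → ℤ) → ℝ) :
    formB (emb (modeSum S t)) (emb (modeSum S t)) (emb (modeSum S fun k => normSq k * t k)) = 0 := by
  set Z := modeSum S t with hZ
  have h := trigInt_transport_laplacian (fun j => comp j Z) (sum_trigD_comp Z)
  have e : ∀ i, comp i (modeSum S fun k => normSq k * t k) =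
      -∑ j, trigD j (trigD j (comp i Z)) := by
    intro i
    rw [neg_laplacian_modeSum, ← hZ]
    simp only [trigD_comp, Fin.sum_univ_two]
    rfl
  rw [formB_emb]
  have e2 : ∑ j, ∑ i, comp j Z * trigD j (comp i Z) *
      comp i (modeSum S fun k => normSq k * t k) =
      -∑ j, ∑ i, comp j Z * trigD j (comp i Z) * ∑ k, trigD k (trigD k (comp i Z)) := by
    simp only [e, Fin.sum_univ_two]
    ring
  rw [e2, map_neg, h, neg_zero]

theorem formA_modeV (k l : Fin 2 → ℤ) :
    formA (modeV k) (modeV l) = if k = l then normSq k else 0 := by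
  rw [formA_modeV_left, inner_field_modeV]
  by_cases hkl : k = l
  · subst hkl
    by_cases hk : k = 0
    · subst hk; simp [normSq_zero]
    · simp [hk]
  · simp [hkl]

/-- In Fourier coefficients this is `k_j² |k|² ≤ |k|⁴`. -/
theorem normV_modeD_le {S : Finset (Fin 2 → ℤ)} (hS : 0 ∉ S) (t : (Fin 2 → ℤ) → ℝ) (j : Fin 2) :
    normV (emb (modeD j (modeSum S t))) ≤
      ‖field (emb (modeSum S fun k => normSq k * t k))‖ := by
  refine abs_le_of_sq_le_sq' ?_ (norm_nonneg _) |>.2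
  have e : emb (modeD j (modeSum S t)) = ∑ k ∈ S, (-(t k * k j)) • modeV (-k) := by
    rw [modeD_modeSum, map_sum]
    exact Finset.sum_congr rfl fun k _ => map_smul _ _ _
  rw [normV_sq, ← real_inner_self_eq_norm_sq, inner_field_modeSum hS, e, ← bilinA_apply, map_sum]
  refine Finset.sum_le_sum fun k hk => ?_
  rw [map_sum, LinearMap.sum_apply, Finset.sum_eq_single k]
  · simp only [map_smul, LinearMap.smul_apply, bilinA_apply, formA_modeV, if_true, normSq_neg,
      smul_eq_mul]
    have h1 : (k j : ℝ) ^ 2 ≤ normSq k :=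
      Finset.single_le_sum (f := fun i => (k i : ℝ) ^ 2) (fun _ _ => sq_nonneg _)
        (Finset.mem_univ j)
    have h2 := mul_le_mul_of_nonneg_left h1 (mul_nonneg (normSq_nonneg k) (sq_nonneg (t k)))
    linarith
  · intro l _ hl
    simp only [map_smul, LinearMap.smul_apply, bilinA_apply, formA_modeV, neg_inj, hl,
      if_false, smul_zero]
  · exact fun h => absurd hk h

/-- Here `q` is only in `V`: both `q` and `∂_j z` are put in `L⁴`, the latter through its `V` norm,
which `|A z|` dominates, and `A z` is put in `L²`. -/
theorem abs_formB_laplacian_le (q : spaceV) {S : Finset (Fin 2 → ℤ)} (hS : 0 ∉ S)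
    (t : (Fin 2 → ℤ) → ℝ) :
    |formB q (emb (modeSum S t)) (emb (modeSum S fun k => normSq k * t k))| ≤
      2 * sobolevConst ^ 2 *
        (normV q * ‖field (emb (modeSum S fun k => normSq k * t k))‖ ^ 2) := by
  set a := field (emb (modeSum S fun k => normSq k * t k)) with ha
  have h : ∀ j, |triInt j (field q) (weakD j (emb (modeSum S t))) a| ≤
      sobolevConst ^ 2 * (normV q * ‖a‖ ^ 2) := by
    intro j
    rw [triInt_comm, weakD_emb, sq ‖a‖]
    refine (abs_triInt_le j q _ a).trans ?_
    have h1 := normV_modeD_le hS t j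
    have h2 := normV_nonneg q
    rw [mul_assoc (normV q)]
    gcongr
  rw [formB_eq, Fin.sum_univ_two]
  refine (abs_add_le _ _).trans ?_
  linarith [h 0, h 1]

end NSE

namespace NSE

/-! ## Regularity of steady states -/

/-- The Stokes operator with a transport term, as a bilinear form. -/
def bilinOseen (α : ℝ) (v : spaceV) : LinearMap.BilinForm ℝ spaceV := bilinA + α • bilinB v

theorem bilinOseen_apply (α : ℝ) (v u w : spaceV) :
    bilinOseen α v u w = formA u w + α * formB v u w := rfl

theorem bilinOseen_self (α : ℝ) (v u : spaceV) : bilinOseen α v u u = normV u ^ 2 := by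
  rw [bilinOseen_apply, formB_self_right, mul_zero, add_zero, normV_sq]

theorem abs_bilinOseen_le (α : ℝ) (v u w : spaceV) : |bilinOseen α v u w| ≤
    (1 + |α| * (2 * sobolevConst ^ 2 * normV v)) * (normV u * normV w) := by
  rw [bilinOseen_apply]
  refine (abs_add_le _ _).trans ?_
  rw [abs_mul]
  have h1 := abs_formA_le u w
  have h2 := mul_le_mul_of_nonneg_left (abs_formB_le v u w) (abs_nonneg α)
  linarith

/-- Solvability of the Galerkin equations. -/
theorem exists_galerkin (α : ℝ) (g : L2) (v : spaceV) {S : Finset (Fin 2 → ℤ)} (hS : 0 ∉ S) :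
    ∃ t : (Fin 2 → ℤ) → ℝ, ∀ s : (Fin 2 → ℤ) → ℝ,
      bilinOseen α v (emb (modeSum S t)) (emb (modeSum S s)) =
        inner ℝ g (field (emb (modeSum S s))) := by
  classical
  set ext : (S → ℝ) → (Fin 2 → ℤ) → ℝ := fun t k => if h : k ∈ S then t ⟨k, h⟩ else 0 with hext
  set T : (S → ℝ) →ₗ[ℝ] spaceV := Fintype.linearCombination ℝ fun l : S => modeV l with hT
  have hTe : ∀ t, T t = emb (modeSum S (ext t)) := by
    intro t
    rw [emb_modeSum, ← Finset.sum_coe_sort S, hT, Fintype.linearCombination_apply]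
    refine Finset.sum_congr rfl fun k _ => ?_
    simp [hext]
  set L : (S → ℝ) →ₗ[ℝ] (S → ℝ) :=
    LinearMap.pi fun k : S => ((bilinOseen α v).flip (modeV k)) ∘ₗ T with hL
  have hLa : ∀ t (k : S), L t k = bilinOseen α v (T t) (modeV k) := fun t k => rfl
  -- The square linear system is solvable because it is injective, and coercivity of the Oseen form
  -- gives injectivity.
  have hinj : Function.Injective L := by
    refine (injective_iff_map_eq_zero L).mpr fun t ht => ?_
    have h0 : bilinOseen α v (T t) (T t) = 0 := by
      have e : T t = ∑ k : S, t k • modeV k := Fintype.linearCombination_apply ℝ _ t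
      conv_lhs => arg 2; rw [e]
      rw [map_sum]
      refine Finset.sum_eq_zero fun k _ => ?_
      rw [map_smul, ← hLa, ht]
      simp
    rw [bilinOseen_self] at h0
    have h1 : normV (T t) = 0 := by simpa using h0
    have h2 : field (T t) = 0 := norm_le_zero_iff.mp (h1 ▸ norm_field_le (T t))
    have h3 := inner_field_modeSum hS (ext t) (ext t)
    rw [← hTe, h2, inner_zero_left] at h3
    have h4 := (Finset.sum_eq_zero_iff_of_nonneg fun k _ => mul_self_nonneg (ext t k)).mp h3.symm
    funext k
    have := h4 k k.2
    simpa [hext] using this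
  obtain ⟨t, ht⟩ := (LinearMap.injective_iff_surjective.mp hinj)
    fun k => inner ℝ g (field (modeV k))
  refine ⟨ext t, fun s => ?_⟩
  rw [← hTe, field_sum_modeV, emb_modeSum, map_sum, inner_sum]
  refine Finset.sum_congr rfl fun k hk => ?_
  rw [map_smul, real_inner_smul_right, smul_eq_mul]
  congr 1
  exact (hLa t ⟨k, hk⟩).symm.trans (congrFun ht ⟨k, hk⟩)

theorem exists_modeSum_near (v : spaceV) {δ : ℝ} (hδ : 0 < δ) :
    ∃ (S : Finset (Fin 2 → ℤ)) (s : (Fin 2 → ℤ) → ℝ), 0 ∉ S ∧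
      normV (emb (modeSum S s) - v) < δ := by
  have hc : Continuous fun w => normV (w - v) :=
    continuous_normV.comp (continuous_id.sub continuous_const)
  have ho : IsOpen {w | normV (w - v) < δ} := isOpen_lt hc continuous_const
  have h0 : normV (v - v) < δ := by
    have : normV 0 = 0 := by simpa using normV_smul 0 0
    rwa [sub_self, this]
  obtain ⟨Z, hZ⟩ := denseRange_emb.exists_mem_open ho ⟨v, h0⟩
  obtain ⟨S, s, hS, rfl⟩ := exists_modeSum Z
  exact ⟨S, s, hS, hZ⟩

variable {α : ℝ} {g : L2} {v : spaceV}

/-- Galerkin approximations converge in `V` and are asymptotically bounded in `D(A)`. -/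
theorem IsSteadyState.exists_approx (hv : IsSteadyState α g v) {ε : ℝ} (hε : 0 < ε) :
    ∃ (S : Finset (Fin 2 → ℤ)) (t : (Fin 2 → ℤ) → ℝ), normV (v - emb (modeSum S t)) ≤ ε ∧
      (1 - |α| * (2 * sobolevConst ^ 2) * ε) *
        ‖field (emb (modeSum S fun k => normSq k * t k))‖ ≤ ‖g‖ := by
  set M := 1 + |α| * (2 * sobolevConst ^ 2 * normV v) with hM
  have hMpos : 0 < M := by
    have := normV_nonneg v
    positivity
  obtain ⟨S, s, hS, hs⟩ := exists_modeSum_near v (div_pos hε hMpos)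
  obtain ⟨t, ht⟩ := exists_galerkin α g v hS
  set z := emb (modeSum S t)
  set p := emb (modeSum S s)
  -- The steady state solves the linear problem whose transport velocity is frozen at `v`. Galerkin
  -- orthogonality and Céa's estimate follow, `M` being the bound of the bilinear form and `1` its
  -- coercivity constant; this fixes the tolerance `ε / M` above.
  have hvw : ∀ w, bilinOseen α v v w = inner ℝ g (field w) := hv
  have horth : ∀ r, bilinOseen α v (z - v) (emb (modeSum S r)) = 0 := fun r => by
    rw [map_sub, LinearMap.sub_apply, ht, hvw, sub_self]
  have hcea : normV (z - v) ^ 2 ≤ M * (normV (z - v) * normV (p - v)) := by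
    have e : bilinOseen α v (z - v) (z - v) = bilinOseen α v (z - v) (p - v) := by
      rw [map_sub (bilinOseen α v (z - v)), map_sub (bilinOseen α v (z - v)), horth, horth]
    rw [← bilinOseen_self α v, e]
    exact (le_abs_self _).trans (abs_bilinOseen_le α v _ _)
  have hzv : normV (v - z) ≤ ε := by
    rw [normV_sub_comm]
    rcases (normV_nonneg (z - v)).eq_or_lt with h0 | h0
    · rw [← h0]; exact hε.le
    · have h1 : normV (z - v) ≤ M * normV (p - v) := by
        refine le_of_mul_le_mul_left ?_ h0
        linarith
      refine h1.trans ?_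
      have := mul_le_mul_of_nonneg_left hs.le hMpos.le
      rwa [mul_div_cancel₀ _ hMpos.ne'] at this
  refine ⟨S, t, hzv, ?_⟩
  set a := emb (modeSum S fun k => normSq k * t k) with ha
  -- Testing with `a = A z`, which lies in the same Galerkin space. The transport velocity is split
  -- as `(v - z) + z`, and `⟨B(z, z), A z⟩ = 0`.
  have h1 : ‖field a‖ ^ 2 + α * formB (v - z) z a = inner ℝ g (field a) := by
    have h2 := ht fun k => normSq k * t k
    rw [bilinOseen_apply, ← ha] at h2
    rw [← h2, ← real_inner_self_eq_norm_sq]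
    have h3 : formA z a = inner ℝ (field a) (field a) := formA_modeSum_left S t a
    have h4 := formB_add_left (v - z) z z a
    have h5 : formB z z a = 0 := formB_self_laplacian S t
    rw [sub_add_cancel, h5, add_zero] at h4
    rw [h3, h4]
  have h2 : |formB (v - z) z a| ≤ 2 * sobolevConst ^ 2 * (normV (v - z) * ‖field a‖ ^ 2) :=
    abs_formB_laplacian_le (v - z) hS t
  have h3 : |α * formB (v - z) z a| ≤ |α| * (2 * sobolevConst ^ 2 * (ε * ‖field a‖ ^ 2)) := by
    rw [abs_mul]
    refine mul_le_mul_of_nonneg_left (h2.trans ?_) (abs_nonneg α)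
    gcongr
  have h4 := real_inner_le_norm g (field a)
  have h5 := (abs_le.mp h3).1
  rcases (norm_nonneg (field a)).eq_or_lt with h0 | h0
  · rw [← h0, mul_zero]; exact norm_nonneg g
  · refine le_of_mul_le_mul_right ?_ h0
    nlinarith

/-- The functional `w ↦ ⟨A v, w⟩` of a steady state `v` is bounded in `H` by the norm of the
force. -/
theorem IsSteadyState.abs_formA_le (hv : IsSteadyState α g v) (w : spaceV) :
    |formA v w| ≤ ‖g‖ * ‖field w‖ := by
  set κ := |α| * (2 * sobolevConst ^ 2) with hκ
  have hκ0 : 0 ≤ κ := by positivity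
  have hl : Tendsto (fun ε : ℝ => (1 - κ * ε) * |formA v w|) (𝓝[>] 0) (𝓝 (|formA v w|)) := by
    have : Continuous fun ε : ℝ => (1 - κ * ε) * |formA v w| := by fun_prop
    simpa using (this.tendsto 0).mono_left nhdsWithin_le_nhds
  have hr : Tendsto (fun ε : ℝ => ‖g‖ * ‖field w‖ + ε * normV w) (𝓝[>] 0)
      (𝓝 (‖g‖ * ‖field w‖)) := by
    have : Continuous fun ε : ℝ => ‖g‖ * ‖field w‖ + ε * normV w := by fun_prop
    simpa using (this.tendsto 0).mono_left nhdsWithin_le_nhds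
  refine le_of_tendsto_of_tendsto hl hr ?_
  -- The factor `1 - κ ε` must be nonnegative to multiply the estimate of `formA v w`; it tends to
  -- `1`, so `α` leaves no trace in the final bound.
  have hsmall : ∀ᶠ ε : ℝ in 𝓝[>] 0, κ * ε < 1 := by
    have : Continuous fun ε : ℝ => κ * ε := by fun_prop
    have h := (this.tendsto 0).mono_left (nhdsWithin_le_nhds (s := Set.Ioi 0))
    rw [mul_zero] at h
    exact h.eventually_lt_const one_pos
  filter_upwards [hsmall, self_mem_nhdsWithin] with ε h1 hε
  have hε : 0 < ε := hε
  obtain ⟨S, t, h2, h3⟩ := hv.exists_approx hε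
  set z := emb (modeSum S t)
  set a := field (emb (modeSum S fun k => normSq k * t k))
  have e : formA v w = formA (v - z) w + formA z w := by
    simp only [← bilinA_apply, map_sub, LinearMap.sub_apply]; ring
  have h4 : |formA v w| ≤ ε * normV w + ‖a‖ * ‖field w‖ := by
    rw [e]
    refine (abs_add_le _ _).trans (add_le_add ((NSE.abs_formA_le _ _).trans ?_) ?_)
    · exact mul_le_mul_of_nonneg_right h2 (normV_nonneg w)
    · rw [formA_modeSum_left]
      exact abs_real_inner_le_norm _ _
  have h5 : 0 ≤ 1 - κ * ε := by linarith
  have h6 := mul_le_mul_of_nonneg_left h4 h5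
  have h7 := mul_le_mul_of_nonneg_right h3 (norm_nonneg (field w))
  have h8 : 0 ≤ κ * ε * (ε * normV w) :=
    mul_nonneg (mul_nonneg hκ0 hε.le) (mul_nonneg hε.le (normV_nonneg w))
  nlinarith

end NSE

namespace NSE

/-! ## Existence of a Stokes eigenbasis -/

theorem exists_monotone_enumeration {J : Type*} [Countable J] [Infinite J] (f : J → ℝ)
    (hf : ∀ C, {k | f k ≤ C}.Finite) : ∃ e : ℕ ≃ J, Monotone (f ∘ e) := by
  obtain ⟨enc, henc⟩ := exists_injective_nat J
  -- Ties of `f` are broken by an injection into `ℕ`. Each element then has finitely many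
  -- predecessors, and their number is an injective rank compatible with `f`.
  set key : J → ℝ ×ₗ ℕ := fun k => toLex (f k, enc k) with hkey
  have hkinj : Function.Injective key := fun k l h => henc (Prod.ext_iff.mp (toLex.injective h)).2
  have hfst : ∀ {k l}, key k ≤ key l → f k ≤ f l := fun {k l} h => by
    rcases (Prod.Lex.toLex_le_toLex.mp h) with h | h
    · exact h.le
    · exact h.1.le
  have hfin : ∀ k, {l | key l < key k}.Finite := fun k =>
    (hf (f k)).subset fun l hl => hfst (le_of_lt hl)
  set r : J → ℕ := fun k => {l | key l < key k}.ncard with hr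
  have hlt : ∀ {k l}, key k < key l → r k < r l := fun {k l} h =>
    Set.ncard_lt_ncard ⟨fun _ hm => lt_trans hm h,
      fun hsub => lt_irrefl (key k) (hsub h : key k < key k)⟩ (hfin l)
  have hinj : Function.Injective r := by
    intro k l h
    rcases lt_trichotomy (key k) (key l) with h' | h' | h'
    · exact absurd h (hlt h').ne
    · exact hkinj h'
    · exact absurd h (hlt h').ne'
  have hmono : ∀ {k l}, r k ≤ r l → f k ≤ f l := fun {k l} h =>
    hfst (not_lt.mp fun h' => absurd (hlt h') (not_lt.mpr h))
  have : Infinite (Set.range r) := Set.infinite_coe_iff.mpr (Set.infinite_range_of_injective hinj)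
  classical
  refine ⟨(Nat.Subtype.orderIsoOfNat (Set.range r)).toEquiv.trans (Equiv.ofInjective r hinj).symm,
    fun n m hnm => hmono ?_⟩
  have h1 : ∀ n, r ((Equiv.ofInjective r hinj).symm
      (Nat.Subtype.orderIsoOfNat (Set.range r) n)) =
      (Nat.Subtype.orderIsoOfNat (Set.range r) n : ℕ) := fun n =>
    congrArg Subtype.val ((Equiv.ofInjective r hinj).apply_symm_apply _)
  have h2 : (Nat.Subtype.orderIsoOfNat (Set.range r) n : ℕ) ≤
      Nat.Subtype.orderIsoOfNat (Set.range r) m :=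
    (Nat.Subtype.orderIsoOfNat (Set.range r)).monotone hnm
  exact (h1 n).le.trans (h2.trans (h1 m).ge)

theorem finite_normSq_le (C : ℝ) : {k : Fin 2 → ℤ | normSq k ≤ C}.Finite := by
  refine (Set.finite_Icc (fun _ => -⌈C⌉ : Fin 2 → ℤ) (fun _ => ⌈C⌉)).subset fun k hk => ?_
  have h : ∀ i, |k i| ≤ ⌈C⌉ := by
    intro i
    have h1 : (k i : ℝ) ^ 2 ≤ C := (Finset.single_le_sum (f := fun i => (k i : ℝ) ^ 2)
      (fun _ _ => sq_nonneg _) (Finset.mem_univ i)).trans hk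
    have h2 : k i ^ 2 ≤ ⌈C⌉ := by
      have : ((k i ^ 2 : ℤ) : ℝ) ≤ (⌈C⌉ : ℝ) := by
        push_cast
        exact h1.trans (Int.le_ceil C)
      exact_mod_cast this
    have h3 : |k i| ≤ k i ^ 2 := by
      rw [← sq_abs]
      nlinarith [abs_nonneg (k i), sq_nonneg (|k i| - 1), Int.le_self_sq |k i|]
    exact h3.trans h2
  exact ⟨fun i => (abs_le.mp (h i)).1, fun i => (abs_le.mp (h i)).2⟩

/-- The nonzero Fourier modes, sorted by `|k|²`, form such a basis. -/
theorem nonempty_stokesEigenbasis : Nonempty StokesEigenbasis := by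
  have : Infinite {k : Fin 2 → ℤ // k ≠ 0} :=
    Set.infinite_coe_iff.mpr (Set.finite_singleton (0 : Fin 2 → ℤ)).infinite_compl
  have hfin : ∀ C, {k : {k : Fin 2 → ℤ // k ≠ 0} | normSq k ≤ C}.Finite := fun C =>
    (finite_normSq_le C).preimage Subtype.val_injective.injOn
  obtain ⟨e, he⟩ := exists_monotone_enumeration
    (fun k : {k : Fin 2 → ℤ // k ≠ 0} => normSq k) hfin
  refine ⟨⟨fun n => modeV (e n), fun n => normSq (e n),
    fun n => zero_lt_one.trans_le (one_le_normSq (e n).2), he, ?_, ?_, ?_,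
    fun n w => formA_modeV_left _ w⟩⟩
  · rw [tendsto_atTop, ← Nat.cofinite_eq_atTop]
    intro C
    have h : {n | normSq (e n) ≤ C}.Finite := (hfin C).preimage e.injective.injOn
    refine Filter.mem_of_superset h.compl_mem_cofinite fun n hn => ?_
    simp only [Set.mem_compl_iff, Set.mem_ofPred_eq, not_le] at hn
    exact hn.le
  · rw [orthonormal_iff_ite]
    intro m n
    rw [inner_field_modeV]
    have : ((e m : Fin 2 → ℤ) = e n ∧ (e m : Fin 2 → ℤ) ≠ 0) ↔ m = n := by
      rw [← Subtype.ext_iff, e.injective.eq_iff]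
      exact and_iff_left (e m).2
    simp only [this]
  · refine le_antisymm (Submodule.topologicalClosure_minimal _ (Submodule.span_le.mpr ?_)
      isClosed_spaceH) (Submodule.topologicalClosure_mono (Submodule.span_le.mpr ?_))
    · rintro _ ⟨n, rfl⟩
      exact field_mem_spaceH _
    · rintro f ⟨u, hu, hfu⟩
      have h1 : f = field (emb ⟨u, smoothFields_subset hu⟩) :=
        Lp.ext (hfu.trans (coeFn_field_emb ⟨u, smoothFields_subset hu⟩).symm)
      obtain ⟨S, t, hS, hZ⟩ := exists_modeSum ⟨u, smoothFields_subset hu⟩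
      rw [h1, hZ, field_sum_modeV]
      refine Submodule.sum_mem _ fun k hk => Submodule.smul_mem _ _ (Submodule.subset_span ?_)
      exact ⟨e.symm ⟨k, fun h => hS (h ▸ hk)⟩, by simp⟩

/-! ## Compactness of families of steady states -/

/-- The test field is the truncation of `A v` to finitely many eigenfunctions. Then `⟨A v, w⟩ =
|w|²`, and the functional bound gives `|w| ≤ |g|` for every truncation. -/
theorem IsSteadyState.mem_domain_one (𝔅 : StokesEigenbasis) {α : ℝ} {g : L2} {v : spaceV}
    (hv : IsSteadyState α g v) :
    field v ∈ 𝔅.domain 1 ∧ ‖𝔅.pow 1 (field v)‖ ≤ ‖g‖ := by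
  refine 𝔅.mem_domain_of_sum_le (norm_nonneg g) (field_mem_spaceH v) fun F => ?_
  set a := fun m => 𝔅.coeff 1 (field v) m with ha
  set w : spaceV := ∑ m ∈ F, a m • 𝔅.φ m with hw
  have hfw : field w = ∑ m ∈ F, a m • field (𝔅.φ m) := by
    rw [hw, ← fieldL_apply, map_sum]; rfl
  have h1 : formA v w = ∑ m ∈ F, a m ^ 2 := by
    rw [hw, ← bilinA_apply, map_sum]
    refine Finset.sum_congr rfl fun m _ => ?_
    rw [map_smul, bilinA_apply, formA_comm, 𝔅.eigen, smul_eq_mul, sq]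
    simp [ha, StokesEigenbasis.coeff]
  have h2 : ‖field w‖ ^ 2 = ∑ m ∈ F, a m ^ 2 := by
    rw [← real_inner_self_eq_norm_sq, hfw, 𝔅.orthonormal.inner_sum]
    exact Finset.sum_congr rfl fun m _ => by simp [sq]
  have h3 := (le_abs_self _).trans (hv.abs_formA_le w)
  rw [h1, ← h2] at h3
  rw [← h2]
  rcases (norm_nonneg (field w)).eq_or_lt with h0 | h0
  · rw [← h0, zero_pow two_ne_zero]; positivity
  · have : ‖field w‖ ≤ ‖g‖ := le_of_mul_le_mul_right (by rwa [← sq]) h0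
    gcongr

/-- Applying the functional bound to both steady states with `w = u - v` upgrades convergence in `H`
to convergence in `V`, whatever the coefficients `α` and `β`. -/
theorem normV_sub_sq_le {α β : ℝ} {g : L2} {u v : spaceV} (hu : IsSteadyState α g u)
    (hv : IsSteadyState β g v) :
    normV (u - v) ^ 2 ≤ 2 * ‖g‖ * ‖field u - field v‖ := by
  have e : normV (u - v) ^ 2 = formA u (u - v) - formA v (u - v) := by
    rw [normV_sq]
    rw [← bilinA_apply, map_sub bilinA, LinearMap.sub_apply, bilinA_apply, bilinA_apply]
  have h1 := (le_abs_self _).trans (hu.abs_formA_le (u - v))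
  have h2 := (neg_abs_le _).trans' (neg_le_neg (hv.abs_formA_le (u - v)))
  rw [field_sub] at h1 h2
  linarith

theorem tendsto_field_of_normV {ι : Type*} {l : Filter ι} {u : ι → spaceV} {v : spaceV}
    (h : Tendsto (fun n => normV (u n - v)) l (𝓝 0)) :
    Tendsto (fun n => field (u n)) l (𝓝 (field v)) := by
  rw [tendsto_iff_norm_sub_tendsto_zero]
  exact squeeze_zero (fun _ => norm_nonneg _) (fun n => norm_field_le (u n - v)) h

theorem exists_subseq_tendsto_normV (𝔅 : StokesEigenbasis) {g : L2} {α : ℕ → ℝ}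
    {v : ℕ → spaceV} (hv : ∀ n, IsSteadyState (α n) g (v n)) :
    ∃ (vlim : spaceV) (σ : ℕ → ℕ), StrictMono σ ∧
      Tendsto (fun n => normV (v (σ n) - vlim)) atTop (𝓝 0) := by
  have hd := fun n => (hv n).mem_domain_one 𝔅
  obtain ⟨w, hw, -, hlim⟩ := 𝔅.exists_weak_limit zero_le_one (norm_nonneg g)
    (fun n => (hd n).1) (fun n => (hd n).2) (hyperfilter ℕ)
  have h0 := 𝔅.tendsto_norm_pow_sub zero_lt_one (fun n => (hd n).1) (fun n => (hd n).2) hw hlim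
  have h1 : Tendsto (fun n => ‖field (v n) - w‖) (hyperfilter ℕ) (𝓝 0) := by
    refine h0.congr fun n => ?_
    rw [𝔅.pow_zero_apply (spaceH.sub_mem (field_mem_spaceH _) hw.1)]
  obtain ⟨σ, hσ, -, hf⟩ := exists_strictMono_of_eventually Nat.hyperfilter_le_atTop
    (P := fun _ _ => True) (fun _ => Eventually.of_forall fun _ => trivial)
    (f := fun _ n => ‖field (v n) - w‖) (fun _ => h1)
  have hL2 : Tendsto (fun n => field (v (σ n))) atTop (𝓝 w) :=
    tendsto_iff_norm_sub_tendsto_zero.mpr (hf 0)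
  have hcau : CauchySeq fun n => v (σ n) := by
    rw [Metric.cauchySeq_iff]
    intro ε hε
    have hδ : 0 < ε ^ 2 / (2 * ‖g‖ + 1) := by positivity
    obtain ⟨N, hN⟩ := Metric.cauchySeq_iff.mp hL2.cauchySeq _ hδ
    refine ⟨N, fun m hm n hn => ?_⟩
    have h2 := hN m hm n hn
    rw [dist_eq_norm, lt_div_iff₀ (by positivity)] at h2
    have h3 := normV_sub_sq_le (hv (σ m)) (hv (σ n))
    rw [dist_eq_norm]
    refine (norm_le_normV _).trans_lt (lt_of_pow_lt_pow_left₀ 2 hε.le ?_)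
    nlinarith [norm_nonneg (field (v (σ m)) - field (v (σ n)))]
  have : CompleteSpace spaceV := (Submodule.isClosed_topologicalClosure _).completeSpace_coe
  obtain ⟨vlim, hvlim⟩ := cauchySeq_tendsto_of_complete hcau
  refine ⟨vlim, σ, hσ, ?_⟩
  have hc : Continuous fun u => normV (u - vlim) :=
    continuous_normV.comp (continuous_id.sub continuous_const)
  have h5 := (hc.tendsto vlim).comp hvlim
  have h6 : normV 0 = 0 := by simpa using normV_smul 0 0
  rw [sub_self, h6] at h5
  exact h5

/-- The uniform bound in `D(A)` turns convergence in `V` into convergence in `D(A^{s 0})`, since `s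
0 < 1`. This starts the greedy construction; the compact embeddings between successive spaces keep
it going. -/
theorem exists_strictExpansion_of_tendsto (𝔅 : StokesEigenbasis) {g : L2} {α : ℕ → ℝ}
    {v : ℕ → spaceV} (hv : ∀ n, IsSteadyState (α n) g (v n)) {vlim : spaceV}
    (hlim : Tendsto (fun n => normV (v n - vlim)) atTop (𝓝 0)) {s : ℕ → ℝ} (hs : StrictAnti s)
    (h01 : ∀ k, s k ∈ Set.Ioo (1 / 2 : ℝ) 1) :
    ∃ τ : ℕ → ℕ, StrictMono τ ∧
      HasStrictExpansion (𝔅.nested s hs) (fun n => field (v (τ n))) (field vlim) := by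
  have hd := fun n => (hv n).mem_domain_one 𝔅
  have hL2 := tendsto_field_of_normV hlim
  have hc : ∀ m, Tendsto (fun n => inner ℝ (field (𝔅.φ m)) (field (v n))) atTop
      (𝓝 (inner ℝ (field (𝔅.φ m)) (field vlim))) := fun m =>
    ((innerSL ℝ (field (𝔅.φ m))).continuous.tendsto _).comp hL2
  obtain ⟨hw, -⟩ := 𝔅.mem_domain_of_tendsto (norm_nonneg g) (fun n => (hd n).1)
    (fun n => (hd n).2) (field_mem_spaceH vlim) hc
  have h0 := 𝔅.tendsto_norm_pow_sub (h01 0).2 (fun n => (hd n).1) (fun n => (hd n).2) hw hc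
  exact exists_hasStrictExpansion (𝔅.nested s hs) Nat.hyperfilter_le_atTop
    (𝔅.nested_compactAlong hs (fun k => by linarith [(h01 k).1]) _)
    (fun n => 𝔅.domain_le (h01 0).2.le (hd n).1) (𝔅.domain_le (h01 0).2.le hw) h0

theorem exists_strictAnti_exponents {s : ℝ} (hs : s ∈ Set.Ico (1 / 2 : ℝ) 1) :
    ∃ t : ℕ → ℝ, StrictAnti t ∧ (∀ k, t k ∈ Set.Ioo (1 / 2 : ℝ) 1) ∧ ∀ k, s ≤ t k := by
  obtain ⟨t, h1, h2, -⟩ := exists_seq_strictAnti_tendsto' hs.2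
  exact ⟨t, h1, fun k => ⟨hs.1.trans_lt (h2 k).1, (h2 k).2⟩, fun k => (h2 k).1.le⟩

end NSE

end

/-! ### Expansions of sequences of steady states. -/

theorem theorem4p1 (g : NSE.L2) (hg : g ∈ NSE.spaceH) (hg0 : g ≠ 0)
    (α : ℕ → ℝ) (hα0 : ∀ n, 0 < α n) (hα : Tendsto α atTop atTop)
    (v : ℕ → NSE.spaceV) (hv : ∀ n, NSE.IsSteadyState (α n) g (v n)) :
    Nonempty NSE.StokesEigenbasis ∧
    ∀ 𝔅 : NSE.StokesEigenbasis,
      (∀ n, NSE.field (v n) ∈ (𝔅.D 1).carrier ∧ (𝔅.D 1).norm (NSE.field (v n)) ≤ ‖g‖) ∧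
      (∃ (vlim : NSE.spaceV) (σ : ℕ → ℕ), StrictMono σ ∧
        Tendsto (fun n => NSE.normV (v (σ n) - vlim)) atTop (𝓝 0)) ∧
      ∀ (vlim : NSE.spaceV) (σ : ℕ → ℕ), StrictMono σ →
        Tendsto (fun n => NSE.normV (v (σ n) - vlim)) atTop (𝓝 0) →
        (∀ (s : ℕ → ℝ) (hs : StrictAnti s), (∀ k, s k ∈ Set.Ioo (1 / 2 : ℝ) 1) →
          ∃ τ : ℕ → ℕ, StrictMono τ ∧
            HasStrictExpansion (𝔅.nested s hs)
              (fun n => NSE.field (v (σ (τ n)))) (NSE.field vlim)) ∧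
        (∀ s ∈ Set.Ico (1 / 2 : ℝ) 1,
          ∃ τ : ℕ → ℕ, StrictMono τ ∧
            (HasUnitaryExpansion (NestedSpaces.const (𝔅.D s))
                (fun n => NSE.field (v (σ (τ n)))) (NSE.field vlim) ∨
             HasDegenerateExpansion (NestedSpaces.const (𝔅.D s))
                (fun n => NSE.field (v (σ (τ n)))) (NSE.field vlim))) := by
  refine ⟨NSE.nonempty_stokesEigenbasis, fun 𝔅 => ⟨fun n => (hv n).mem_domain_one 𝔅,
    NSE.exists_subseq_tendsto_normV 𝔅 hv, fun vlim σ _ hlim => ⟨fun s hs h01 => ?_,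
    fun s hs => ?_⟩⟩⟩
  · exact NSE.exists_strictExpansion_of_tendsto 𝔅 (fun n => hv (σ n)) hlim hs h01
  -- A single space offers no compactness, so the strict expansion is built in auxiliary spaces
  -- `D(A^{t k})` with `s ≤ t k < 1`, all continuously embedded in `D(A^s)`.
  · obtain ⟨t, ht, h01, hst⟩ := NSE.exists_strictAnti_exponents hs
    obtain ⟨τ, hτ, h⟩ := NSE.exists_strictExpansion_of_tendsto 𝔅 (fun n => hv (σ n)) hlim ht h01
    exact ⟨τ, hτ, h.unitary_or_degenerate (fun k => 𝔅.domain_le (hst k))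
      fun k => ⟨_, fun _ hu => 𝔅.norm_pow_le (hst k) hu⟩⟩
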